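/- **Setting.** Let $\mathbb K$ be a field and $n\ge 3$. The monoid $\mathrm{GVB}_n^+$ is presented by generators $\sigma_1,\dots,\sigma_{n-1},\xi_1,\dots,\xi_{n-1}$ and relations: $\sigma_a\sigma_b=\sigma_b\sigma_a$, $\sigma_a\xi_b=\xi_b\sigma_a$, $\xi_a\xi_b=\xi_b\xi_a$ for $|a-b|>1$; and, for $1\le a\le n-2$, $\sigma_a\sigma_{a+1}\sigma_a=\sigma_{a+1}\sigma_a\sigma_{a+1}$, $\xi_a\xi_{a+1}\xi_a=\xi_{a+1}\xi_a\xi_{a+1}$, $\xi_a\sigma_{a+1}\sigma_a=\sigma_{a+1}\sigma_a\xi_{a+1}$, $\xi_{a+1}\sigma_a\sigma_{a+1}=\sigma_a\sigma_{a+1}\xi_a$. For $\tau\in\mathrm{GVB}_n^+$ let $l_v(\tau)$ be the number of letters $\xi_a$ in any word representing $\tau$. **Permutations.** View $s\in\mathfrak S_n$ as moving the factor in position $a$ to position $s(a)$, with product the composition of maps, and let $s_a=(a,a+1)$. An index $a\in\{1,\dots,n-1\}$ is a descent of $s$ if $s(a)>s(a+1)$; $\mathrm{des}_n(\le I)$ is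 the set of $s\in\mathfrak S_n$ all of whose descents lie in $I$. For $k+p+q\le n$, let $\mathfrak S_{p,q}^{\uparrow k}\subset\mathfrak S_n$ be the set of permutations that fix all positions outside $\{k+1,\dots,k+p+q\}$ and are increasing on $\{k+1,\dots,k+p\}$ and on $\{k+p+1,\dots,k+p+q\}$; put $\mathfrak S_{p,q}=\mathfrak S_{p,q}^{\uparrow0}$. For $s\in\mathfrak S_n$ fixing the last $l$ positions, let $s^{\uparrow l}$ be the permutation that fixes the first $l$ positions and sends $a+l$ to $s(a)+l$ for $1\le a\le n-l$. **Lifts.** Every $s\in\mathfrak S_n$ is uniquely a product $s=s^{(n-1)}\cdots s^{(2)}s^{(1)}$ with $s^{(k)}\in\mathfrak S_{k,1}$; if $s^{(k)}\ne e$, then $s^{(k)}=s_{t_k}s_{t_k+1}\cdots s_k$ with $1\le t_k\le k$; if $s^{(k)}=e$, put $t_k=0$; also put $t_n=0$. Define $$L(s)=\prod_{k:\ s^{(k)}\neq e}\bigl(\sigma_{t_k}+(1-\delta_{t_k+1,\,t_{k+1}})\,\sigma_1\cdots\sigma_{t_k-1}\,\xi_{t_k}\bigr)\,\sigma_{t_k+1}\cdots\sigma_k\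 \in\ \mathbb K[\mathrm{GVB}_n^+],$$ the product being taken in decreasing order of $k$ from left to right. For $s\in\mathfrak S_n$ and $\tau\in\mathrm{GVB}_n^+$ with $l=l_v(\tau)$, define, and extend linearly in $\tau$, * $\mathbf M_{p,q}(s,\tau)=L(s)\,\tau$ if $p-l>0$ and $s\in\mathfrak S_{p-l,q}^{\uparrow l}$, and $\mathbf M_{p,q}(s,\tau)=0$ otherwise; * $\mathbf M'_{p,q}(s,\tau)=L(s^{\uparrow l})\,\tau$ if $p+q=n$, $q-l>0$ and $s\in\mathfrak S_{p,q-l}$, and $\mathbf M'_{p,q}(s,\tau)=0$ otherwise. Let $I=\{i,j\}$ with $1\le i<j\le n-1$. Every $s\in\mathrm{des}_n(\le I)$ can be written uniquely as $s=s_Ls_R$ with $(s_L,s_R)\in\mathfrak S_{j,n-j}\times\mathfrak S_{i,j-i}$, and uniquely as $s=s_L's_R'$ with $(s_L',s_R')\in\mathfrak S_{i,n-i}\times\mathfrak S_{j-i,n-j}^{\uparrow i}$. Put $$Q_{\le I}(s)=\mathbf M_{j,n-j}\bigl(s_L,L(s_R)\bigr),\qquad Q'_{\le I}(s)=\mathbf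 M'_{i,n-i}\bigl(s_L',L(s_R')\bigr).$$ **Action.** Let $(\widehat V,\sigma,m)$ be a braided algebra over $\mathbb K$: a vector space with linear maps $\sigma:\widehat V^{\otimes2}\to\widehat V^{\otimes2}$ and $m:\widehat V^{\otimes 2}\to\widehat V$ such that $m$ is associative, $(\sigma\otimes\mathrm{id})(\mathrm{id}\otimes\sigma)(\sigma\otimes\mathrm{id})=(\mathrm{id}\otimes\sigma)(\sigma\otimes\mathrm{id})(\mathrm{id}\otimes\sigma)$, $\sigma(m\otimes\mathrm{id})=(\mathrm{id}\otimes m)(\sigma\otimes\mathrm{id})(\mathrm{id}\otimes\sigma)$ and $\sigma(\mathrm{id}\otimes m)=(m\otimes\mathrm{id})(\mathrm{id}\otimes\sigma)(\sigma\otimes\mathrm{id})$. Let $\mathbf 1\in\widehat V$ satisfy $m(\mathbf1\otimes v)=m(v\otimes\mathbf1)=v$, $\sigma(\mathbf1\otimes v)=v\otimes\mathbf1$ and $\sigma(v\otimes\mathbf1)=\mathbf1\otimes v$ for all $v\in\widehat V$. Put $\sigma^m(v\otimes w)=\mathbf1\otimes m(v\otimes w)$. Then $\mathbb K[\mathrm{GVB}_n^+]$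 acts on $\widehat V^{\otimes n}$ by $$\sigma_a\mapsto\mathrm{id}^{\otimes(a-1)}\otimes\sigma\otimes\mathrm{id}^{\otimes(n-a-1)},\qquad \xi_a\mapsto\mathrm{id}^{\otimes(a-1)}\otimes\sigma^m\otimes\mathrm{id}^{\otimes(n-a-1)}.$$ **Corollary.** For all $1\le i<j\le n-1$ and $I=\{i,j\}$, the elements $$\sum_{s\in\mathrm{des}_n(\le I)}Q_{\le I}(s)\qquad\text{and}\qquad\sum_{s\in\mathrm{des}_n(\le I)}Q'_{\le I}(s)$$ have the same image in $\mathrm{End}(\widehat V^{\otimes n})$, for every such $(\widehat V,\sigma,m,\mathbf1)$; but they are different elements of $\mathbb K[\mathrm{GVB}_n^+]$. -/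

import Mathlib

open scoped TensorProduct

noncomputable section

namespace TensorSlots

variable {K : Type*} [Field K] {V : Type*} [AddCommGroup V] [Module K V]

/-- `ins v a b _ (x ⊗ y)` is the pure tensor obtained from `v` by putting `x` in slot `a` and
`y` in slot `b`. -/
def ins {n : ℕ} (v : Fin n → V) (a b : Fin n) (h : a ≠ b) : V ⊗[K] V →ₗ[K] ⨂[K]^n V :=
  TensorProduct.lift <| LinearMap.mk₂ K
    (fun x y => PiTensorProduct.tprod K (Function.update (Function.update v a x) b y))
    (by intro x x' y; simp only [Function.update_comm h, MultilinearMap.map_update_add])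
    (by intro c x y; simp only [Function.update_comm h, MultilinearMap.map_update_smul])
    (by intro x y y'; simp only [MultilinearMap.map_update_add])
    (by intro c x y; simp only [MultilinearMap.map_update_smul])

@[simp] theorem ins_tmul {n : ℕ} (v : Fin n → V) (a b : Fin n) (h : a ≠ b) (x y : V) :
    ins (K := K) v a b h (x ⊗ₜ y) =
      PiTensorProduct.tprod K (Function.update (Function.update v a x) b y) := rfl

theorem ins_update_left {n : ℕ} (v : Fin n → V) (a b : Fin n) (h : a ≠ b) (x : V) :
    ins (K := K) (Function.update v a x) a b h = ins v a b h := by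
  ext y z; simp

theorem ins_update_right {n : ℕ} (v : Fin n → V) (a b : Fin n) (h : a ≠ b) (x : V) :
    ins (K := K) (Function.update v b x) a b h = ins v a b h := by
  ext y z; simp [Function.update_comm h]

theorem ins_update_add {n : ℕ} (v : Fin n → V) (a b c : Fin n) (h : a ≠ b) (ha : c ≠ a)
    (hb : c ≠ b) (x y : V) :
    ins (K := K) (Function.update v c (x + y)) a b h =
      ins (Function.update v c x) a b h + ins (Function.update v c y) a b h := by
  ext z w
  simp [Function.update_comm ha, Function.update_comm hb]

theorem ins_update_smul {n : ℕ} (v : Fin n → V) (a b c : Fin n) (h : a ≠ b) (ha : c ≠ a)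
    (hb : c ≠ b) (r : K) (x : V) :
    ins (K := K) (Function.update v c (r • x)) a b h =
      r • ins (Function.update v c x) a b h := by
  ext z w
  simp [Function.update_comm ha, Function.update_comm hb]

/-- The operator on `V^{⊗ n}` applying `f : V ⊗ V → V ⊗ V` to the tensor factors in the slots
`a` and `b` (in this order) and the identity to the others. -/
def slotOp {n : ℕ} (f : Module.End K (V ⊗[K] V)) (a b : Fin n) (h : a ≠ b) :
    Module.End K (⨂[K]^n V) :=
  PiTensorProduct.lift <| MultilinearMap.mk' (fun v => ins v a b h (f (v a ⊗ₜ[K] v b)))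
    (by
      intro v c x y
      by_cases ha : c = a
      · subst ha
        simp [ins_update_left, Function.update_of_ne h.symm, TensorProduct.add_tmul]
      by_cases hb : c = b
      · subst hb
        simp [ins_update_right, Function.update_of_ne h, TensorProduct.tmul_add]
      simp [ins_update_add v a b c h ha hb, Function.update_of_ne (Ne.symm ha),
        Function.update_of_ne (Ne.symm hb)])
    (by
      intro v c r x
      by_cases ha : c = a
      · subst ha
        simp [ins_update_left, Function.update_of_ne h.symm, ← TensorProduct.smul_tmul']
      by_cases hb : c = b
      · subst hb
        simp [ins_update_right, Function.update_of_ne h]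
      simp [ins_update_smul v a b c h ha hb, Function.update_of_ne (Ne.symm ha),
        Function.update_of_ne (Ne.symm hb)])

@[simp] theorem slotOp_tprod {n : ℕ} (f : Module.End K (V ⊗[K] V)) (a b : Fin n) (h : a ≠ b)
    (v : Fin n → V) :
    slotOp f a b h (PiTensorProduct.tprod K v) = ins v a b h (f (v a ⊗ₜ[K] v b)) := by
  simp [slotOp]

/-- `f ⊗ id` on `V ⊗ V ⊗ V`. -/
def on12 (f : Module.End K (V ⊗[K] V)) : Module.End K (V ⊗[K] (V ⊗[K] V)) :=
  (TensorProduct.assoc K V V V).toLinearMap ∘ₗ f.rTensor V ∘ₗ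
    (TensorProduct.assoc K V V V).symm.toLinearMap

/-- `id ⊗ f` on `V ⊗ V ⊗ V`. -/
def on23 (f : Module.End K (V ⊗[K] V)) : Module.End K (V ⊗[K] (V ⊗[K] V)) :=
  f.lTensor V

/-- Insertion of three tensor factors in the slots `a`, `b`, `c` of a pure tensor. -/
def ins₃ {n : ℕ} (v : Fin n → V) (a b c : Fin n) (hab : a ≠ b) (hac : a ≠ c) (hbc : b ≠ c) :
    V ⊗[K] (V ⊗[K] V) →ₗ[K] ⨂[K]^n V :=
  TensorProduct.lift
    { toFun := fun x => ins (Function.update v a x) b c hbc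
      map_add' := fun x y => ins_update_add v b c a hbc hab hac x y
      map_smul' := fun r x => ins_update_smul v b c a hbc hab hac r x }

section three

variable {n : ℕ} (v : Fin n → V) (a b c : Fin n) (hab : a ≠ b) (hac : a ≠ c) (hbc : b ≠ c)
  (f : Module.End K (V ⊗[K] V))

@[simp] theorem ins₃_tmul (x : V) (w : V ⊗[K] V) :
    ins₃ v a b c hab hac hbc (x ⊗ₜ w) = ins (Function.update v a x) b c hbc w := rfl

theorem slotOp_ins₃_left :
    slotOp f a b hab ∘ₗ ins₃ v a b c hab hac hbc = ins₃ v a b c hab hac hbc ∘ₗ on12 f := by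
  ext x y z
  have key : ∀ w : V ⊗[K] V,
      ins (K := K) (Function.update (Function.update (Function.update v a x) b y) c z) a b hab w =
      ins₃ v a b c hab hac hbc ((TensorProduct.assoc K V V V) (w ⊗ₜ z)) := by
    intro w
    induction w with
    | zero => simp
    | add w w' hw hw' => simp [hw, hw', TensorProduct.add_tmul]
    | tmul p q =>
      simp only [ins_tmul, TensorProduct.assoc_tmul, ins₃_tmul]
      congr 1
      funext i
      simp only [Function.update_apply]
      split_ifs <;> simp_all
  simpa [on12, Function.update_of_ne hab, Function.update_of_ne hac, Function.update_of_ne hbc]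
    using key (f (x ⊗ₜ y))

theorem slotOp_ins₃_right :
    slotOp f b c hbc ∘ₗ ins₃ v a b c hab hac hbc = ins₃ v a b c hab hac hbc ∘ₗ on23 f := by
  ext x y z
  simp [on23, Function.update_of_ne hbc, ins_update_right]
  rw [ins_update_left]

theorem ins₃_self :
    ins₃ (K := K) v a b c hab hac hbc (v a ⊗ₜ (v b ⊗ₜ v c)) = PiTensorProduct.tprod K v := by
  simp

end three

/-- Equality of words in `f ⊗ id`, `id ⊗ f` on three factors gives the same equality on any three
slots. -/
theorem slotOp_word₃ {n : ℕ} (a b c : Fin n) (hab : a ≠ b) (hac : a ≠ c) (hbc : b ≠ c)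
    (f₁ f₂ f₃ g₁ g₂ g₃ : Module.End K (V ⊗[K] V))
    (h : on12 f₁ * on23 f₂ * on12 f₃ = on23 g₁ * on12 g₂ * on23 g₃) :
    slotOp f₁ a b hab * slotOp f₂ b c hbc * slotOp f₃ a b hab =
      slotOp g₁ b c hbc * slotOp g₂ a b hab * slotOp g₃ b c hbc := by
  apply PiTensorProduct.ext
  ext v
  have L := fun (f : Module.End K (V ⊗[K] V)) w =>
    LinearMap.congr_fun (slotOp_ins₃_left v a b c hab hac hbc f) w
  have R := fun (f : Module.End K (V ⊗[K] V)) w =>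
    LinearMap.congr_fun (slotOp_ins₃_right v a b c hab hac hbc f) w
  simp only [LinearMap.comp_apply] at L R
  have h' := congrArg (ins₃ v a b c hab hac hbc)
    (LinearMap.congr_fun h (v a ⊗ₜ (v b ⊗ₜ v c)))
  simp only [Module.End.mul_apply] at h'
  simp only [LinearMap.compMultilinearMap_apply, Module.End.mul_apply]
  rw [← ins₃_self (K := K) v a b c hab hac hbc, L, R, L, R, L, R, h']

/-- Insertion of two pairs of tensor factors in the slots `a`, `b` and `c`, `d`. -/
def ins₂₂ {n : ℕ} (v : Fin n → V) (a b c d : Fin n) (hab : a ≠ b) (hcd : c ≠ d)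
    (hac : a ≠ c) (had : a ≠ d) (hbc : b ≠ c) (hbd : b ≠ d) :
    V ⊗[K] V →ₗ[K] V ⊗[K] V →ₗ[K] ⨂[K]^n V :=
  TensorProduct.lift <| LinearMap.mk₂ K
    (fun x y => ins (Function.update (Function.update v a x) b y) c d hcd)
    (by intro x x' y; simp only [Function.update_comm hab, ins_update_add _ c d a hcd hac had])
    (by intro r x y; simp only [Function.update_comm hab, ins_update_smul _ c d a hcd hac had])
    (by intro x y y'; simp only [ins_update_add _ c d b hcd hbc hbd])
    (by intro r x y; simp only [ins_update_smul _ c d b hcd hbc hbd])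

theorem slotOp_comm {n : ℕ} (a b c d : Fin n) (hab : a ≠ b) (hcd : c ≠ d)
    (hac : a ≠ c) (had : a ≠ d) (hbc : b ≠ c) (hbd : b ≠ d) (f g : Module.End K (V ⊗[K] V)) :
    slotOp f a b hab * slotOp g c d hcd = slotOp g c d hcd * slotOp f a b hab := by
  apply PiTensorProduct.ext
  ext v
  have tm : ∀ (x y : V) (z : V ⊗[K] V), ins₂₂ v a b c d hab hcd hac had hbc hbd (x ⊗ₜ y) z =
      ins (Function.update (Function.update v a x) b y) c d hcd z := fun _ _ _ => rfl
  have R : ∀ w z : V ⊗[K] V, slotOp g c d hcd (ins₂₂ v a b c d hab hcd hac had hbc hbd w z) =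
      ins₂₂ v a b c d hab hcd hac had hbc hbd w (g z) := by
    intro w z
    induction w with
    | zero => simp
    | add w w' hw hw' => simp [hw, hw']
    | tmul p q =>
      induction z with
      | zero => simp
      | add z z' hz hz' => simp [hz, hz']
      | tmul x y =>
        simp [tm, Function.update_of_ne hcd, ins_update_right]
        rw [ins_update_left]
  have L : ∀ w z : V ⊗[K] V, slotOp f a b hab (ins₂₂ v a b c d hab hcd hac had hbc hbd w z) =
      ins₂₂ v a b c d hab hcd hac had hbc hbd (f w) z := by
    intro w z
    induction z with
    | zero => simp
    | add z z' hz hz' => simp [hz, hz']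
    | tmul x y =>
      have key : ∀ (p q : V) (u : V ⊗[K] V), ins (K := K) (Function.update (Function.update
          (Function.update (Function.update v a p) b q) c x) d y) a b hab u =
          ins₂₂ v a b c d hab hcd hac had hbc hbd u (x ⊗ₜ y) := by
        intro p q u
        induction u with
        | zero => simp
        | add u u' hu hu' => simp [hu, hu']
        | tmul r s =>
          simp only [ins_tmul, tm]
          congr 1
          funext i
          simp only [Function.update_apply]
          clear tm R
          grind
      induction w with
      | zero => simp
      | add w w' hw hw' => simp [hw, hw']
      | tmul p q =>
        rw [tm, ins_tmul, slotOp_tprod, key]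
        simp [Function.update_of_ne hab, Function.update_of_ne hac, Function.update_of_ne had,
          Function.update_of_ne hbc, Function.update_of_ne hbd]
  have self : PiTensorProduct.tprod K v =
      ins₂₂ v a b c d hab hcd hac had hbc hbd (v a ⊗ₜ v b) (v c ⊗ₜ v d) := by
    simp [tm]
  simp only [LinearMap.compMultilinearMap_apply, Module.End.mul_apply]
  rw [self, R, L, L, R]

end TensorSlots

/-! # Braided algebras -/

open TensorSlots in
/-- A braided algebra `(V, σ, m)`: a braiding `σ` (a solution of the braid equation on
`V ⊗ V ⊗ V`) and an associative product `m`, compatible with each other. -/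
structure BraidedAlgebra (K : Type*) [Field K] (V : Type*) [AddCommGroup V] [Module K V] where
  /-- the braiding `σ : V ⊗ V → V ⊗ V` -/
  braid : V ⊗[K] V →ₗ[K] V ⊗[K] V
  /-- the product `m : V ⊗ V → V` -/
  mul : V ⊗[K] V →ₗ[K] V
  /-- `(σ ⊗ id)(id ⊗ σ)(σ ⊗ id) = (id ⊗ σ)(σ ⊗ id)(id ⊗ σ)` -/
  braid_eq : on12 braid * on23 braid * on12 braid = on23 braid * on12 braid * on23 braid
  mul_assoc : ∀ x y z : V, mul (mul (x ⊗ₜ y) ⊗ₜ z) = mul (x ⊗ₜ mul (y ⊗ₜ z))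
  /-- `σ (m ⊗ id) = (id ⊗ m)(σ ⊗ id)(id ⊗ σ)` -/
  braid_mul_left : braid ∘ₗ mul.rTensor V ∘ₗ (TensorProduct.assoc K V V V).symm.toLinearMap =
    mul.lTensor V ∘ₗ on12 braid ∘ₗ on23 braid
  /-- `σ (id ⊗ m) = (m ⊗ id)(id ⊗ σ)(σ ⊗ id)` -/
  braid_mul_right : braid ∘ₗ mul.lTensor V =
    mul.rTensor V ∘ₗ (TensorProduct.assoc K V V V).symm.toLinearMap ∘ₗ on23 braid ∘ₗ on12 braid

/-- A braided algebra with a specified element `𝟏` that is a unit for the product and is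
transported trivially by the braiding. -/
structure UnitalBraidedAlgebra (K : Type*) [Field K] (V : Type*) [AddCommGroup V] [Module K V]
    extends BraidedAlgebra K V where
  /-- the specified element `𝟏` -/
  one : V
  one_mul : ∀ v : V, mul (one ⊗ₜ v) = v
  mul_one : ∀ v : V, mul (v ⊗ₜ one) = v
  braid_one_left : ∀ v : V, braid (one ⊗ₜ v) = v ⊗ₜ one
  braid_one_right : ∀ v : V, braid (v ⊗ₜ one) = one ⊗ₜ v

namespace UnitalBraidedAlgebra

open TensorSlots

variable {K : Type*} [Field K] {V : Type*} [AddCommGroup V] [Module K V]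
  (A : UnitalBraidedAlgebra K V)

/-- The map `σ^m : v ⊗ w ↦ 𝟏 ⊗ m (v ⊗ w)`. -/
def braidMul : V ⊗[K] V →ₗ[K] V ⊗[K] V :=
  TensorProduct.mk K V V A.one ∘ₗ A.mul

@[simp] theorem braidMul_apply (x : V ⊗[K] V) : A.braidMul x = A.one ⊗ₜ A.mul x := rfl

theorem on12_braidMul (x y z : V) :
    on12 A.braidMul (x ⊗ₜ (y ⊗ₜ z)) = A.one ⊗ₜ (A.mul (x ⊗ₜ y) ⊗ₜ z) := by
  simp [on12]

theorem on12_braidMul' (x : V ⊗[K] (V ⊗[K] V)) :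
    on12 A.braidMul x =
      A.one ⊗ₜ (A.mul.rTensor V ((TensorProduct.assoc K V V V).symm x)) := by
  have : on12 A.braidMul = TensorProduct.mk K V (V ⊗[K] V) A.one ∘ₗ A.mul.rTensor V ∘ₗ
      (TensorProduct.assoc K V V V).symm.toLinearMap := by
    ext x y z
    simp [on12]
  rw [this]; rfl

theorem on23_braidMul (x y z : V) :
    on23 A.braidMul (x ⊗ₜ (y ⊗ₜ z)) = x ⊗ₜ (A.one ⊗ₜ A.mul (y ⊗ₜ z)) := by
  simp [on23]

/-- on `V ⊗ V ⊗ V`: `ξ₁ ξ₂ ξ₁ = ξ₂ ξ₁ ξ₂` -/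
theorem word_xxx : on12 A.braidMul * on23 A.braidMul * on12 A.braidMul =
    on23 A.braidMul * on12 A.braidMul * on23 A.braidMul := by
  ext x y z
  simp [on12_braidMul, on23_braidMul, A.mul_assoc, A.one_mul, A.mul_one]

/-- on `V ⊗ V ⊗ V`: `ξ₁ σ₂ σ₁ = σ₂ σ₁ ξ₂` -/
theorem word_xss : on12 A.braidMul * on23 A.braid * on12 A.braid =
    on23 A.braid * on12 A.braid * on23 A.braidMul := by
  ext x y z
  have h := LinearMap.congr_fun A.braid_mul_right (x ⊗ₜ (y ⊗ₜ z))
  simp only [LinearMap.comp_apply, LinearMap.lTensor_tmul, LinearEquiv.coe_coe] at h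
  simp [on12_braidMul', ← h]
  simp [on12, on23, A.braid_one_right]

/-- on `V ⊗ V ⊗ V`: `ξ₂ σ₁ σ₂ = σ₁ σ₂ ξ₁` -/
theorem word_ssx : on12 A.braid * on23 A.braid * on12 A.braidMul =
    on23 A.braidMul * on12 A.braid * on23 A.braid := by
  ext x y z
  have h := LinearMap.congr_fun A.braid_mul_left (x ⊗ₜ (y ⊗ₜ z))
  simp only [LinearMap.comp_apply, LinearEquiv.coe_coe, TensorProduct.assoc_symm_tmul,
    LinearMap.rTensor_tmul] at h
  have e : on23 A.braidMul = (TensorProduct.mk K V V A.one).lTensor V ∘ₗ A.mul.lTensor V := by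
    ext; simp [on23]
  have key : ∀ w : V ⊗[K] V, on12 A.braid (A.one ⊗ₜ w) =
      (TensorProduct.mk K V V A.one).lTensor V w := by
    intro w
    induction w with
    | zero => simp
    | add w w' hw hw' => simp [TensorProduct.tmul_add, hw, hw']
    | tmul p q => simp [on12, A.braid_one_left]
  simp [e, ← h]
  simp [on12_braidMul, on23, key]

end UnitalBraidedAlgebra

/-! # The generalized virtual braid monoid -/

namespace GVB

/-- Generators `σ_1, …, σ_{n-1}`, `ξ_1, …, ξ_{n-1}`; the element `i : Fin (n - 1)` stands for the
index `i + 1`. -/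
inductive Gen (n : ℕ) : Type
  | sigma (i : Fin (n - 1)) : Gen n
  | xi (i : Fin (n - 1)) : Gen n

open FreeMonoid (of) in
/-- Defining relations of the generalized virtual braid monoid. -/
inductive Rel (n : ℕ) : FreeMonoid (Gen n) → FreeMonoid (Gen n) → Prop
  | comm_ss (i j : Fin (n - 1)) (h : (i : ℕ) + 1 < j ∨ (j : ℕ) + 1 < i) :
      Rel n (of (.sigma i) * of (.sigma j)) (of (.sigma j) * of (.sigma i))
  | comm_sx (i j : Fin (n - 1)) (h : (i : ℕ) + 1 < j ∨ (j : ℕ) + 1 < i) :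
      Rel n (of (.sigma i) * of (.xi j)) (of (.xi j) * of (.sigma i))
  | comm_xx (i j : Fin (n - 1)) (h : (i : ℕ) + 1 < j ∨ (j : ℕ) + 1 < i) :
      Rel n (of (.xi i) * of (.xi j)) (of (.xi j) * of (.xi i))
  | braid_sss (i j : Fin (n - 1)) (h : (j : ℕ) = i + 1) :
      Rel n (of (.sigma i) * of (.sigma j) * of (.sigma i))
        (of (.sigma j) * of (.sigma i) * of (.sigma j))
  | braid_xxx (i j : Fin (n - 1)) (h : (j : ℕ) = i + 1) :
      Rel n (of (.xi i) * of (.xi j) * of (.xi i)) (of (.xi j) * of (.xi i) * of (.xi j))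
  | braid_xss (i j : Fin (n - 1)) (h : (j : ℕ) = i + 1) :
      Rel n (of (.xi i) * of (.sigma j) * of (.sigma i))
        (of (.sigma j) * of (.sigma i) * of (.xi j))
  | braid_ssx (i j : Fin (n - 1)) (h : (j : ℕ) = i + 1) :
      Rel n (of (.xi j) * of (.sigma i) * of (.sigma j))
        (of (.sigma i) * of (.sigma j) * of (.xi i))

end GVB

/-- The generalized virtual braid monoid `GVB_n^+`. -/
abbrev GVB (n : ℕ) : Type := PresentedMonoid (GVB.Rel n)

namespace GVB

/-- The number of letters `ξ` of a generator (`0` or `1`). -/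
def Gen.xiCount {n : ℕ} : Gen n → Multiplicative ℕ
  | .sigma _ => Multiplicative.ofAdd 0
  | .xi _ => Multiplicative.ofAdd 1

/-- The virtual length, as a monoid homomorphism. -/
def virtualLengthHom (n : ℕ) : GVB n →* Multiplicative ℕ :=
  PresentedMonoid.lift Gen.xiCount (by
    intro a b h
    cases h <;> simp [Gen.xiCount])

/-- The virtual length `l_v`: the number of occurrences of the letters `ξ_i` in any expression. -/
def virtualLength {n : ℕ} (τ : GVB n) : ℕ := (virtualLengthHom n τ).toAdd

variable (K : Type*) [Field K] (n : ℕ)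

/-- `σ_i ∈ K[GVB_n^+]` for `1 ≤ i ≤ n - 1` (by convention `1` for other values of `i`). -/
def sigma (i : ℕ) : MonoidAlgebra K (GVB n) :=
  if h : 1 ≤ i ∧ i < n then
    MonoidAlgebra.of K (GVB n) (PresentedMonoid.of (Rel n) (.sigma ⟨i - 1, by omega⟩))
  else 1

/-- `ξ_i ∈ K[GVB_n^+]` for `1 ≤ i ≤ n - 1` (by convention `1` for other values of `i`). -/
def xi (i : ℕ) : MonoidAlgebra K (GVB n) :=
  if h : 1 ≤ i ∧ i < n then
    MonoidAlgebra.of K (GVB n) (PresentedMonoid.of (Rel n) (.xi ⟨i - 1, by omega⟩))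
  else 1

/-- `σ_a σ_{a+1} ⋯ σ_{a+m-1}` -/
def sigmaRun (a m : ℕ) : MonoidAlgebra K (GVB n) := ((List.range' a m).map (sigma K n)).prod

end GVB

namespace UnitalBraidedAlgebra

open TensorSlots

variable {K : Type*} [Field K] {V : Type*} [AddCommGroup V] [Module K V]
  (A : UnitalBraidedAlgebra K V)

/-- `id^{⊗ i} ⊗ f ⊗ id^{⊗ (n - i - 2)}` on `V^{⊗ n}`, where `i : Fin (n - 1)` is counted from `0`. -/
def adjacentOp {n : ℕ} (f : Module.End K (V ⊗[K] V)) (i : Fin (n - 1)) :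
    Module.End K (⨂[K]^n V) :=
  slotOp f (⟨i, by omega⟩ : Fin n) ⟨i + 1, by omega⟩ (by simp)

/-- The operators by which the generators act on `V^{⊗ n}`: `σ_i` through the braiding `σ`, and
`ξ_i` through `σ^m`. -/
def genOp (n : ℕ) : GVB.Gen n → Module.End K (⨂[K]^n V)
  | .sigma i => adjacentOp A.braid i
  | .xi i => adjacentOp A.braidMul i

theorem adjacentOp_comm {n : ℕ} (f g : Module.End K (V ⊗[K] V)) (i j : Fin (n - 1))
    (h : (i : ℕ) + 1 < j ∨ (j : ℕ) + 1 < i) :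
    adjacentOp f i * adjacentOp g j = adjacentOp g j * adjacentOp f i := by
  apply slotOp_comm <;> simp only [ne_eq, Fin.mk.injEq] <;> omega

theorem adjacentOp_word {n : ℕ} (i j : Fin (n - 1)) (h : (j : ℕ) = i + 1)
    (f₁ f₂ f₃ g₁ g₂ g₃ : Module.End K (V ⊗[K] V))
    (e : on12 f₁ * on23 f₂ * on12 f₃ = on23 g₁ * on12 g₂ * on23 g₃) :
    adjacentOp f₁ i * adjacentOp f₂ j * adjacentOp f₃ i =
      adjacentOp g₁ j * adjacentOp g₂ i * adjacentOp g₃ j := by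
  obtain ⟨j, hj⟩ := j
  obtain rfl : j = i + 1 := h
  exact slotOp_word₃ _ _ _ _ (by simp; omega) _ f₁ f₂ f₃ g₁ g₂ g₃ e

/-- The action of the monoid `GVB_n^+` on `V^{⊗ n}`. -/
def action (n : ℕ) : GVB n →* Module.End K (⨂[K]^n V) :=
  PresentedMonoid.lift (A.genOp n) (by
    intro a b h
    cases h with
    | comm_ss i j h => simpa [genOp] using adjacentOp_comm _ _ i j h
    | comm_sx i j h => simpa [genOp] using adjacentOp_comm _ _ i j h
    | comm_xx i j h => simpa [genOp] using adjacentOp_comm _ _ i j h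
    | braid_sss i j h => simpa [genOp] using adjacentOp_word i j h _ _ _ _ _ _ A.braid_eq
    | braid_xxx i j h => simpa [genOp] using adjacentOp_word i j h _ _ _ _ _ _ A.word_xxx
    | braid_xss i j h => simpa [genOp] using adjacentOp_word i j h _ _ _ _ _ _ A.word_xss
    | braid_ssx i j h =>
      simpa [genOp] using (adjacentOp_word i j h _ _ _ _ _ _ A.word_ssx).symm)

/-- The representation of the algebra `K[GVB_n^+]` on `V^{⊗ n}`. -/
def rep (n : ℕ) : MonoidAlgebra K (GVB n) →ₐ[K] Module.End K (⨂[K]^n V) :=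
  MonoidAlgebra.lift K _ _ (A.action n)

end UnitalBraidedAlgebra

/-! # Permutations: shuffles, descents, bubble decomposition

A permutation `σ : Equiv.Perm (Fin n)` moves the tensor factor in position `a` to position `σ a`,
so that the product of permutations is the composition of the moves.  Positions are counted from
`0` in `Fin n`, while the indices of `s_i`, `σ_i`, `ξ_i` and of descents are counted from `1`. -/

namespace Lifting

open Equiv

/-- The set `𝔖_{p,q}^{↑ k} ⊆ 𝔖_n` of `(p,q)`-shuffles acting on the `p + q` positions following the
first `k` ones: the other positions are fixed, and the order within the first `p` and within the
last `q` of these `p + q` positions is kept. -/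
def shuffles (n p q k : ℕ) : Set (Perm (Fin n)) :=
  {σ | (∀ a : Fin n, (a : ℕ) < k ∨ k + p + q ≤ a → σ a = a) ∧
    (∀ a b : Fin n, k ≤ (a : ℕ) → a < b → (b : ℕ) < k + p → σ a < σ b) ∧
    (∀ a b : Fin n, k + p ≤ (a : ℕ) → a < b → (b : ℕ) < k + p + q → σ a < σ b)}

/-- The descent set: `i ∈ {1, …, n - 1}` is a descent of `σ` if the `i`-th tensor factor is moved to
a position behind the one to which the `(i + 1)`-st is moved. -/
def descents {n : ℕ} (σ : Perm (Fin n)) : Set ℕ :=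
  {i | ∃ h : 1 ≤ i ∧ i < n, σ ⟨i, h.2⟩ < σ ⟨i - 1, by omega⟩}

open Classical in
/-- The set `des_n(≤ I)` of permutations all of whose descents lie in `I`. -/
def desLE (n : ℕ) (I : Set ℕ) : Finset (Perm (Fin n)) :=
  Finset.univ.filter fun σ => descents σ ⊆ I

/-- The simple transposition `s_i = (i, i + 1)` for `1 ≤ i ≤ n - 1` (by convention `1` for other
values of `i`). -/
def simple (n i : ℕ) : Perm (Fin n) :=
  if h : 1 ≤ i ∧ i < n then swap ⟨i - 1, by omega⟩ ⟨i, h.2⟩ else 1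

/-- `s_a s_{a+1} ⋯ s_{a+m-1}` -/
def simpleRun (n a m : ℕ) : Perm (Fin n) := ((List.range' a m).map (simple n)).prod

/-- The index `t_k(σ)` of the bubble decomposition, `0` if the `k`-th component is trivial: the
rank of the image of position `k + 1` among those of positions `1, …, k + 1`, if it is at most
`k`. -/
def bubbleIdx {n : ℕ} (σ : Perm (Fin n)) (k : ℕ) : ℕ :=
  if h : k < n then
    let r := 1 + (Finset.univ.filter fun a : Fin n => (a : ℕ) < k ∧ σ a < σ ⟨k, h⟩).card
    if r ≤ k then r else 0
  else 0

/-- The component `σ^{(k)} ∈ 𝔖_{k,1}` of the bubble decomposition, which is `s_{t_k} ⋯ s_k` or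
trivial. -/
def bubblePart {n : ℕ} (σ : Perm (Fin n)) (k : ℕ) : Perm (Fin n) :=
  if bubbleIdx σ k = 0 then 1 else simpleRun n (bubbleIdx σ k) (k + 1 - bubbleIdx σ k)

theorem bubbleIdx_le {n : ℕ} (σ : Perm (Fin n)) (k : ℕ) : bubbleIdx σ k ≤ k := by
  unfold bubbleIdx
  split_ifs with h
  · dsimp only
    split_ifs <;> omega
  · omega

theorem simple_apply {n i : ℕ} (h : 1 ≤ i ∧ i < n) (a : Fin n) :
    (simple n i a : ℕ) = if (a : ℕ) = i - 1 then i else if (a : ℕ) = i then i - 1 else a := by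
  simp only [simple, dif_pos h, swap_apply_def, Fin.ext_iff]
  split_ifs <;> simp_all

theorem simpleRun_apply {n t m : ℕ} (ht : 1 ≤ t) (hm : t + m ≤ n) (a : Fin n) :
    (simpleRun n t m a : ℕ) = if (a : ℕ) = t + m - 1 then t - 1
      else if t - 1 ≤ (a : ℕ) ∧ (a : ℕ) < t + m - 1 then a + 1 else a := by
  induction m generalizing a with
  | zero =>
    simp [simpleRun]
    split_ifs <;> omega
  | succ m ih =>
    have e : simpleRun n t (m + 1) = simpleRun n t m * simple n (t + m) := by
      simp [simpleRun, List.range'_concat]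
    rw [e, Perm.mul_apply, ih (by omega), simple_apply (by omega)]
    split_ifs <;> omega

theorem bubblePart_mem_shuffles {n : ℕ} (σ : Perm (Fin n)) {k : ℕ} (hk : k < n) :
    bubblePart σ k ∈ shuffles n k 1 0 := by
  have hle := bubbleIdx_le σ k
  unfold bubblePart
  split_ifs with h
  · exact ⟨fun a _ => rfl, fun a b _ hab _ => hab, fun a b _ hab _ => hab⟩
  · have key := simpleRun_apply (n := n) (t := bubbleIdx σ k) (m := k + 1 - bubbleIdx σ k)
      (by omega) (by omega)
    refine ⟨fun a ha => ?_, fun a b _ hab hb => ?_, fun a b ha hab hb => ?_⟩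
    · rw [Fin.ext_iff, key]; split_ifs <;> omega
    · rw [Fin.lt_def, key, key]; rw [Fin.lt_def] at hab; split_ifs <;> omega
    · rw [Fin.lt_def] at hab; omega

/-- The bubble decomposition `σ = σ^{(n-1)} ⋯ σ^{(2)} σ^{(1)}`. -/
theorem prod_bubblePart {n : ℕ} (σ : Perm (Fin n)) :
    ((List.range (n - 1)).reverse.map fun k => bubblePart σ (k + 1)).prod = σ := by
  have main : ∀ m : ℕ, m < n → ∀ a : Fin n,
      ((((List.range m).reverse.map fun k => bubblePart σ (k + 1)).prod a : Fin n) : ℕ) =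
        if (a : ℕ) ≤ m then
          (Finset.univ.filter fun b : Fin n => (b : ℕ) ≤ m ∧ σ b < σ a).card else a := by
    intro m
    induction m with
    | zero =>
      intro hm a
      simp only [List.range_zero, List.reverse_nil, List.map_nil, List.prod_nil, Perm.one_apply]
      split_ifs with h
      · rw [eq_comm, Nat.le_zero.1 h, Finset.card_eq_zero, Finset.filter_eq_empty_iff]
        rintro b - ⟨hb, hlt⟩
        have : b = a := Fin.ext (by omega)
        subst this
        exact lt_irrefl _ hlt
      · rfl
    | succ m ih =>
      intro hm a
      rw [List.range_succ, List.reverse_append, List.reverse_singleton, List.singleton_append,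
        List.map_cons, List.prod_cons, Perm.mul_apply]
      set P := ((List.range m).reverse.map fun k => bubblePart σ (k + 1)).prod with hP
      have ih' := ih (by omega)
      set R : Fin n → ℕ := fun a =>
        (Finset.univ.filter fun b : Fin n => (b : ℕ) ≤ m ∧ σ b < σ a).card with hR
      let c : Fin n := ⟨m + 1, hm⟩
      have hRle : ∀ a, R a ≤ m + 1 := by
        intro a
        calc R a ≤ (Finset.univ.filter fun b : Fin n => (b : ℕ) < m + 1).card :=
              Finset.card_le_card (by
                intro b; simp only [Finset.mem_filter, Finset.mem_univ, true_and]; omega)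
          _ = m + 1 := by
              rw [Fin.card_filter_val_lt]; omega
      have hidx : bubbleIdx σ (m + 1) = if R c + 1 ≤ m + 1 then R c + 1 else 0 := by
        have : (Finset.univ.filter fun b : Fin n => (b : ℕ) < m + 1 ∧ σ b < σ ⟨m + 1, hm⟩).card
            = R c := by
          simp only [hR, Nat.lt_succ_iff]; rfl
        simp only [bubbleIdx, dif_pos hm, this, add_comm 1]
      have hpart : ∀ x : Fin n, (bubblePart σ (m + 1) x : ℕ) =
          if (x : ℕ) = m + 1 then R c
          else if R c ≤ (x : ℕ) ∧ (x : ℕ) < m + 1 then x + 1 else x := by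
        intro x
        have := hRle c
        unfold bubblePart
        rw [hidx]
        by_cases h : R c + 1 ≤ m + 1
        · rw [if_pos h, if_neg (by omega), simpleRun_apply (by omega) (by omega)]
          split_ifs <;> omega
        · rw [if_neg h, if_pos rfl, Perm.one_apply]
          split_ifs <;> omega
      rw [hpart, ih' a]
      have hsum : (Finset.univ.filter fun b : Fin n => (b : ℕ) ≤ m + 1 ∧ σ b < σ a).card =
          R a + if σ c < σ a then 1 else 0 := by
        by_cases hc : σ c < σ a
        · have : (Finset.univ.filter fun b : Fin n => (b : ℕ) ≤ m + 1 ∧ σ b < σ a) =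
              insert c (Finset.univ.filter fun b : Fin n => (b : ℕ) ≤ m ∧ σ b < σ a) := by
            ext b
            simp only [Finset.mem_filter, Finset.mem_univ, true_and, Finset.mem_insert]
            constructor
            · rintro ⟨h1, h2⟩
              by_cases hb : (b : ℕ) = m + 1
              · exact Or.inl (Fin.ext hb)
              · exact Or.inr ⟨by omega, h2⟩
            · rintro (rfl | ⟨h1, h2⟩)
              · exact ⟨le_refl _, hc⟩
              · exact ⟨by omega, h2⟩
          rw [this, Finset.card_insert_of_notMem (by simp [c]), if_pos hc]
        · rw [if_neg hc, add_zero]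
          congr 1
          ext b
          simp only [Finset.mem_filter, Finset.mem_univ, true_and]
          constructor
          · rintro ⟨h1, h2⟩
            refine ⟨?_, h2⟩
            by_contra hb
            have : b = c := Fin.ext (by simp only [c]; omega)
            exact hc (this ▸ h2)
          · rintro ⟨h1, h2⟩
            exact ⟨by omega, h2⟩
      rw [hsum]
      rcases lt_trichotomy (a : ℕ) (m + 1) with ha | ha | ha
      · rw [if_pos (show (a : ℕ) ≤ m by omega), if_pos (show (a : ℕ) ≤ m + 1 by omega)]
        change (if R a = m + 1 then R c
          else if R c ≤ R a ∧ R a < m + 1 then R a + 1 else R a) = _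
        have hlt : R a < m + 1 := by
          calc R a < (Finset.univ.filter fun b : Fin n => (b : ℕ) < m + 1).card :=
                Finset.card_lt_card (by
                  refine Finset.ssubset_iff_subset_ne.2 ⟨?_, ?_⟩
                  · intro b; simp only [Finset.mem_filter, Finset.mem_univ, true_and]; omega
                  · intro e
                    have : a ∈ (Finset.univ.filter fun b : Fin n => (b : ℕ) < m + 1) := by
                      simpa using ha
                    rw [← e] at this
                    simp at this)
            _ = m + 1 := by
                rw [Fin.card_filter_val_lt]; omega
        by_cases hc : σ c < σ a
        · have : R c ≤ R a := Finset.card_le_card (by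
            intro b; simp only [Finset.mem_filter, Finset.mem_univ, true_and]
            exact fun h => ⟨h.1, h.2.trans hc⟩)
          rw [if_neg (by omega), if_pos ⟨this, hlt⟩, if_pos hc]
        · have hne : a ≠ c := fun h => by
            rw [h] at ha; simp [c] at ha
          have hac : σ a < σ c := lt_of_le_of_ne (not_lt.1 hc) (fun h => hne (σ.injective h))
          have : R a < R c := Finset.card_lt_card (by
            refine Finset.ssubset_iff_subset_ne.2 ⟨?_, ?_⟩
            · intro b; simp only [Finset.mem_filter, Finset.mem_univ, true_and]
              exact fun h => ⟨h.1, h.2.trans hac⟩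
            · intro e
              have : a ∈ (Finset.univ.filter fun b : Fin n => (b : ℕ) ≤ m ∧ σ b < σ c) := by
                simp only [Finset.mem_filter, Finset.mem_univ, true_and]
                exact ⟨by omega, hac⟩
              rw [← e] at this
              simp at this)
          rw [if_neg (by omega), if_neg (by omega), if_neg hc, add_zero]
      · have hac : a = c := Fin.ext ha
        subst hac
        rw [if_neg (show ¬ ((c : Fin n) : ℕ) ≤ m by simp [c]), if_pos ha, if_pos ha.le,
          if_neg (lt_irrefl _), add_zero]
      · rw [if_neg (show ¬ (a : ℕ) ≤ m by omega), if_neg (by omega), if_neg (by omega),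
          if_neg (by omega)]
  rcases Nat.eq_zero_or_pos n with rfl | hn
  · ext a; exact a.elim0
  ext a
  rw [main (n - 1) (by omega) a, if_pos (by omega)]
  have : (Finset.univ.filter fun b : Fin n => (b : ℕ) ≤ n - 1 ∧ σ b < σ a) =
      (Finset.univ.filter fun b : Fin n => b < σ a).map σ.symm.toEmbedding := by
    ext b
    simp only [Finset.mem_filter, Finset.mem_univ, true_and, Finset.mem_map_equiv, symm_symm]
    exact ⟨fun h => h.2, fun h => ⟨by omega, h⟩⟩
  rw [this, Finset.card_map]
  simp only [Fin.lt_def, Fin.card_filter_val_lt]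
  omega

/-! ### Decomposition of permutations with at most two descents into two shuffles -/

/-- Every permutation is, in a unique way, a permutation of the positions `lo, …, hi - 1` followed
by a permutation keeping the order within these positions. -/
theorem existsUnique_block_decomp {n : ℕ} (σ : Perm (Fin n)) (lo hi : ℕ) :
    ∃! p : Perm (Fin n) × Perm (Fin n),
      (∀ a b : Fin n, lo ≤ (a : ℕ) → a < b → (b : ℕ) < hi → p.1 a < p.1 b) ∧
      (∀ a : Fin n, (a : ℕ) < lo ∨ hi ≤ a → p.2 a = a) ∧ p.1 * p.2 = σ := by
  classical
  let p : Fin n → Prop := fun a => lo ≤ (a : ℕ) ∧ (a : ℕ) < hi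
  have hp : ∀ a, ¬ p a ↔ ((a : ℕ) < lo ∨ hi ≤ a) := fun a => by simp only [p]; omega
  apply existsUnique_of_exists_of_unique
  · let S : Finset (Fin n) := Finset.univ.filter p
    let T : Finset (Fin n) := S.map σ.toEmbedding
    have hT : T.card = S.card := Finset.card_map _
    let eS := S.orderIsoOfFin rfl
    let eT := T.orderIsoOfFin hT
    let f : {a // p a} ≃ S := Equiv.subtypeEquivRight fun a => by simp [S]
    let g : S ≃ T := σ.subtypeEquiv fun a => by simp [T]
    let r₀ : Perm {a // p a} := (((f.trans g).trans eT.symm.toEquiv).trans eS.toEquiv).trans f.symm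
    let r : Perm (Fin n) := Perm.ofSubtype r₀
    refine ⟨(σ * r⁻¹, r), ?_, ?_, by simp⟩
    · intro a b ha hab hb
      have hpa : p a := ⟨ha, by rw [Fin.lt_def] at hab; omega⟩
      have hpb : p b := ⟨by rw [Fin.lt_def] at hab; omega, hb⟩
      have key : ∀ a (h : p a), (σ * r⁻¹) a = eT (eS.symm (f ⟨a, h⟩)) := by
        intro a h
        have h1 : r⁻¹ a = (r₀⁻¹ ⟨a, h⟩ : {a // p a}) := by
          rw [Perm.inv_eq_iff_eq, Perm.ofSubtype_apply_coe]; simp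
        rw [Perm.mul_apply, h1]
        change ((g (f (r₀⁻¹ ⟨a, h⟩)) : T) : Fin n) = _
        congr 1
        have : r₀ (r₀⁻¹ ⟨a, h⟩) = ⟨a, h⟩ := by simp
        generalize r₀⁻¹ ⟨a, h⟩ = x at *
        have h2 : f.symm (eS (eT.symm (g (f x)))) = ⟨a, h⟩ := this
        rw [← h2]; simp
      change (σ * r⁻¹) a < (σ * r⁻¹) b
      rw [key a hpa, key b hpb, Subtype.coe_lt_coe, eT.lt_iff_lt, eS.symm.lt_iff_lt]
      exact hab
    · intro a ha
      exact Perm.ofSubtype_apply_of_not_mem _ ((hp a).2 ha)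
  · rintro ⟨l, r⟩ ⟨l', r'⟩ ⟨hl, hr, e⟩ ⟨hl', hr', e'⟩
    simp only at hl hr e hl' hr' e'
    let u : Perm (Fin n) := r' * r⁻¹
    have hrinv : ∀ a, ¬ p a → r⁻¹ a = a := fun a ha => by
      rw [Perm.inv_eq_iff_eq]; exact (hr a ((hp a).1 ha)).symm
    have hu : ∀ a, ¬ p a → u a = a := fun a ha => by
      simp only [u, Perm.mul_apply]
      rw [hrinv a ha, hr' a ((hp a).1 ha)]
    have hup : ∀ a, p a → p (u a) := fun a ha => by
      by_contra h
      have := u.injective (hu _ h)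
      rw [this] at h
      exact h ha
    have hlu : ∀ a, l a = l' (u a) := fun a => by
      have : l = l' * u := by
        simp only [u]
        rw [← mul_assoc, e', ← e]; simp
      rw [this]; rfl
    have hmono : StrictMono u := by
      intro a b hab
      by_cases ha : p a <;> by_cases hb : p b
      · by_contra h
        have h1 := hl a b ha.1 hab hb.2
        rw [hlu, hlu] at h1
        rcases lt_or_eq_of_le (not_lt.1 h) with h2 | h2
        · exact lt_asymm h1 (hl' _ _ (hup b hb).1 h2 (hup a ha).2)
        · rw [h2] at h1; exact lt_irrefl _ h1
      · rw [hu b hb]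
        have := hup a ha
        simp only [p, Fin.lt_def] at *
        omega
      · rw [hu a ha]
        have := hup b hb
        simp only [p, Fin.lt_def] at *
        omega
      · rwa [hu a ha, hu b hb]
    have hu1 : u = 1 := by
      let o : Fin n ≃o Fin n := StrictMono.orderIsoOfSurjective u hmono u.surjective
      have : o = OrderIso.refl _ := Subsingleton.elim _ _
      ext a
      have := congrArg (fun o : Fin n ≃o Fin n => (o a : ℕ)) this
      simpa [o] using this
    have h1 : r' = r := by
      rw [← mul_inv_eq_one]; exact hu1
    subst h1
    have h2 : l = l' := mul_right_cancel (e.trans e'.symm)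
    rw [h2]

theorem lt_of_adjacent_lt {n : ℕ} (σ : Perm (Fin n)) (lo hi : ℕ)
    (h : ∀ i, (hi' : 1 ≤ i ∧ i < n) → lo < i → i < hi → σ ⟨i - 1, by omega⟩ < σ ⟨i, hi'.2⟩)
    (a b : Fin n) (ha : lo ≤ (a : ℕ)) (hab : a < b) (hb : (b : ℕ) < hi) : σ a < σ b := by
  obtain ⟨a, ha'⟩ := a
  obtain ⟨b, hb'⟩ := b
  simp only [Fin.mk_lt_mk] at *
  induction b with
  | zero => omega
  | succ b ih =>
    have h1 := h (b + 1) (by omega) (by omega) hb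
    rcases Nat.lt_succ_iff_lt_or_eq.1 hab with h2 | rfl
    · exact (ih (by omega) (by omega) h2).trans h1
    · exact h1

theorem mem_desLE_pair_iff {n i j : ℕ} (hij : i < j) (σ : Perm (Fin n)) :
    σ ∈ desLE n {i, j} ↔
      (∀ a b : Fin n, a < b → (b : ℕ) < i → σ a < σ b) ∧
      (∀ a b : Fin n, i ≤ (a : ℕ) → a < b → (b : ℕ) < j → σ a < σ b) ∧
      (∀ a b : Fin n, j ≤ (a : ℕ) → a < b → σ a < σ b) := by
  simp only [desLE, Finset.mem_filter, Finset.mem_univ, true_and]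
  constructor
  · intro h
    have key : ∀ k, (hk : 1 ≤ k ∧ k < n) → k ≠ i → k ≠ j →
        σ ⟨k - 1, by omega⟩ < σ ⟨k, hk.2⟩ := by
      intro k hk h1 h2
      by_contra hlt
      have hne : σ ⟨k, hk.2⟩ ≠ σ ⟨k - 1, by omega⟩ := fun e => by
        have := σ.injective e
        simp only [Fin.mk.injEq] at this
        omega
      have : k ∈ descents σ := ⟨hk, lt_of_le_of_ne (not_lt.1 hlt) hne⟩
      have := h this
      simp only [Set.mem_insert_iff, Set.mem_singleton_iff] at this
      omega
    refine ⟨fun a b hab hb => ?_, fun a b ha hab hb => ?_, fun a b ha hab => ?_⟩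
    · exact lt_of_adjacent_lt σ 0 i (fun k hk _ h2 => key k hk (by omega) (by omega)) a b
        (by omega) hab hb
    · exact lt_of_adjacent_lt σ i j (fun k hk _ h2 => key k hk (by omega) (by omega)) a b
        ha hab hb
    · exact lt_of_adjacent_lt σ j n (fun k hk _ h2 => key k hk (by omega) (by omega)) a b
        ha hab b.2
  · rintro ⟨h1, h2, h3⟩ k ⟨hk, hlt⟩
    simp only [Set.mem_insert_iff, Set.mem_singleton_iff]
    by_contra hne
    apply lt_asymm hlt
    have hlt' : (⟨k - 1, by omega⟩ : Fin n) < ⟨k, hk.2⟩ := by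
      simp only [Fin.mk_lt_mk]; omega
    rcases lt_or_ge k i with h | h
    · exact h1 _ _ hlt' h
    rcases lt_or_ge k j with h' | h'
    · exact h2 _ _ (by simp only; omega) hlt' h'
    · exact h3 _ _ (by simp only; omega) hlt'

theorem block_apply_mem {n lo hi : ℕ} {r : Perm (Fin n)}
    (hr : ∀ a : Fin n, (a : ℕ) < lo ∨ hi ≤ a → r a = a) (a : Fin n)
    (ha : lo ≤ (a : ℕ) ∧ (a : ℕ) < hi) : lo ≤ (r a : ℕ) ∧ (r a : ℕ) < hi := by
  by_contra h
  have h1 := r.injective (hr (r a) (by omega))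
  rw [h1] at h
  exact h ha

/-- Multiplication is a bijection `𝔖_{j,n-j} × 𝔖_{i,j-i} → des_n(≤ {i,j})`. -/
theorem mem_desLE_iff_existsUnique {n i j : ℕ} (hij : i < j) (hj : j < n) (σ : Perm (Fin n)) :
    σ ∈ desLE n {i, j} ↔ ∃! p : Perm (Fin n) × Perm (Fin n),
      p.1 ∈ shuffles n j (n - j) 0 ∧ p.2 ∈ shuffles n i (j - i) 0 ∧ p.1 * p.2 = σ := by
  rw [mem_desLE_pair_iff hij]
  constructor
  · rintro ⟨h1, h2, h3⟩
    obtain ⟨⟨l, r⟩, ⟨hl, hr, e⟩, huniq⟩ := existsUnique_block_decomp σ 0 j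
    simp only at hl hr e
    have hmem := fun (a : Fin n) (ha : (a : ℕ) < j) => block_apply_mem hr a ⟨Nat.zero_le _, ha⟩
    have hσ : ∀ a, σ a = l (r a) := fun a => by rw [← e]; rfl
    have hr2 : ∀ a b : Fin n, (a : ℕ) < j → (b : ℕ) < j → σ a < σ b → r a < r b := by
      intro a b ha hb hlt
      by_contra h
      rw [hσ, hσ] at hlt
      rcases lt_or_eq_of_le (not_lt.1 h) with h' | h'
      · exact lt_asymm hlt (hl _ _ (Nat.zero_le _) h' (hmem a ha).2)
      · rw [h'] at hlt; exact lt_irrefl _ hlt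
    refine ⟨(l, r), ⟨⟨fun a ha => by omega, fun a b ha hab hb => hl a b ha hab (by omega),
      fun a b ha hab hb => ?_⟩, ⟨fun a ha => hr a (by omega), fun a b ha hab hb => ?_,
        fun a b ha hab hb => ?_⟩, e⟩, ?_⟩
    · have h := h3 a b (by omega) hab
      rw [Fin.lt_def] at hab
      rwa [hσ, hσ, hr a (by omega), hr b (by omega)] at h
    · rw [Fin.lt_def] at hab
      exact hr2 a b (by omega) (by omega) (h1 a b hab (by omega))
    · rw [Fin.lt_def] at hab
      exact hr2 a b (by omega) (by omega) (h2 a b (by omega) hab (by omega))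
    · rintro ⟨l', r'⟩ ⟨hl', hr', e'⟩
      exact huniq _ ⟨fun a b ha hab hb => hl'.2.1 a b ha hab (by omega),
        fun a ha => hr'.1 a (by omega), e'⟩
  · rintro ⟨⟨l, r⟩, ⟨hl, hr, rfl⟩, -⟩
    simp only at hl hr
    have hmem := block_apply_mem (lo := 0) (hi := j) (r := r) (fun a ha => hr.1 a (by omega))
    simp only [Perm.mul_apply]
    refine ⟨fun a b hab hb => ?_, fun a b ha hab hb => ?_, fun a b ha hab => ?_⟩
    · have := hr.2.1 a b (by omega) hab (by omega)
      exact hl.2.1 _ _ (by omega) this (by have := hmem b (by omega); omega)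
    · have := hr.2.2 a b (by omega) hab (by omega)
      exact hl.2.1 _ _ (by omega) this (by have := hmem b (by omega); omega)
    · have hab' := hab
      rw [Fin.lt_def] at hab'
      rw [hr.1 a (by omega), hr.1 b (by omega)]
      exact hl.2.2 _ _ (by omega) hab (by omega)

/-- Multiplication is a bijection `𝔖_{i,n-i} × 𝔖_{j-i,n-j}^{↑ i} → des_n(≤ {i,j})`. -/
theorem mem_desLE_iff_existsUnique' {n i j : ℕ} (hij : i < j) (hj : j < n) (σ : Perm (Fin n)) :
    σ ∈ desLE n {i, j} ↔ ∃! p : Perm (Fin n) × Perm (Fin n),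
      p.1 ∈ shuffles n i (n - i) 0 ∧ p.2 ∈ shuffles n (j - i) (n - j) i ∧ p.1 * p.2 = σ := by
  rw [mem_desLE_pair_iff hij]
  constructor
  · rintro ⟨h1, h2, h3⟩
    obtain ⟨⟨l, r⟩, ⟨hl, hr, e⟩, huniq⟩ := existsUnique_block_decomp σ i n
    simp only at hl hr e
    have hmem := fun (a : Fin n) (ha : i ≤ (a : ℕ)) => block_apply_mem hr a ⟨ha, a.2⟩
    have hσ : ∀ a, σ a = l (r a) := fun a => by rw [← e]; rfl
    have hr2 : ∀ a b : Fin n, i ≤ (a : ℕ) → i ≤ (b : ℕ) → σ a < σ b → r a < r b := by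
      intro a b ha hb hlt
      by_contra h
      rw [hσ, hσ] at hlt
      rcases lt_or_eq_of_le (not_lt.1 h) with h' | h'
      · exact lt_asymm hlt (hl _ _ (hmem b hb).1 h' (hmem a ha).2)
      · rw [h'] at hlt; exact lt_irrefl _ hlt
    refine ⟨(l, r), ⟨⟨fun a ha => by omega, fun a b ha hab hb => ?_,
      fun a b ha hab hb => hl a b (by omega) hab (by omega)⟩, ⟨fun a ha => hr a (by omega),
        fun a b ha hab hb => ?_, fun a b ha hab hb => ?_⟩, e⟩, ?_⟩
    · have h := h1 a b hab (by omega)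
      rw [Fin.lt_def] at hab
      rwa [hσ, hσ, hr a (by omega), hr b (by omega)] at h
    · rw [Fin.lt_def] at hab
      exact hr2 a b (by omega) (by omega) (h2 a b (by omega) hab (by omega))
    · rw [Fin.lt_def] at hab
      exact hr2 a b (by omega) (by omega) (h3 a b (by omega) hab)
    · rintro ⟨l', r'⟩ ⟨hl', hr', e'⟩
      exact huniq _ ⟨fun a b ha hab hb => hl'.2.2 a b (by omega) hab (by omega),
        fun a ha => hr'.1 a (by omega), e'⟩
  · rintro ⟨⟨l, r⟩, ⟨hl, hr, rfl⟩, -⟩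
    simp only at hl hr
    have hmem := block_apply_mem (lo := i) (hi := n) (r := r) (fun a ha => hr.1 a (by omega))
    simp only [Perm.mul_apply]
    refine ⟨fun a b hab hb => ?_, fun a b ha hab hb => ?_, fun a b ha hab => ?_⟩
    · have hab' := hab
      rw [Fin.lt_def] at hab'
      rw [hr.1 a (by omega), hr.1 b (by omega)]
      exact hl.2.1 _ _ (by omega) hab (by omega)
    · have hab' := hab
      rw [Fin.lt_def] at hab'
      have := hr.2.1 a b (by omega) hab (by omega)
      exact hl.2.2 _ _ (by have := hmem a (by omega); omega) this (by omega)
    · have hab' := hab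
      rw [Fin.lt_def] at hab'
      have := hr.2.2 a b (by omega) hab (by omega)
      exact hl.2.2 _ _ (by have := hmem a (by omega); omega) this (by omega)

open Classical in
/-- The pair `(σ_L, σ_R) ∈ 𝔖_{j,n-j} × 𝔖_{i,j-i}` with `σ = σ_L σ_R`, for `σ ∈ des_n(≤ {i,j})`. -/
def split {n : ℕ} (i j : ℕ) (σ : Perm (Fin n)) : Perm (Fin n) × Perm (Fin n) :=
  if h : ∃ p : Perm (Fin n) × Perm (Fin n),
      p.1 ∈ shuffles n j (n - j) 0 ∧ p.2 ∈ shuffles n i (j - i) 0 ∧ p.1 * p.2 = σ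
  then h.choose else 1

open Classical in
/-- The pair `(σ_L', σ_R') ∈ 𝔖_{i,n-i} × 𝔖_{j-i,n-j}^{↑ i}` with `σ = σ_L' σ_R'`, for
`σ ∈ des_n(≤ {i,j})`. -/
def split' {n : ℕ} (i j : ℕ) (σ : Perm (Fin n)) : Perm (Fin n) × Perm (Fin n) :=
  if h : ∃ p : Perm (Fin n) × Perm (Fin n),
      p.1 ∈ shuffles n i (n - i) 0 ∧ p.2 ∈ shuffles n (j - i) (n - j) i ∧ p.1 * p.2 = σ
  then h.choose else 1

/-! ### Lifting permutations to the generalized virtual braid monoid -/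

section lifting

open GVB

variable (K : Type*) [Field K] {n : ℕ}

/-- The factor
`(σ_{t_k} + (1 - δ_{t_k + 1, t_{k+1}}) σ_1 ⋯ σ_{t_k - 1} ξ_{t_k}) σ_{t_k + 1} ⋯ σ_k`
of the lift of `σ`, or `1` if the `k`-th component of the bubble decomposition is trivial. -/
def liftFactor (σ : Perm (Fin n)) (k : ℕ) : MonoidAlgebra K (GVB n) :=
  let t := bubbleIdx σ k
  if t = 0 then 1
  else (sigma K n t +
      (if t + 1 = bubbleIdx σ (k + 1) then 0 else 1) * (sigmaRun K n 1 (t - 1) * xi K n t)) *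
    sigmaRun K n (t + 1) (k - t)

/-- The product, in descending order `k = n - 1, …, 1`, of the factors above. -/
def lift (σ : Perm (Fin n)) : MonoidAlgebra K (GVB n) :=
  ((List.range (n - 1)).reverse.map fun k => liftFactor K σ (k + 1)).prod

open Classical in
/-- The map `Q_{p,q}^{→ k}`: the lift of the shuffles in `𝔖_{p,q}^{↑ k}`, extended by zero to `𝔖_n`.
For `k = 0`, this is the generalized Matsumoto-Tits section `Q_{p,q}`. -/
def Q (p q k : ℕ) (σ : Perm (Fin n)) : MonoidAlgebra K (GVB n) :=
  if σ ∈ shuffles n p q k then lift K σ else 0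

open Classical in
/-- `M_{p,q}(σ, τ)` for `τ ∈ GVB_n^+`. -/
def M₀ (p q : ℕ) (σ : Perm (Fin n)) (τ : GVB n) : MonoidAlgebra K (GVB n) :=
  if virtualLength τ < p ∧ σ ∈ shuffles n (p - virtualLength τ) q (virtualLength τ) then
    Q K (p - virtualLength τ) q (virtualLength τ) σ * MonoidAlgebra.of K (GVB n) τ
  else 0

/-- `M_{p,q}(σ, τ)`, extended linearly to `τ ∈ K[GVB_n^+]`. -/
def M (p q : ℕ) (σ : Perm (Fin n)) : MonoidAlgebra K (GVB n) →ₗ[K] MonoidAlgebra K (GVB n) :=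
  Finsupp.linearCombination K (M₀ K p q σ) ∘ₗ (MonoidAlgebra.coeffLinearEquiv K).toLinearMap

/-- `σ^{↑ l}`, for a permutation `σ` fixing the last `l` of the `n` positions: the same permutation,
performed `l` positions further to the right. -/
def shift (l : ℕ) (σ : Perm (Fin n)) : Perm (Fin n) :=
  finRotate n ^ l * σ * (finRotate n ^ l)⁻¹

open Classical in
/-- `M'_{p,q}^{↑ k}(σ, τ)` for `τ ∈ GVB_n^+`, where `k + p + q = n`. With `l = l_v(τ)`, it is
nonzero only for `σ` a `(p,q-l)`-shuffle of the positions `k + 1, …, n - l`; this shuffle is then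
performed on the positions `k + l + 1, …, n` and lifted. -/
def M₀' (p q k : ℕ) (σ : Perm (Fin n)) (τ : GVB n) : MonoidAlgebra K (GVB n) :=
  if virtualLength τ < q ∧ σ ∈ shuffles n p (q - virtualLength τ) k then
    Q K p (q - virtualLength τ) (k + virtualLength τ) (shift (virtualLength τ) σ) *
      MonoidAlgebra.of K (GVB n) τ
  else 0

/-- `M'_{p,q}^{↑ k}(σ, τ)`, extended linearly to `τ ∈ K[GVB_n^+]`. -/
def M' (p q k : ℕ) (σ : Perm (Fin n)) : MonoidAlgebra K (GVB n) →ₗ[K] MonoidAlgebra K (GVB n) :=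
  Finsupp.linearCombination K (M₀' K p q k σ) ∘ₗ (MonoidAlgebra.coeffLinearEquiv K).toLinearMap

/-- The lift `Q_{≤ I}(σ) = M_{j,n-j}(σ_L, M_{i,j-i}(σ_R))` of `σ ∈ des_n(≤ I)`, for `I = {i,j}` with
`i < j`. -/
def QLE (i j : ℕ) (σ : Perm (Fin n)) : MonoidAlgebra K (GVB n) :=
  M K j (n - j) (split i j σ).1 (M K i (j - i) (split i j σ).2 1)

/-- The lift `Q'_{≤ I}(σ) = M'_{i,n-i}(σ_L', M'_{j-i,n-j}^{↑ i}(σ_R'))` of `σ ∈ des_n(≤ I)`, for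
`I = {i,j}` with `i < j`. -/
def QLE' (i j : ℕ) (σ : Perm (Fin n)) : MonoidAlgebra K (GVB n) :=
  M' K i (n - i) 0 (split' i j σ).1 (M' K (j - i) (n - j) i (split' i j σ).2 1)

end lifting

end Lifting

end

/-! Both sums are quasi-shuffle products of three blocks of `i`, `j - i` and `n - j` factors,
bracketed in two ways. The action makes this product associative; the monoid algebra does not.

The element `merge a`, that is `σ_1 ⋯ σ_{a-1} ξ_a`, merges the factors `a` and `a + 1` and carries
the left-over unit to the front. The first non-unit factor of a quasi-shuffle comes from the first
block, from the second, or from merging the first factors of both. This is the three-term recursion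
`qsh`. Splitting shuffles according to whether they fix the first position of their block shows that
the lifts satisfy it (`lift_mul_simpleRun`, `sum_lift_shuffles`): the Kronecker delta in `L` removes
exactly the mergings that the recursion does not contain. A second shuffle, performed after `l`
mergings, has to skip `l` units. Hence `qsh` carries a weight `f l`, and iterated lifts become
nested `qsh` (`sum_QLE`, `sum_QLE'`).

Equality of the images is `MergeRel.qsh_assoc`, proved from a short list of relations, `MergeRel`,
by expanding both bracketings into seven terms. Some of these relations hold in the monoid algebra
already. The others are verified in the action (`mergeRel_rep`), where the left-over factor is a
genuine unit, crossed trivially by everything, and `m` is associative.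

For the inequality, another representation is used (`letterRep`), in which the left-over of a
merging is not a unit. Merging `u`, `u` leaves `o` and merging `u`, `w` leaves `q`. The letter `q`
passes `o` and `u` on its way to the front, but neither `o` nor `q` can pass `q`. On a suitable word
all exchanges at block boundaries vanish and each bracketing reduces to four terms. The double
merging survives if the left boundary is merged before the right one, and is zero in the other
order. -/

/-! # Quasi-shuffle recursion in a ring with braid-like elements -/

namespace QuasiShuffle

/-- Induction following the recursion of quasi-shuffles. -/
theorem qsh_induction {P : ℕ → ℕ → ℕ → Prop} (h_left : ∀ k q, P k 0 q) (h_right : ∀ k p, P k p 0)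
    (h_succ : ∀ k p q, P (k + 1) p (q + 1) → P (k + 1) (p + 1) q → P (k + 2) p q →
      P k (p + 1) (q + 1)) (k p q : ℕ) : P k p q := by
  induction hN : p + q using Nat.strong_induction_on generalizing k p q with
  | _ N ih =>
    rcases p with _ | p
    · exact h_left ..
    rcases q with _ | q
    · exact h_right ..
    exact h_succ _ _ _ (ih _ (by omega) _ _ _ rfl) (ih _ (by omega) _ _ _ rfl)
      (ih _ (by omega) _ _ _ rfl)

variable {E : Type*} [Semiring E]

/-- `s_a s_{a+1} ⋯ s_{a+m-1}` -/
def run (s : ℕ → E) (a m : ℕ) : E := ((List.range' a m).map s).prod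

@[simp] theorem run_zero (s : ℕ → E) (a : ℕ) : run s a 0 = 1 := rfl

theorem run_succ (s : ℕ → E) (a m : ℕ) : run s a (m + 1) = run s a m * s (a + m) := by
  simp [run, List.range'_concat]

theorem run_succ' (s : ℕ → E) (a m : ℕ) : run s a (m + 1) = s a * run s (a + 1) m := by
  simp [run, List.range'_succ]

@[simp] theorem run_one (s : ℕ → E) (a : ℕ) : run s a 1 = s a := by simp [run]

theorem run_add (s : ℕ → E) (a m m' : ℕ) : run s a (m + m') = run s a m * run s (a + m) m' := by
  induction m' with
  | zero => simp
  | succ m' ih => rw [← add_assoc, run_succ, ih, run_succ, mul_assoc, add_assoc]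

/-- The weighted sum over the quasi-shuffles of the `p` positions following the first `k` ones with
the next `q` positions. The term of a quasi-shuffle is a word in the `s_a` (exchange of adjacent
factors) and the `X_a` (merging of adjacent factors) and is multiplied by `f l` from the left, where
`l` is the number of letters `X_a`. -/
def qsh (s X : ℕ → E) : (ℕ → E) → ℕ → ℕ → ℕ → E
  | f, _, 0, _ => f 0
  | f, _, _ + 1, 0 => f 0
  | f, k, p + 1, q + 1 => qsh s X f (k + 1) p (q + 1) +
      qsh s X f (k + 1) (p + 1) q * run s (k + 1) (p + 1) +
      qsh s X (fun l => f (l + 1)) (k + 2) p q * (X (k + 1) * run s (k + 2) p)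
termination_by _ _ p q => p + q

variable (s X : ℕ → E)

@[simp] theorem qsh_zero_left (f : ℕ → E) (k q : ℕ) : qsh s X f k 0 q = f 0 := by
  rw [qsh]

@[simp] theorem qsh_zero_right (f : ℕ → E) (k p : ℕ) : qsh s X f k p 0 = f 0 := by
  cases p <;> rw [qsh]

theorem qsh_succ (f : ℕ → E) (k p q : ℕ) : qsh s X f k (p + 1) (q + 1) =
    qsh s X f (k + 1) p (q + 1) + qsh s X f (k + 1) (p + 1) q * run s (k + 1) (p + 1) +
      qsh s X (fun l => f (l + 1)) (k + 2) p q * (X (k + 1) * run s (k + 2) p) := by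
  rw [qsh]

variable {s X}

/-- Each merging uses up one factor of either block, so only the weights `f l` with `l ≤ min p q`
occur. -/
theorem qsh_congr (k p q : ℕ) : ∀ f g : ℕ → E, (∀ l, l ≤ p → l ≤ q → f l = g l) →
    qsh s X f k p q = qsh s X g k p q := by
  induction k, p, q using qsh_induction with
  | h_left k q => intro f g h; simp [h 0]
  | h_right k p => intro f g h; simp [h 0]
  | h_succ k p q h1 h2 h3 =>
    intro f g h
    rw [qsh_succ, qsh_succ, h1 f g fun l _ _ => h l (by omega) (by omega),
      h2 f g fun l _ _ => h l (by omega) (by omega),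
      h3 _ (fun l => g (l + 1)) fun l _ _ => h (l + 1) (by omega) (by omega)]

theorem qsh_add (k p q : ℕ) : ∀ f g : ℕ → E,
    qsh s X (fun l => f l + g l) k p q = qsh s X f k p q + qsh s X g k p q := by
  induction k, p, q using qsh_induction with
  | h_left k q => simp
  | h_right k p => simp
  | h_succ k p q h1 h2 h3 =>
    intro f g
    simp only [qsh_succ]
    rw [h1, h2, h3 (fun l => f (l + 1)) fun l => g (l + 1)]
    simp only [add_mul]
    abel

theorem map_run {F : Type*} [Semiring F] (φ : E →+* F) (a m : ℕ) :
    φ (run s a m) = run (fun a => φ (s a)) a m := by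
  simp only [run, map_list_prod, List.map_map, Function.comp_def]

theorem map_qsh {F : Type*} [Semiring F] (φ : E →+* F) (k p q : ℕ) : ∀ f : ℕ → E,
    φ (qsh s X f k p q) = qsh (fun a => φ (s a)) (fun a => φ (X a)) (fun l => φ (f l)) k p q := by
  induction k, p, q using qsh_induction with
  | h_left k q => simp
  | h_right k p => simp
  | h_succ k p q h1 h2 h3 =>
    intro f
    simp only [qsh_succ, map_add, map_mul, map_run, h1, h2, h3]

/-- If the first exchange vanishes on a vector, at most the first merging contributes. -/
theorem qsh_smul_of_smul_eq_zero {M : Type*} [AddCommMonoid M] [Module E M] (f : ℕ → E)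
    (k p q : ℕ) : ∀ v : M, s (k + p + 1) • v = 0 →
    qsh s X f k (p + 1) (q + 1) • v = f 0 • v + f 1 • X (k + p + 1) • v := by
  intro v hv
  induction p generalizing k with
  | zero =>
    rw [qsh_succ]
    simp only [add_zero] at hv
    simp [add_smul, mul_smul, hv]
  | succ p ih =>
    -- Every run occurring here is nonempty and has as its rightmost letter the exchange at the
    -- block boundary, which kills `v`. Only keeping the first factor in place remains, and it does
    -- not move the boundary.
    have h1 : run s (k + 1) (p + 2) • v = 0 := by
      rw [run_succ, mul_smul, show k + 1 + (p + 1) = k + (p + 1) + 1 by ring, hv, smul_zero]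
    have h2 : run s (k + 2) (p + 1) • v = 0 := by
      rw [run_succ, mul_smul, show k + 2 + p = k + (p + 1) + 1 by ring, hv, smul_zero]
    rw [qsh_succ, add_smul, add_smul, mul_smul, h1, mul_smul, mul_smul, h2]
    simp only [smul_zero, add_zero]
    rw [show k + (p + 1) = k + 1 + p by ring] at hv ⊢
    exact ih _ hv

/-- The left bracketing of a product of three blocks on a vector on which hardly any exchange is
possible. -/
theorem qsh_qsh_smul_left {M : Type*} [AddCommMonoid M] [Module E M] (i d r : ℕ) (v : M)
    (h₁ : s (i + 1) • v = 0) (h₂ : s (i + d + 2) • v = 0)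
    (h₃ : s (i + d + 2) • X (i + 1) • v = 0) :
    qsh s X (fun l => qsh s X (fun _ => 1) l (i + d + 2 - l) (r + 1)) 0 (i + 1) (d + 1) • v =
      v + X (i + d + 2) • v + (X (i + 1) • v + X (i + d + 2) • X (i + 1) • v) := by
  have e₁ : 0 + i + 1 = i + 1 := by omega
  have e₂ : 0 + (i + d + 1) + 1 = i + d + 2 := by omega
  have e₃ : 1 + (i + d) + 1 = i + d + 2 := by omega
  rw [qsh_smul_of_smul_eq_zero _ 0 i d v (by rwa [e₁]), e₁,
    show i + d + 2 - 0 = i + d + 1 + 1 by omega, show i + d + 2 - 1 = i + d + 1 by omega,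
    qsh_smul_of_smul_eq_zero _ 0 (i + d + 1) r v (by rwa [e₂]), e₂,
    qsh_smul_of_smul_eq_zero _ 1 (i + d) r _ (by rwa [e₃]), e₃]
  simp only [one_smul]

/-- The right bracketing of a product of three blocks on a vector on which hardly any exchange is
possible. -/
theorem qsh_qsh_smul_right {M : Type*} [AddCommMonoid M] [Module E M] (i d r : ℕ) (v : M)
    (h₁ : s (i + 1) • v = 0) (h₂ : s (i + d + 2) • v = 0)
    (h₃ : s (i + 2) • X (i + d + 2) • v = 0) :
    qsh s X (fun l => qsh s X (fun _ => 1) l (i + 1) (d + r + 2 - l)) (i + 1) (d + 1) (r + 1) • v =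
      v + X (i + 1) • v + (X (i + d + 2) • v + X (i + 2) • X (i + d + 2) • v) := by
  have e₁ : 0 + i + 1 = i + 1 := by omega
  have e₂ : i + 1 + d + 1 = i + d + 2 := by omega
  have e₃ : 1 + i + 1 = i + 2 := by omega
  rw [qsh_smul_of_smul_eq_zero _ (i + 1) d r v (by rwa [e₂]), e₂,
    show d + r + 2 - 0 = d + r + 1 + 1 by omega, show d + r + 2 - 1 = d + r + 1 by omega,
    qsh_smul_of_smul_eq_zero _ 0 i (d + r + 1) v (by rwa [e₁]), e₁,
    qsh_smul_of_smul_eq_zero _ 1 i (d + r) _ (by rwa [e₃]), e₃]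
  simp only [one_smul]

/-! ### Relations between exchanges and mergings, and associativity -/

variable (s) in
/-- The braid relations between `s_1, …, s_{n-1}`. -/
structure BraidRel (n : ℕ) : Prop where
  s_s : ∀ a b, 1 ≤ a → a + 2 ≤ b → b < n → s a * s b = s b * s a
  braid : ∀ a, 1 ≤ a → a + 1 < n → s a * s (a + 1) * s a = s (a + 1) * s a * s (a + 1)

variable (s X) in
/-- The relations between exchanges and mergings of adjacent factors, among `n` factors, where a
merging leaves a unit behind, which is moved to the front. -/
structure MergeRel (n : ℕ) : Prop extends BraidRel s n where
  -- The unit arriving at the front pushes everything left of the merged pair one place to the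
  -- right; this accounts for the index shifts in `s_X_of_lt` and `X_X`. The relations `s_X_left`
  -- and `s_X_right` say that passing a merged factor amounts to passing both of its constituents,
  -- and `X_X_assoc` is associativity of merging three neighbours.
  s_X_of_lt : ∀ a b, 1 ≤ b → b + 2 ≤ a → a < n → s (b + 1) * X a = X a * s b
  s_X_of_gt : ∀ a b, 1 ≤ a → a + 2 ≤ b → b < n → s b * X a = X a * s b
  s_X_left : ∀ a, 1 ≤ a → a + 1 < n → s (a + 1) * X (a + 1) = X a * s (a + 1) * s a
  s_X_right : ∀ a, 1 ≤ a → a + 1 < n → s (a + 1) * X a = X (a + 1) * s a * s (a + 1)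
  X_X : ∀ a b, 1 ≤ a → a + 2 ≤ b → b < n → X b * X a = X (a + 1) * X b
  X_X_assoc : ∀ a, 1 ≤ a → a + 1 < n → X (a + 1) * X a = X (a + 1) * X (a + 1)

namespace BraidRel

variable {n : ℕ} (h : BraidRel s n)
include h

theorem s_run_of_lt (b a m : ℕ) (hb : 1 ≤ b) (hab : b + 2 ≤ a) (hm : a + m ≤ n) :
    s b * run s a m = run s a m * s b := by
  induction m with
  | zero => simp
  | succ m ih =>
    rw [run_succ, ← mul_assoc, ih (by omega), mul_assoc, h.s_s _ _ hb (by omega) (by omega),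
      mul_assoc]

theorem s_run_of_gt (b a m : ℕ) (ha : 1 ≤ a) (hab : a + m + 1 ≤ b) (hb : b < n) :
    s b * run s a m = run s a m * s b := by
  induction m with
  | zero => simp
  | succ m ih =>
    rw [run_succ, ← mul_assoc, ih (by omega), mul_assoc, ← h.s_s _ _ (by omega) (by omega) hb,
      mul_assoc]

theorem run_run_comm (a m b m' : ℕ) (ha : 1 ≤ a) (hab : a + m + 1 ≤ b) (hb : b + m' ≤ n) :
    run s b m' * run s a m = run s a m * run s b m' := by
  induction m' with
  | zero => simp
  | succ m' ih =>
    rw [run_succ, mul_assoc, h.s_run_of_gt _ _ _ ha (by omega) (by omega), ← mul_assoc,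
      ih (by omega), mul_assoc]

theorem s_run (b a m : ℕ) (ha : 1 ≤ a) (hab : a ≤ b) (hb : b + 1 < a + m) (hm : a + m ≤ n) :
    s (b + 1) * run s a m = run s a m * s b := by
  induction m with
  | zero => omega
  | succ m ih =>
    rcases Nat.lt_or_ge (b + 1) (a + m) with h1 | h1
    · rw [run_succ, ← mul_assoc, ih h1 (by omega), mul_assoc, h.s_s _ _ (by omega) (by omega)
        (by omega), mul_assoc]
    · obtain ⟨m, rfl⟩ : ∃ m', m = m' + 1 := ⟨m - 1, by omega⟩
      obtain rfl : b = a + m := by omega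
      rw [run_succ, run_succ, mul_assoc, ← mul_assoc, h.s_run_of_gt _ _ _ ha (by omega) (by omega)]
      simp only [mul_assoc]
      congr 1
      have := h.braid (a + m) (by omega) (by omega)
      simp only [mul_assoc] at this
      exact this.symm

theorem run_run (a m b m' : ℕ) (ha : 1 ≤ a) (hab : a ≤ b) (hb : b + m' < a + m) (hm : a + m ≤ n) :
    run s (b + 1) m' * run s a m = run s a m * run s b m' := by
  induction m' with
  | zero => simp
  | succ m' ih =>
    rw [run_succ, mul_assoc, show b + 1 + m' = b + m' + 1 by ring,
      h.s_run _ _ _ ha (by omega) (by omega) hm, ← mul_assoc, ih (by omega), mul_assoc, run_succ]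

end BraidRel

namespace MergeRel

variable {n : ℕ} (h : MergeRel s X n)
include h

theorem run_X_of_gt (a b m : ℕ) (ha : 1 ≤ a) (hab : a + 2 ≤ b) (hb : b + m ≤ n) :
    run s b m * X a = X a * run s b m := by
  induction m with
  | zero => simp
  | succ m ih =>
    rw [run_succ, mul_assoc, h.s_X_of_gt _ _ ha (by omega) (by omega), ← mul_assoc,
      ih (by omega), mul_assoc]

/-- Iterated `s_X_left`: carrying a merged factor to the left past `p` others is the same as
carrying both constituents there and merging them afterwards. -/
theorem run_X_left (a p : ℕ) (ha : 1 ≤ a) (hp : a + p < n) :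
    run s (a + 1) p * X (a + p) = X a * run s (a + 1) p * run s a p := by
  induction p with
  | zero => simp
  | succ p ih =>
    rw [run_succ, mul_assoc, show a + 1 + p = a + p + 1 by ring, ← add_assoc,
      h.s_X_left _ (by omega) (by omega), mul_assoc, ← mul_assoc, ih (by omega), run_succ]
    simp only [mul_assoc]
    congr 2
    rw [← mul_assoc, ← mul_assoc, h.s_run_of_gt _ _ _ ha (by omega) (by omega)]

/-- A factor coming from the right passes a merged pair exactly as it passes its two constituents.
This is the only use of `s_X_right`. -/
theorem run_X_right (a m : ℕ) (ha : 1 ≤ a) (hm : a + m + 1 < n) :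
    run s (a + 1) (m + 1) * X a = X (a + 1) * run s a (m + 2) := by
  rw [run_succ', mul_assoc, h.run_X_of_gt _ _ _ ha (by omega) (by omega), ← mul_assoc,
    h.s_X_right _ ha (by omega), run_succ', run_succ']
  simp only [mul_assoc]

/-- The exchange takes place within the first `k` positions, which the quasi-shuffle only pushes to
the right, by one place for each merging. Hence `s b` before it becomes `s (b + l)` after it. The
statements for `X` and for runs have the same reason. -/
theorem qsh_s (k p q : ℕ) : ∀ (g : ℕ → E) (b : ℕ), 1 ≤ b → b + 1 ≤ k → k + p + q ≤ n →
    qsh s X (fun l => g l * s (b + l)) k p q = qsh s X g k p q * s b := by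
  induction k, p, q using qsh_induction with
  | h_left k q => simp
  | h_right k p => simp
  | h_succ k p q h1 h2 h3 =>
    intro g b hb hk hn
    have h3' := h3 (fun l => g (l + 1)) (b + 1) (by omega) (by omega) (by omega)
    simp only [show ∀ l, b + 1 + l = b + (l + 1) from fun l => by ring] at h3'
    rw [qsh_succ, qsh_succ, h1 g b hb (by omega) (by omega), h2 g b hb (by omega) (by omega), h3']
    have e : s (b + 1) * (X (k + 1) * run s (k + 2) p) = X (k + 1) * run s (k + 2) p * s b := by
      rw [← mul_assoc, h.s_X_of_lt _ _ hb (by omega) (by omega), mul_assoc,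
        h.s_run_of_lt _ _ _ hb (by omega) (by omega), mul_assoc]
    simp only [add_mul, mul_assoc _ (s b), mul_assoc _ (s (b + 1)), e,
      h.s_run_of_lt _ (k + 1) (p + 1) hb (by omega) (by omega)]
    simp only [mul_assoc]

theorem qsh_X (k p q : ℕ) : ∀ (g : ℕ → E) (b : ℕ), 1 ≤ b → b + 1 ≤ k → k + p + q ≤ n →
    qsh s X (fun l => g l * X (b + l)) k p q = qsh s X g k p q * X b := by
  induction k, p, q using qsh_induction with
  | h_left k q => simp
  | h_right k p => simp
  | h_succ k p q h1 h2 h3 =>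
    intro g b hb hk hn
    have h3' := h3 (fun l => g (l + 1)) (b + 1) (by omega) (by omega) (by omega)
    simp only [show ∀ l, b + 1 + l = b + (l + 1) from fun l => by ring] at h3'
    rw [qsh_succ, qsh_succ, h1 g b hb (by omega) (by omega), h2 g b hb (by omega) (by omega), h3']
    have e : X (b + 1) * (X (k + 1) * run s (k + 2) p) = X (k + 1) * run s (k + 2) p * X b := by
      rw [← mul_assoc, ← h.X_X _ _ hb (by omega) (by omega), mul_assoc, mul_assoc,
        h.run_X_of_gt _ _ _ hb (by omega) (by omega)]
    simp only [add_mul, mul_assoc _ (X b), mul_assoc _ (X (b + 1)), e,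
      ← h.run_X_of_gt _ (k + 1) (p + 1) hb (by omega) (by omega)]
    simp only [mul_assoc]

theorem qsh_run (g : ℕ → E) (k p q b m : ℕ) (hb : 1 ≤ b) (hk : b + m ≤ k) (hn : k + p + q ≤ n) :
    qsh s X (fun l => g l * run s (b + l) m) k p q = qsh s X g k p q * run s b m := by
  induction m with
  | zero => simp
  | succ m ih =>
    simp only [run_succ, ← mul_assoc]
    rw [← ih (by omega), ← h.qsh_s _ _ _ _ (b + m) (by omega) (by omega) (by omega)]
    simp only [add_right_comm]

theorem qsh_X_run (g : ℕ → E) (k p q b m : ℕ) (hb : 1 ≤ b) (hk : b + m + 1 ≤ k)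
    (hn : k + p + q ≤ n) :
    qsh s X (fun l => g l * (X (b + l) * run s (b + l + 1) m)) k p q =
      qsh s X g k p q * (X b * run s (b + 1) m) := by
  rw [← mul_assoc, ← h.qsh_X _ _ _ _ b hb (by omega) hn,
    ← h.qsh_run _ _ _ _ (b + 1) m (by omega) (by omega) hn]
  simp only [mul_assoc, add_right_comm]

/-- The factor that follows both blocks may be carried in front of them before or after they are
quasi-shuffled. After `l` mergings there are `l` further units at the front and only `p + q - l`
factors left to pass. -/
theorem qsh_run_passing (k p q : ℕ) : ∀ g : ℕ → E, k + p + q < n →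
    qsh s X (fun l => g l * run s (k + l + 1) (p + q - l)) k p q =
      qsh s X g (k + 1) p q * run s (k + 1) (p + q) := by
  induction k, p, q using qsh_induction with
  | h_left k q => simp
  | h_right k p => simp
  | h_succ k p q h1 h2 h3 =>
    intro g hn
    -- One statement for the three terms of the recursion: `d` is the number of mergings in the
    -- first step, `0` for the two shuffle terms and `1` for the merging term. The leftmost exchange
    -- of the run is split off and moved through by `qsh_s`; the rest is the induction hypothesis.
    have key : ∀ (k' p' q' d : ℕ) (g : ℕ → E), k' = k + 1 + d → k' + p' + q' = k + p + q + 2 →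
        1 ≤ p' + q' + d → k' + p' + q' < n → d ≤ 1 →
        (∀ g : ℕ → E, k' + p' + q' < n →
          qsh s X (fun l => g l * run s (k' + l + 1) (p' + q' - l)) k' p' q' =
            qsh s X g (k' + 1) p' q' * run s (k' + 1) (p' + q')) →
        qsh s X (fun l => g l * run s (k + d + l + 1) (p + q + 2 - (l + d))) k' p' q' =
          qsh s X g (k' + 1) p' q' * run s (k + d + 1) (p + q + 2 - d) := by
      intro k' p' q' d g hk' hsum hpos hlt hd ih
      rw [show p + q + 2 - d = p' + q' + 1 by omega, run_succ', ← mul_assoc,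
        ← h.qsh_s _ _ _ _ _ (by omega) (by omega) (by omega),
        show k + d + 1 + 1 = k' + 1 by omega, ← ih _ hlt]
      refine qsh_congr _ _ _ _ _ fun l hp hq => ?_
      rw [mul_assoc, show p + q + 2 - (l + d) = p' + q' - l + 1 by omega, run_succ',
        show k + d + l + 1 = k + d + 1 + l by ring, show k + d + 1 + l + 1 = k' + l + 1 by omega]
    have e1 := key (k + 1) p (q + 1) 0 g (by omega) (by omega) (by omega) (by omega) (by omega) h1
    have e2 := key (k + 1) (p + 1) q 0 g (by omega) (by omega) (by omega) (by omega) (by omega) h2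
    have e3 := key (k + 2) p q 1 (fun l => g (l + 1)) (by omega) (by omega) (by omega) (by omega)
      (by omega) h3
    simp only [add_zero, tsub_zero] at e1 e2
    simp only [show p + 1 + (q + 1) = p + q + 2 by ring]
    rw [qsh_succ, e1, e2]
    simp only [show ∀ l, k + (l + 1) + 1 = k + 1 + l + 1 from fun l => by ring]
    rw [e3, qsh_succ]
    simp only [add_mul, mul_assoc]
    have c2 : run s (k + 1) (p + q + 2) * run s (k + 1) (p + 1) =
        run s (k + 2) (p + 1) * run s (k + 1) (p + q + 2) :=
      (h.run_run _ _ _ _ (by omega) le_rfl (by omega) (by omega)).symm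
    have c3 : run s (k + 1 + 1) (p + q + 2 - 1) * (X (k + 1) * run s (k + 2) p) =
        X (k + 2) * (run s (k + 3) p * run s (k + 1) (p + q + 2)) := by
      rw [← mul_assoc, show p + q + 2 - 1 = p + q + 1 by omega,
        h.run_X_right _ _ (by omega) (by omega), mul_assoc,
        h.run_run _ _ (k + 2) _ (by omega) (by omega) (by omega) (by omega)]
    rw [c2, c3]

/-- The same principle for a factor from behind both blocks that is carried to their front and there
merged with the factor in position `k`. -/
theorem qsh_X_run_passing (g : ℕ → E) (k p q : ℕ) (hk : 1 ≤ k) (hn : k + p + q < n) :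
    qsh s X (fun l => g l * (X (k + l) * run s (k + l + 1) (p + q - l))) k p q =
      qsh s X g (k + 1) p q * (X k * run s (k + 1) (p + q)) := by
  rw [← mul_assoc, ← h.qsh_X _ _ _ _ k hk (by omega) (by omega), ← h.qsh_run_passing _ _ _ _ hn]
  simp only [mul_assoc]

/-- Associativity of the quasi-shuffle product. -/
theorem qsh_assoc (N : ℕ) : ∀ k p q r : ℕ, p + q + r = N → k + p + q + r ≤ n →
    qsh s X (fun l => qsh s X (fun _ => 1) (k + l) (p + q - l) r) k p q =
      qsh s X (fun l => qsh s X (fun _ => 1) (k + l) p (q + r - l)) (k + p) q r := by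
  induction N using Nat.strong_induction_on with
  | _ N ih =>
    intro k p q r hN hn
    rcases p with _ | p
    · simp only [qsh_zero_left, add_zero, zero_add, tsub_zero]
    rcases q with _ | q
    · simp
    rcases r with _ | r
    · simp
    -- The left and the right bracketing, as functions of the block sizes, so that the induction
    -- hypothesis reads `A = B` for smaller total size.
    let A := fun k p q r => qsh s X (fun l => qsh s X (fun _ => 1) (k + l) (p + q - l) r) k p q
    let B := fun k p q r =>
      qsh s X (fun l => qsh s X (fun _ => 1) (k + l) p (q + r - l)) (k + p) q r
    have IH : ∀ k' p' q' r', p' + q' + r' < p + q + r + 3 → k' + p' + q' + r' ≤ n →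
        A k' p' q' r' = B k' p' q' r' :=
      fun k' p' q' r' h1 h2 => ih _ (by omega) k' p' q' r' rfl h2
    -- Seven terms, one for each nonempty set of blocks whose first factors make up the first
    -- non-unit factor of the result. The quasi-shuffle performed last is expanded first: `f₁` takes
    -- this factor from the first two blocks, `f₂` from the third block, and `f₃` merges the two.
    -- Then `f₁` and `f₃` are split by the recursion for the first two blocks, whereas in `f₂` the
    -- factor of the third block just passes.
    have hA : A k (p + 1) (q + 1) (r + 1) =
        A (k + 1) p (q + 1) (r + 1) + A (k + 1) (p + 1) q (r + 1) * run s (k + 1) (p + 1) +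
        A (k + 2) p q (r + 1) * (X (k + 1) * run s (k + 2) p) +
        A (k + 1) (p + 1) (q + 1) r * run s (k + 1) (p + q + 2) +
        (A (k + 2) p (q + 1) r * (X (k + 1) * run s (k + 2) (p + q + 1)) +
        A (k + 2) (p + 1) q r *
          (X (k + 1) * run s (k + 2) (p + q + 1)) * run s (k + 1) (p + 1) +
        A (k + 3) p q r * (X (k + 2) * run s (k + 3) (p + q)) * (X (k + 1) * run s (k + 2) p)) := by
      let f₁ := fun l => qsh s X (fun _ => 1) (k + 1 + l) (p + q + 1 - l) (r + 1)
      let f₂ := fun l => qsh s X (fun _ => 1) (k + 1 + l) (p + q + 2 - l) r *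
        run s (k + l + 1) (p + 1 + (q + 1) - l)
      let f₃ := fun l => qsh s X (fun _ => 1) (k + 2 + l) (p + q + 1 - l) r *
        (X (k + 1 + l) * run s (k + 1 + l + 1) (p + q + 1 - l))
      have e₁ : qsh s X f₁ k (p + 1) (q + 1) = A (k + 1) p (q + 1) (r + 1) +
          A (k + 1) (p + 1) q (r + 1) * run s (k + 1) (p + 1) +
          A (k + 2) p q (r + 1) * (X (k + 1) * run s (k + 2) p) := by
        simp only [qsh_succ, A, f₁]
        congr 4 <;> funext l
        · rw [show p + 1 + q = p + q + 1 by ring]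
        · rw [show k + 1 + (l + 1) = k + 2 + l by ring, Nat.add_sub_add_right]
      have e₂ : qsh s X f₂ k (p + 1) (q + 1) =
          A (k + 1) (p + 1) (q + 1) r * run s (k + 1) (p + q + 2) := by
        simp only [f₂]
        rw [h.qsh_run_passing _ _ _ _ (by omega), show p + 1 + (q + 1) = p + q + 2 by ring]
        simp only [A, show p + 1 + (q + 1) = p + q + 2 by ring]
      have e₃ : qsh s X f₃ k (p + 1) (q + 1) =
          A (k + 2) p (q + 1) r * (X (k + 1) * run s (k + 2) (p + q + 1)) +
          A (k + 2) (p + 1) q r *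
            (X (k + 1) * run s (k + 2) (p + q + 1)) * run s (k + 1) (p + 1) +
          A (k + 3) p q r * (X (k + 2) * run s (k + 3) (p + q)) *
            (X (k + 1) * run s (k + 2) p) := by
        have u := h.qsh_X_run_passing (fun l => qsh s X (fun _ => 1) (k + 2 + l) (p + q + 1 - l) r)
          (k + 1) p (q + 1) (by omega) (by omega)
        have v := h.qsh_X_run_passing (fun l => qsh s X (fun _ => 1) (k + 2 + l) (p + q + 1 - l) r)
          (k + 1) (p + 1) q (by omega) (by omega)
        have w := h.qsh_X_run_passing (fun l => qsh s X (fun _ => 1) (k + 3 + l) (p + q - l) r)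
          (k + 2) p q (by omega) (by omega)
        simp only [show p + 1 + q = p + q + 1 by ring] at v
        simp only [← add_assoc] at u
        have hf : (fun l => f₃ (l + 1)) = fun l => qsh s X (fun _ => 1) (k + 3 + l) (p + q - l) r *
            (X (k + 2 + l) * run s (k + 2 + l + 1) (p + q - l)) := by
          funext l
          simp only [f₃, show ∀ c, k + c + (l + 1) = k + (c + 1) + l from fun c => by ring,
            Nat.add_sub_add_right]
        rw [qsh_succ, hf]
        simp only [f₃]
        rw [u, v, w]
        simp only [A, show p + 1 + q = p + q + 1 by ring, ← add_assoc]
      rw [← e₁, ← e₂, ← e₃, ← qsh_add, ← qsh_add]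
      refine qsh_congr _ _ _ _ _ fun l hp hq => ?_
      simp only [f₁, f₂, f₃]
      rw [show p + 1 + (q + 1) - l = p + q + 1 - l + 1 by omega, qsh_succ,
        show p + q + 2 - l = p + q + 1 - l + 1 by omega]
      simp only [add_right_comm k _ l]
    -- The same seven sets for the other bracketing. Now `f₁` takes the factor from the first block,
    -- while `f₂` and `f₃` involve the product of the last two blocks and split into three terms
    -- each.
    have hB : B k (p + 1) (q + 1) (r + 1) =
        B (k + 1) p (q + 1) (r + 1) +
        (B (k + 1) (p + 1) q (r + 1) * run s (k + 1) (p + 1) +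
        B (k + 1) (p + 1) (q + 1) r * run s (k + 1) (p + 1) * run s (k + p + 2) (q + 1) +
        B (k + 2) (p + 1) q r * run s (k + 2) (p + 1) *
          (X (k + p + 2) * run s (k + p + 3) q)) +
        (B (k + 2) p q (r + 1) * (X (k + 1) * run s (k + 2) p) +
        B (k + 2) p (q + 1) r * (X (k + 1) * run s (k + 2) p) * run s (k + p + 2) (q + 1) +
        B (k + 3) p q r * (X (k + 2) * run s (k + 3) p) *
          (X (k + p + 2) * run s (k + p + 3) q)) := by
      let f₁ := fun l => qsh s X (fun _ => 1) (k + 1 + l) p (q + r + 2 - l)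
      let f₂ := fun l => qsh s X (fun _ => 1) (k + 1 + l) (p + 1) (q + r + 1 - l) *
        run s (k + 1 + l) (p + 1)
      let f₃ := fun l => qsh s X (fun _ => 1) (k + 2 + l) p (q + r + 1 - l) *
        (X (k + 1 + l) * run s (k + 1 + l + 1) p)
      have e₁ : qsh s X f₁ (k + p + 1) (q + 1) (r + 1) = B (k + 1) p (q + 1) (r + 1) := by
        simp only [B, f₁, show q + 1 + (r + 1) = q + r + 2 by ring, add_right_comm k 1 p]
      have e₂ : qsh s X f₂ (k + p + 1) (q + 1) (r + 1) =
          B (k + 1) (p + 1) q (r + 1) * run s (k + 1) (p + 1) +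
          B (k + 1) (p + 1) (q + 1) r * run s (k + 1) (p + 1) * run s (k + p + 2) (q + 1) +
          B (k + 2) (p + 1) q r * run s (k + 2) (p + 1) *
            (X (k + p + 2) * run s (k + p + 3) q) := by
        have hf : (fun l => f₂ (l + 1)) = fun l =>
            qsh s X (fun _ => 1) (k + 2 + l) (p + 1) (q + r - l) * run s (k + 2 + l) (p + 1) := by
          funext l
          simp only [f₂, show ∀ c, k + c + (l + 1) = k + (c + 1) + l from fun c => by ring,
            Nat.add_sub_add_right]
        rw [qsh_succ, hf]
        simp only [f₂]
        rw [h.qsh_run _ _ _ _ _ _ (by omega) (by omega) (by omega),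
          h.qsh_run _ _ _ _ _ _ (by omega) (by omega) (by omega),
          h.qsh_run _ _ _ _ _ _ (by omega) (by omega) (by omega)]
        simp only [B, show k + 1 + (p + 1) = k + p + 1 + 1 by ring,
          show k + 2 + (p + 1) = k + p + 1 + 2 by ring, show q + 1 + r = q + r + 1 by ring,
          ← add_assoc]
      have e₃ : qsh s X f₃ (k + p + 1) (q + 1) (r + 1) =
          B (k + 2) p q (r + 1) * (X (k + 1) * run s (k + 2) p) +
          B (k + 2) p (q + 1) r * (X (k + 1) * run s (k + 2) p) * run s (k + p + 2) (q + 1) +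
          B (k + 3) p q r * (X (k + 2) * run s (k + 3) p) *
            (X (k + p + 2) * run s (k + p + 3) q) := by
        have hf : (fun l => f₃ (l + 1)) = fun l => qsh s X (fun _ => 1) (k + 3 + l) p (q + r - l) *
            (X (k + 2 + l) * run s (k + 2 + l + 1) p) := by
          funext l
          simp only [f₃, show ∀ c, k + c + (l + 1) = k + (c + 1) + l from fun c => by ring,
            Nat.add_sub_add_right]
        rw [qsh_succ, hf]
        simp only [f₃]
        rw [h.qsh_X_run _ _ _ _ _ _ (by omega) (by omega) (by omega),
          h.qsh_X_run _ _ _ _ _ _ (by omega) (by omega) (by omega),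
          h.qsh_X_run _ _ _ _ _ _ (by omega) (by omega) (by omega)]
        simp only [B, show k + 2 + p = k + p + 1 + 1 by ring,
          show k + 3 + p = k + p + 1 + 2 by ring, show q + 1 + r = q + r + 1 by ring,
          ← add_assoc]
      rw [← e₁, ← e₂, ← e₃, ← qsh_add, ← qsh_add]
      simp only [B]
      rw [show k + (p + 1) = k + p + 1 by ring]
      refine qsh_congr _ _ _ _ _ fun l hp hq => ?_
      simp only [f₁, f₂, f₃]
      rw [show q + 1 + (r + 1) - l = q + r + 1 - l + 1 by omega, qsh_succ,
        show q + r + 2 - l = q + r + 1 - l + 1 by omega]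
      simp only [add_right_comm k _ l]
    change A k (p + 1) (q + 1) (r + 1) = B k (p + 1) (q + 1) (r + 1)
    rw [hA, hB]
    -- The term merging the first factors of the second and third blocks: they pass the first block
    -- separately on one side and as a merged factor on the other.
    have vw : X (k + 1) * run s (k + 2) (p + q + 1) * run s (k + 1) (p + 1) =
        run s (k + 2) (p + 1) * (X (k + p + 2) * run s (k + p + 3) q) := by
      have := h.run_X_left (k + 1) (p + 1) (by omega) (by omega)
      rw [show k + 1 + (p + 1) = k + p + 2 by ring] at this
      rw [← mul_assoc, this, show p + q + 1 = p + 1 + q by ring, run_add, ← mul_assoc,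
        mul_assoc, show k + 2 + (p + 1) = k + p + 3 by ring,
        h.run_run_comm _ _ _ _ (by omega) (by omega) (by omega), ← mul_assoc]
    -- The term merging the first factors of all three blocks, the only place where `X_X_assoc` is
    -- needed.
    have uvw : X (k + 2) * run s (k + 3) (p + q) * (X (k + 1) * run s (k + 2) p) =
        X (k + 2) * run s (k + 3) p * (X (k + p + 2) * run s (k + p + 3) q) := by
      have := h.run_X_left (k + 2) p (by omega) (by omega)
      rw [show k + 2 + p = k + p + 2 by ring] at this
      rw [← mul_assoc (X (k + 2) * run s (k + 3) p), mul_assoc (X (k + 2)) (run s (k + 3) p), this,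
        mul_assoc (X (k + 2)), ← mul_assoc (run s (k + 3) (p + q)),
        h.run_X_of_gt _ _ _ (by omega) (by omega) (by omega), run_add,
        show k + 3 + p = k + p + 3 by ring]
      simp only [mul_assoc]
      rw [h.run_run_comm _ _ _ _ (by omega) (by omega) (by omega), ← mul_assoc, ← mul_assoc,
        h.X_X_assoc _ (by omega) (by omega)]
      simp only [mul_assoc]
    rw [IH _ _ _ _ (by omega) (by omega), IH _ _ _ _ (by omega) (by omega),
      IH _ _ _ _ (by omega) (by omega), IH _ _ _ _ (by omega) (by omega),
      IH _ _ _ _ (by omega) (by omega), IH _ _ _ _ (by omega) (by omega),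
      IH _ _ _ _ (by omega) (by omega),
      mul_assoc (B (k + 2) (p + 1) q r), mul_assoc (B (k + 2) (p + 1) q r), vw,
      mul_assoc (B (k + 3) p q r), mul_assoc (B (k + 3) p q r), uvw,
      show p + q + 2 = p + 1 + (q + 1) by ring, run_add _ (k + 1) (p + 1) (q + 1),
      show p + q + 1 = p + (q + 1) by ring, run_add _ (k + 2) p (q + 1),
      show k + 1 + (p + 1) = k + p + 2 by ring, show k + 2 + p = k + p + 2 by ring]
    simp only [mul_assoc]
    abel

end MergeRel

end QuasiShuffle

/-! ### Exchanges and mergings in the monoid algebra -/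

noncomputable section

namespace GVB

open QuasiShuffle

variable (K : Type*) [Field K] {n : ℕ}

theorem sigmaRun_eq_run (a m : ℕ) : sigmaRun K n a m = run (sigma K n) a m := rfl

theorem sigma_mul_sigma {a b : ℕ} (ha : 1 ≤ a) (hab : a + 2 ≤ b) (hb : b < n) :
    sigma K n a * sigma K n b = sigma K n b * sigma K n a := by
  simp only [sigma, dif_pos (show 1 ≤ a ∧ a < n by omega), dif_pos (show 1 ≤ b ∧ b < n by omega),
    ← map_mul]
  exact congrArg _ (PresentedMonoid.mk_eq_mk_of_rel (.comm_ss _ _ (by simp only; omega)))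

theorem sigma_mul_xi {a b : ℕ} (ha : 1 ≤ a) (ha' : a < n) (hb : 1 ≤ b) (hb' : b < n)
    (hab : a + 2 ≤ b ∨ b + 2 ≤ a) : sigma K n a * xi K n b = xi K n b * sigma K n a := by
  simp only [sigma, xi, dif_pos (show 1 ≤ a ∧ a < n by omega),
    dif_pos (show 1 ≤ b ∧ b < n by omega), ← map_mul]
  exact congrArg _ (PresentedMonoid.mk_eq_mk_of_rel (.comm_sx _ _ (by simp only; omega)))

theorem sigma_braid {a : ℕ} (ha : 1 ≤ a) (ha' : a + 1 < n) :
    sigma K n a * sigma K n (a + 1) * sigma K n a =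
      sigma K n (a + 1) * sigma K n a * sigma K n (a + 1) := by
  simp only [sigma, dif_pos (show 1 ≤ a ∧ a < n by omega),
    dif_pos (show 1 ≤ a + 1 ∧ a + 1 < n by omega), ← map_mul]
  exact congrArg _ (PresentedMonoid.mk_eq_mk_of_rel (.braid_sss _ _ (by simp only; omega)))

theorem xi_mul_sigma_mul_sigma {a : ℕ} (ha : 1 ≤ a) (ha' : a + 1 < n) :
    xi K n a * sigma K n (a + 1) * sigma K n a =
      sigma K n (a + 1) * sigma K n a * xi K n (a + 1) := by
  simp only [sigma, xi, dif_pos (show 1 ≤ a ∧ a < n by omega),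
    dif_pos (show 1 ≤ a + 1 ∧ a + 1 < n by omega), ← map_mul]
  exact congrArg _ (PresentedMonoid.mk_eq_mk_of_rel (.braid_xss _ _ (by simp only; omega)))

theorem xi_succ_mul_sigma_mul_sigma {a : ℕ} (ha : 1 ≤ a) (ha' : a + 1 < n) :
    xi K n (a + 1) * sigma K n a * sigma K n (a + 1) =
      sigma K n a * sigma K n (a + 1) * xi K n a := by
  simp only [sigma, xi, dif_pos (show 1 ≤ a ∧ a < n by omega),
    dif_pos (show 1 ≤ a + 1 ∧ a + 1 < n by omega), ← map_mul]
  exact congrArg _ (PresentedMonoid.mk_eq_mk_of_rel (.braid_ssx _ _ (by simp only; omega)))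

theorem braidRel_sigma : BraidRel (sigma K n) n where
  s_s _ _ := sigma_mul_sigma K
  braid _ := sigma_braid K

variable (n) in
/-- `σ_1 ⋯ σ_{a-1} ξ_a`: merging of the factors `a` and `a + 1`, followed by moving the unit to the
front. -/
def merge (a : ℕ) : MonoidAlgebra K (GVB n) := run (sigma K n) 1 (a - 1) * xi K n a

theorem merge_succ (a : ℕ) : merge K n (a + 1) = run (sigma K n) 1 a * xi K n (a + 1) := rfl

theorem sigma_mul_merge_of_lt {a b : ℕ} (hb : 1 ≤ b) (hab : b + 2 ≤ a) (ha : a < n) :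
    sigma K n (b + 1) * merge K n a = merge K n a * sigma K n b := by
  rw [merge, ← mul_assoc, (braidRel_sigma K).s_run _ _ _ le_rfl hb (by omega) (by omega),
    mul_assoc, sigma_mul_xi K (by omega) (by omega) (by omega) (by omega) (by omega), mul_assoc]

theorem sigma_mul_merge_of_gt {a b : ℕ} (ha : 1 ≤ a) (hab : a + 2 ≤ b) (hb : b < n) :
    sigma K n b * merge K n a = merge K n a * sigma K n b := by
  rw [merge, ← mul_assoc, (braidRel_sigma K).s_run_of_gt _ _ _ le_rfl (by omega) (by omega),
    mul_assoc, sigma_mul_xi K (by omega) (by omega) (by omega) (by omega) (by omega), mul_assoc]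

theorem sigma_mul_merge_left {a : ℕ} (ha : 1 ≤ a) (ha' : a + 1 < n) :
    sigma K n (a + 1) * merge K n (a + 1) = merge K n a * sigma K n (a + 1) * sigma K n a := by
  obtain ⟨a, rfl⟩ : ∃ c, a = c + 1 := ⟨a - 1, by omega⟩
  rw [merge_succ, merge_succ, run_succ, ← mul_assoc, ← mul_assoc,
    (braidRel_sigma K).s_run_of_gt _ _ _ le_rfl (by omega) (by omega), add_comm 1 a]
  simp only [mul_assoc]
  rw [← mul_assoc (sigma K n _), ← xi_mul_sigma_mul_sigma K (by omega) (by omega), mul_assoc]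

/-- The relation `s_X_right` would need `σ_{a+1} ξ_a` in place of the last four letters. The
additional `σ_a σ_a` lets the left-over unit cross a neighbour back and forth; it disappears only in
the action. -/
theorem merge_mul_sigma_mul_sigma {a : ℕ} (ha : 1 ≤ a) (ha' : a + 1 < n) :
    merge K n (a + 1) * sigma K n a * sigma K n (a + 1) =
      run (sigma K n) 1 (a - 1) *
        (sigma K n a * sigma K n a * sigma K n (a + 1) * xi K n a) := by
  obtain ⟨a, rfl⟩ : ∃ c, a = c + 1 := ⟨a - 1, by omega⟩
  rw [merge_succ, mul_assoc, mul_assoc, ← mul_assoc (xi K n _),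
    xi_succ_mul_sigma_mul_sigma K (by omega) (by omega), run_succ, add_comm 1 a]
  simp only [mul_assoc, Nat.add_sub_cancel]

end GVB

/-! ### Exchanges and mergings on pure tensors -/

namespace TensorSlots

open QuasiShuffle UnitalBraidedAlgebra

variable {K : Type*} [Field K] {V : Type*} [AddCommGroup V] [Module K V]

theorem slotOp_word₄ {n : ℕ} (a b c : Fin n) (hab : a ≠ b) (hac : a ≠ c) (hbc : b ≠ c)
    (f g : Module.End K (V ⊗[K] V)) (h : on12 f * on12 f * on23 f * on12 g = on23 f * on12 g) :
    slotOp f a b hab * slotOp f a b hab * slotOp f b c hbc * slotOp g a b hab =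
      slotOp f b c hbc * slotOp g a b hab := by
  apply PiTensorProduct.ext
  ext v
  have L := fun (f : Module.End K (V ⊗[K] V)) w =>
    LinearMap.congr_fun (slotOp_ins₃_left v a b c hab hac hbc f) w
  have R := fun (f : Module.End K (V ⊗[K] V)) w =>
    LinearMap.congr_fun (slotOp_ins₃_right v a b c hab hac hbc f) w
  simp only [LinearMap.comp_apply] at L R
  have h' := congrArg (ins₃ v a b c hab hac hbc)
    (LinearMap.congr_fun h (v a ⊗ₜ (v b ⊗ₜ v c)))
  simp only [Module.End.mul_apply] at h'
  simp only [LinearMap.compMultilinearMap_apply, Module.End.mul_apply]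
  rw [← ins₃_self (K := K) v a b c hab hac hbc, L, R, L, L, h']

/-- The operator on `V^{⊗ n}` applying `f` to the factors `a` and `a + 1`, counted from `1` (by
convention the identity if `a` is out of range). -/
def nthOp (n : ℕ) (f : Module.End K (V ⊗[K] V)) (a : ℕ) : Module.End K (⨂[K]^n V) :=
  if h : 1 ≤ a ∧ a < n then adjacentOp f ⟨a - 1, by omega⟩ else 1

variable (K) in
/-- The pure tensor `w 0 ⊗ ⋯ ⊗ w (n - 1)`. -/
def pureTensor (n : ℕ) (w : ℕ → V) : ⨂[K]^n V := PiTensorProduct.tprod K fun c : Fin n => w c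

theorem pureTensor_congr {n : ℕ} {w w' : ℕ → V} (h : ∀ c, c < n → w c = w' c) :
    pureTensor K n w = pureTensor K n w' :=
  congrArg (PiTensorProduct.tprod K) (funext fun c : Fin n => h c c.2)

theorem ext_pureTensor {n : ℕ} {M : Type*} [AddCommMonoid M] [Module K M] {f g : (⨂[K]^n V) →ₗ[K] M}
    (h : ∀ w, f (pureTensor K n w) = g (pureTensor K n w)) : f = g := by
  apply PiTensorProduct.ext
  ext v
  have : PiTensorProduct.tprod K v = pureTensor K n fun c => if h : c < n then v ⟨c, h⟩ else 0 := by
    simp [pureTensor]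
  simp only [LinearMap.compMultilinearMap_apply]
  rw [this, h]

/-- Operators are numbered from `1` and slots from `0`, so the operator numbered `a + 1` acts on the
slots `a` and `a + 1`. -/
theorem nthOp_pureTensor {n : ℕ} (f : Module.End K (V ⊗[K] V)) {a : ℕ} (ha : a + 1 < n) {w : ℕ → V}
    {x y : V} (h : f (w a ⊗ₜ w (a + 1)) = x ⊗ₜ y) :
    nthOp n f (a + 1) (pureTensor K n w) =
      pureTensor K n (Function.update (Function.update w a x) (a + 1) y) := by
  rw [nthOp, dif_pos (by omega), pureTensor, adjacentOp]
  simp only [Nat.add_sub_cancel, slotOp_tprod, h, ins_tmul]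
  rw [pureTensor]
  congr 1
  funext c
  simp only [Function.update_apply, Fin.ext_iff]

theorem nthOp_pureTensor_eq_zero {n : ℕ} (f : Module.End K (V ⊗[K] V)) {a : ℕ} (ha : a + 1 < n)
    {w : ℕ → V} (h : f (w a ⊗ₜ w (a + 1)) = 0) : nthOp n f (a + 1) (pureTensor K n w) = 0 := by
  rw [nthOp, dif_pos (by omega), pureTensor, adjacentOp]
  simp only [Nat.add_sub_cancel, slotOp_tprod, h, map_zero]

/-- Moving the factor `e` in slot `b + m` to slot `b`. -/
theorem run_nthOp_pureTensor {n : ℕ} (f : Module.End K (V ⊗[K] V)) (b m : ℕ) (hm : b + m < n)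
    (e : V) :
    ∀ w : ℕ → V, w (b + m) = e → (∀ c, b ≤ c → c < b + m → f (w c ⊗ₜ e) = e ⊗ₜ w c) →
    run (nthOp n f) (b + 1) m (pureTensor K n w) =
      pureTensor K n fun c =>
        if c = b then e else if b < c ∧ c ≤ b + m then w (c - 1) else w c := by
  induction m with
  | zero =>
    intro w hw _
    rw [run_zero, Module.End.one_apply]
    refine pureTensor_congr fun c _ => ?_
    split_ifs with h1 h2
    · rw [h1, ← hw, add_zero]
    · omega
    · rfl
  | succ m ih =>
    intro w hw h
    rw [run_succ, Module.End.mul_apply, add_right_comm b 1 m,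
      nthOp_pureTensor f (a := b + m) (w := w) hm (x := e) (y := w (b + m))
        (by rw [show b + m + 1 = b + (m + 1) from rfl, hw]; exact h _ (by omega) (by omega)),
      ih (by omega)]
    · refine pureTensor_congr fun c _ => ?_
      simp only [Function.update_apply]
      split_ifs <;> first | rfl | omega | skip
      congr 1; omega
    · simp
    · intro c hc hc'
      rw [Function.update_of_ne (by omega), Function.update_of_ne (by omega)]
      exact h c hc (by omega)

/-- Merging the factors in the slots `a` and `a + 1` into `e ⊗ y`, and moving `e` to the front. -/
theorem run_nthOp_mul_nthOp_pureTensor {n : ℕ} (f g : Module.End K (V ⊗[K] V)) (a : ℕ)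
    (ha : a + 1 < n)
    (e y : V) (w : ℕ → V) (hg : g (w a ⊗ₜ w (a + 1)) = e ⊗ₜ y)
    (hf : ∀ c < a, f (w c ⊗ₜ e) = e ⊗ₜ w c) :
    (run (nthOp n f) 1 a * nthOp n g (a + 1)) (pureTensor K n w) =
      pureTensor K n fun c => if c = 0 then e else if c ≤ a then w (c - 1)
        else if c = a + 1 then y else w c := by
  rw [Module.End.mul_apply, nthOp_pureTensor g ha hg, run_nthOp_pureTensor f 0 a (by omega) e]
  · refine pureTensor_congr fun c _ => ?_
    simp only [Function.update_apply]
    split_ifs <;> first | rfl | omega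
  · simp
  · intro c _ hc
    rw [Function.update_of_ne (by omega), Function.update_of_ne (by omega)]
    exact hf c (by omega)

/-- If the unit left behind by a merging cannot pass the first slot, the result is zero. -/
theorem run_nthOp_mul_nthOp_pureTensor_eq_zero {n : ℕ} (f g : Module.End K (V ⊗[K] V)) (a : ℕ)
    (ha : a + 2 < n) (e y : V) (w : ℕ → V) (hg : g (w (a + 1) ⊗ₜ w (a + 2)) = e ⊗ₜ y)
    (hf : ∀ c, 1 ≤ c → c < a + 1 → f (w c ⊗ₜ e) = e ⊗ₜ w c) (h₀ : f (w 0 ⊗ₜ e) = 0) :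
    (run (nthOp n f) 1 (a + 1) * nthOp n g (a + 2)) (pureTensor K n w) = 0 := by
  rw [Module.End.mul_apply, nthOp_pureTensor g ha hg, run_succ', Module.End.mul_apply,
    run_nthOp_pureTensor f 1 a (by omega) e]
  · exact nthOp_pureTensor_eq_zero (a := 0) f (by omega) (by simpa using h₀)
  · simp [add_comm 1 a]
  · intro c hc hc'
    rw [Function.update_of_ne (by omega), Function.update_of_ne (by omega)]
    exact hf c hc (by omega)

end TensorSlots

/-! ### The merging relations in the action of a unital braided algebra -/

namespace UnitalBraidedAlgebra

open TensorSlots QuasiShuffle GVB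

variable {K : Type*} [Field K] {V : Type*} [AddCommGroup V] [Module K V]
  (A : UnitalBraidedAlgebra K V)

/-- on `V ⊗ V ⊗ V`: `σ₁ σ₁ σ₂ ξ₁ = σ₂ ξ₁` -/
theorem word_sssx : on12 A.braid * on12 A.braid * on23 A.braid * on12 A.braidMul =
    on23 A.braid * on12 A.braidMul := by
  -- After `ξ₁` the first factor is `𝟏` and `σ₂` leaves it there; the two copies of `σ₁` then
  -- cancel, since `𝟏` is braided trivially from both sides.
  have key : ∀ w : V ⊗[K] V, on12 A.braid (on12 A.braid (A.one ⊗ₜ w)) = A.one ⊗ₜ w := by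
    intro w
    induction w with
    | zero => simp
    | add w w' hw hw' => simp only [TensorProduct.tmul_add, map_add, hw, hw']
    | tmul p q => simp [on12, A.braid_one_left, A.braid_one_right]
  ext x y z
  simp [on12_braidMul, on23, key]

variable (n : ℕ)

theorem rep_sigma (a : ℕ) : A.rep n (sigma K n a) = nthOp n A.braid a := by
  unfold sigma nthOp
  split_ifs with h
  · simp [rep, action, genOp]
  · simp

theorem rep_xi (a : ℕ) : A.rep n (xi K n a) = nthOp n A.braidMul a := by
  unfold xi nthOp
  split_ifs with h
  · simp [rep, action, genOp]
  · simp

theorem rep_run (a m : ℕ) : A.rep n (run (sigma K n) a m) = run (nthOp n A.braid) a m := by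
  rw [← AlgHom.coe_toRingHom, map_run]
  simp only [AlgHom.coe_toRingHom, rep_sigma]

variable {n}

theorem rep_merge_pureTensor (a : ℕ) (ha : a + 1 < n) (w : ℕ → V) :
    A.rep n (merge K n (a + 1)) (pureTensor K n w) =
      pureTensor K n fun c => if c = 0 then A.one else if c ≤ a then w (c - 1)
        else if c = a + 1 then A.mul (w a ⊗ₜ w (a + 1)) else w c := by
  rw [merge_succ, map_mul, rep_run, rep_xi]
  exact run_nthOp_mul_nthOp_pureTensor _ _ a ha _ _ w rfl fun c _ => A.braid_one_right _

/-- The relations up to `s_X_left` are images of identities in the monoid algebra. The relation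
`s_X_right` is repaired by `word_sssx`. The last two can be read off on pure tensors, since merging
maps pure tensors to pure tensors; `X_X_assoc` then is associativity of `m`. -/
theorem mergeRel_rep :
    MergeRel (fun a => A.rep n (sigma K n a)) (fun a => A.rep n (merge K n a)) n where
  s_s a b h1 h2 h3 := by simp only [← map_mul, sigma_mul_sigma K h1 h2 h3]
  braid a h1 h2 := by simp only [← map_mul, sigma_braid K h1 h2]
  s_X_of_lt a b h1 h2 h3 := by simp only [← map_mul, sigma_mul_merge_of_lt K h1 h2 h3]
  s_X_of_gt a b h1 h2 h3 := by simp only [← map_mul, sigma_mul_merge_of_gt K h1 h2 h3]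
  s_X_left a h1 h2 := by simp only [← map_mul, sigma_mul_merge_left K h1 h2]
  s_X_right a h1 h2 := by
    simp only [← map_mul]
    rw [merge_mul_sigma_mul_sigma K h1 h2, merge, ← mul_assoc (sigma K n (a + 1)),
      (braidRel_sigma K).s_run_of_gt _ _ _ le_rfl (by omega) (by omega), mul_assoc]
    simp only [map_mul]
    congr 1
    simp only [rep_sigma, rep_xi, nthOp, dif_pos (show 1 ≤ a ∧ a < n by omega),
      dif_pos (show 1 ≤ a + 1 ∧ a + 1 < n by omega), adjacentOp]
    obtain ⟨a, rfl⟩ : ∃ c, a = c + 1 := ⟨a - 1, by omega⟩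
    exact (slotOp_word₄ ⟨a, by omega⟩ ⟨a + 1, by omega⟩ ⟨a + 2, by omega⟩ (by simp) (by simp)
      (by simp) _ _ A.word_sssx).symm
  X_X a b h1 h2 h3 := by
    obtain ⟨a, rfl⟩ : ∃ c, a = c + 1 := ⟨a - 1, by omega⟩
    obtain ⟨b, rfl⟩ : ∃ c, b = c + 1 := ⟨b - 1, by omega⟩
    refine ext_pureTensor fun w => ?_
    simp only [Module.End.mul_apply]
    rw [rep_merge_pureTensor _ _ (by omega), rep_merge_pureTensor _ _ (by omega),
      rep_merge_pureTensor _ _ (by omega),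
      rep_merge_pureTensor _ _ (by omega)]
    refine pureTensor_congr fun c _ => ?_
    grind
  X_X_assoc a h1 h2 := by
    obtain ⟨a, rfl⟩ : ∃ c, a = c + 1 := ⟨a - 1, by omega⟩
    refine ext_pureTensor fun w => ?_
    simp only [Module.End.mul_apply]
    rw [rep_merge_pureTensor _ _ (by omega), rep_merge_pureTensor _ _ (by omega),
      rep_merge_pureTensor _ _ (by omega),
      rep_merge_pureTensor _ _ (by omega)]
    refine pureTensor_congr fun c _ => ?_
    have := A.mul_assoc (w a) (w (a + 1)) (w (a + 2))
    grind

end UnitalBraidedAlgebra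

end

/-! ### The grading by virtual length -/

noncomputable section

namespace GVB

open QuasiShuffle

variable (K : Type*) [Field K] {n : ℕ}

@[simp] theorem virtualLength_one : virtualLength (1 : GVB n) = 0 := by
  simp [virtualLength]

@[simp] theorem virtualLength_mul (τ τ' : GVB n) :
    virtualLength (τ * τ') = virtualLength τ + virtualLength τ' := by
  simp [virtualLength]

/-- `x` is an element of `GVB_n^+` of virtual length `d`. -/
def IsWord (x : MonoidAlgebra K (GVB n)) (d : ℕ) : Prop :=
  ∃ τ : GVB n, MonoidAlgebra.of K (GVB n) τ = x ∧ virtualLength τ = d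

variable {K}

theorem isWord_one : IsWord K (1 : MonoidAlgebra K (GVB n)) 0 :=
  ⟨1, map_one _, virtualLength_one⟩

theorem IsWord.mul {x y : MonoidAlgebra K (GVB n)} {d e : ℕ} (hx : IsWord K x d)
    (hy : IsWord K y e) : IsWord K (x * y) (d + e) := by
  obtain ⟨τ, rfl, rfl⟩ := hx
  obtain ⟨τ', rfl, rfl⟩ := hy
  exact ⟨τ * τ', map_mul _ _ _, virtualLength_mul _ _⟩

theorem isWord_sigma (a : ℕ) : IsWord K (sigma K n a) 0 := by
  unfold sigma
  split_ifs with h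
  · exact ⟨_, rfl, by simp [virtualLength, virtualLengthHom, Gen.xiCount]⟩
  · exact isWord_one

theorem isWord_xi {a : ℕ} (h : 1 ≤ a ∧ a < n) : IsWord K (xi K n a) 1 := by
  rw [xi, dif_pos h]
  exact ⟨_, rfl, by simp [virtualLength, virtualLengthHom, Gen.xiCount]⟩

theorem isWord_run (a m : ℕ) : IsWord K (run (sigma K n) a m) 0 := by
  induction m with
  | zero => exact isWord_one
  | succ m ih =>
    rw [run_succ]
    exact ih.mul (isWord_sigma _)

theorem isWord_merge {a : ℕ} (h : 1 ≤ a ∧ a < n) : IsWord K (merge K n a) 1 := by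
  exact zero_add 1 ▸ (isWord_run 1 (a - 1)).mul (isWord_xi (K := K) h)

/-- The linear map `τ ↦ f l τ` for `τ ∈ GVB_n^+` of virtual length `l`. -/
def gradedMul (f : ℕ → MonoidAlgebra K (GVB n)) :
    MonoidAlgebra K (GVB n) →ₗ[K] MonoidAlgebra K (GVB n) :=
  Finsupp.linearCombination K
    (fun τ => f (virtualLength τ) * MonoidAlgebra.of K (GVB n) τ) ∘ₗ
      (MonoidAlgebra.coeffLinearEquiv K).toLinearMap

theorem gradedMul_of (f : ℕ → MonoidAlgebra K (GVB n)) (τ : GVB n) :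
    gradedMul f (MonoidAlgebra.of K (GVB n) τ) =
      f (virtualLength τ) * MonoidAlgebra.of K (GVB n) τ := by
  simp [gradedMul]

/-- Virtual length is additive, so a right factor of virtual length `d` shifts the argument of the
weight by `d`. -/
theorem gradedMul_mul (f : ℕ → MonoidAlgebra K (GVB n)) (x : MonoidAlgebra K (GVB n))
    {y : MonoidAlgebra K (GVB n)} {d : ℕ} (hy : IsWord K y d) :
    gradedMul f (x * y) = gradedMul (fun l => f (l + d)) x * y := by
  obtain ⟨τ, rfl, rfl⟩ := hy
  induction x using MonoidAlgebra.induction_on with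
  | of τ' => rw [← map_mul, gradedMul_of, gradedMul_of, virtualLength_mul, map_mul, mul_assoc]
  | add x y hx hy => rw [add_mul, map_add, map_add, hx, hy, add_mul]
  | smul c x hx => rw [smul_mul_assoc, map_smul, map_smul, hx, smul_mul_assoc]

/-- The right factors in the recursion have virtual lengths `0`, `0` and `1`, which matches the
shift of the weight in its third term. This links the dependence of `M` and `M'` on `l_v` with
nested quasi-shuffles. -/
theorem qsh_eq_gradedMul (k p q : ℕ) : ∀ f : ℕ → MonoidAlgebra K (GVB n), k + p + q ≤ n →
    qsh (sigma K n) (merge K n) f k p q =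
      gradedMul f (qsh (sigma K n) (merge K n) (fun _ => 1) k p q) := by
  have h1 : ∀ f : ℕ → MonoidAlgebra K (GVB n), gradedMul f 1 = f 0 := fun f => by
    rw [← map_one (MonoidAlgebra.of K (GVB n)), gradedMul_of, virtualLength_one, map_one, mul_one]
  induction k, p, q using qsh_induction with
  | h_left k q => intro f _; simp [h1]
  | h_right k p => intro f _; simp [h1]
  | h_succ k p q i1 i2 i3 =>
    intro f hn
    rw [qsh_succ, qsh_succ, map_add, map_add, gradedMul_mul f _ (isWord_run _ _),
      gradedMul_mul f _ ((isWord_merge (by omega)).mul (isWord_run _ _)), i1 f (by omega),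
      i2 f (by omega), i3 (fun l => f (l + 1)) (by omega)]
    rfl

end GVB

/-! ### Recursion for shuffles and their lifts -/

namespace Lifting

open Equiv GVB QuasiShuffle

variable {n : ℕ}

theorem shuffles_zero_left {q k : ℕ} : shuffles n 0 q k = {1} := by
  ext σ
  refine ⟨fun h => ?_, ?_⟩
  · obtain ⟨_, -, hu⟩ := existsUnique_block_decomp σ k (k + q)
    -- With an empty first part, `(σ, 1)` and `(1, σ)` are both block decompositions of `σ`, so
    -- uniqueness forces `σ = 1`.
    have h1 := hu (σ, 1) ⟨fun a b ha hab hb => h.2.2 a b ha hab (by omega), fun a _ => rfl,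
      mul_one _⟩
    have h2 := hu (1, σ) ⟨fun a b _ hab _ => hab, fun a ha => h.1 a (by omega), one_mul _⟩
    exact congrArg Prod.fst (h1.trans h2.symm)
  · rintro rfl
    exact ⟨fun _ _ => rfl, fun _ _ _ h _ => h, fun _ _ _ h _ => h⟩

theorem shuffles_zero_right {p k : ℕ} : shuffles n p 0 k = {1} := by
  rw [← shuffles_zero_left (n := n) (q := p) (k := k)]
  ext σ
  constructor
  · rintro ⟨h1, h2, -⟩
    exact ⟨fun a ha => h1 a (by omega), fun a b _ hab _ => by rw [Fin.lt_def] at hab; omega,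
      fun a b ha hab hb => h2 a b ha hab (by omega)⟩
  · rintro ⟨h1, -, h3⟩
    exact ⟨fun a ha => h1 a (by omega), fun a b ha hab hb => h3 a b ha hab (by omega),
      fun a b _ hab _ => by rw [Fin.lt_def] at hab; omega⟩

theorem shuffles_block {p q k : ℕ} {σ : Perm (Fin n)} (h : σ ∈ shuffles n p q k) (a : Fin n)
    (ha : k ≤ (a : ℕ) ∧ (a : ℕ) < k + p + q) : k ≤ (σ a : ℕ) ∧ (σ a : ℕ) < k + p + q :=
  block_apply_mem (fun a ha => h.1 a (by omega)) a ha

theorem mem_shuffles_succ_iff {p q k : ℕ} (hn : k + (p + 1) + q ≤ n) (σ : Perm (Fin n)) :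
    σ ∈ shuffles n p q (k + 1) ↔
      σ ∈ shuffles n (p + 1) q k ∧ σ ⟨k, by omega⟩ = ⟨k, by omega⟩ := by
  constructor
  · intro h
    have hk : σ ⟨k, by omega⟩ = ⟨k, by omega⟩ := h.1 _ (by simp)
    refine ⟨⟨fun a ha => h.1 a (by omega), fun a b ha hab hb => ?_, fun a b ha hab hb =>
      h.2.2 a b (by omega) hab (by omega)⟩, hk⟩
    rcases Nat.eq_or_lt_of_le ha with rfl | ha'
    · rw [Fin.lt_def] at hab ⊢
      have := shuffles_block h b (by omega)
      have e : (σ a : ℕ) = a := congrArg Fin.val hk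
      omega
    · exact h.2.1 a b ha' hab (by omega)
  · rintro ⟨h, hk⟩
    refine ⟨fun a ha => ?_, fun a b ha hab hb => h.2.1 a b (by omega) hab (by omega),
      fun a b ha hab hb => h.2.2 a b (by omega) hab (by omega)⟩
    by_cases e : (a : ℕ) = k
    · rw [show a = ⟨k, by omega⟩ from Fin.ext e]
      exact hk
    · exact h.1 a (by omega)

/-- If the first position of the block is not fixed by a shuffle, it is taken by the first position
of the second part of the block. -/
theorem shuffles_apply_of_ne {p q k : ℕ} (hn : k + (p + 1) + q ≤ n) {σ : Perm (Fin n)}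
    (h : σ ∈ shuffles n (p + 1) q k) (hk : σ ⟨k, by omega⟩ ≠ ⟨k, by omega⟩) :
    ∃ hq : k + (p + 1) < n, σ ⟨k + (p + 1), hq⟩ = ⟨k, by omega⟩ := by
  obtain ⟨x, hx⟩ := σ.surjective ⟨k, by omega⟩
  have hxk : (x : ℕ) ≠ k := by
    intro e
    rw [show x = ⟨k, by omega⟩ from Fin.ext e] at hx
    exact hk hx
  have hxv : (σ x : ℕ) = k := congrArg Fin.val hx
  have hout : k ≤ (x : ℕ) ∧ (x : ℕ) < k + (p + 1) + q := by
    by_contra hc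
    have := congrArg Fin.val (h.1 x (by omega))
    omega
  have h1 : k + (p + 1) ≤ (x : ℕ) := by
    by_contra hc
    have h2 := h.2.1 ⟨k, by omega⟩ x le_rfl (by rw [Fin.lt_def]; simp only; omega) (by omega)
    have h3 := shuffles_block h ⟨k, by omega⟩ (by simp only; omega)
    rw [Fin.lt_def] at h2
    omega
  refine ⟨by omega, ?_⟩
  rcases Nat.eq_or_lt_of_le h1 with h2 | h2
  · rw [← hx]
    congr 1
    exact Fin.ext h2
  · have h3 := h.2.2 ⟨k + (p + 1), by omega⟩ x le_rfl (by rw [Fin.lt_def]; exact h2) (by omega)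
    have h4 := shuffles_block h ⟨k + (p + 1), by omega⟩ (by simp only; omega)
    rw [Fin.lt_def] at h3
    omega

/-- The cycle first brings the first factor of the second part to the front of the block, where `σ`
keeps it. Together with the next lemma this describes all shuffles that do not fix the first
position of the block. -/
theorem mul_simpleRun_mem_shuffles {p q k : ℕ} (hn : k + (p + 1) + (q + 1) ≤ n)
    {σ : Perm (Fin n)} (h : σ ∈ shuffles n (p + 1) q (k + 1)) :
    σ * simpleRun n (k + 1) (p + 1) ∈ shuffles n (p + 1) (q + 1) k ∧
      (σ * simpleRun n (k + 1) (p + 1)) ⟨k, by omega⟩ ≠ ⟨k, by omega⟩ := by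
  have hc := simpleRun_apply (n := n) (t := k + 1) (m := p + 1) (by omega) (by omega)
  set c := simpleRun n (k + 1) (p + 1)
  refine ⟨⟨fun a ha => ?_, fun a b ha hab hb => ?_, fun a b ha hab hb => ?_⟩, fun e => ?_⟩
  · have e : c a = a := by
      rw [Fin.ext_iff, hc]
      split_ifs <;> omega
    rw [Perm.mul_apply, e, h.1 a (by omega)]
  · rw [Fin.lt_def] at hab
    have ha' := hc a
    have hb' := hc b
    rw [if_neg (by omega), if_pos (by omega)] at ha' hb'
    exact h.2.1 _ _ (by omega) (by rw [Fin.lt_def]; omega) (by omega)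
  · rw [Fin.lt_def] at hab
    have ha' := hc a
    have hb' := hc b
    rw [if_neg (by omega), if_neg (by omega)] at hb'
    by_cases e : (a : ℕ) = k + (p + 1)
    · rw [if_pos (by omega)] at ha'
      have h1 := h.1 (c a) (by omega)
      have h2 := shuffles_block h (c b) (by omega)
      rw [Perm.mul_apply, Perm.mul_apply, h1, Fin.lt_def]
      omega
    · rw [if_neg (by omega), if_neg (by omega)] at ha'
      exact h.2.2 _ _ (by omega) (by rw [Fin.lt_def]; omega) (by omega)
  · have h1 := hc ⟨k, by omega⟩
    rw [if_neg (by simp only; omega), if_pos (by simp only; omega)] at h1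
    simp only at h1
    have h2 := shuffles_block h (c ⟨k, by omega⟩) (by omega)
    have h3 := congrArg Fin.val e
    rw [Perm.mul_apply] at h3
    simp only at h3
    omega

theorem mul_simpleRun_inv_mem_shuffles {p q k : ℕ} (hn : k + (p + 1) + (q + 1) ≤ n)
    {σ : Perm (Fin n)} (h : σ ∈ shuffles n (p + 1) (q + 1) k)
    (hk : σ ⟨k, by omega⟩ ≠ ⟨k, by omega⟩) :
    σ * (simpleRun n (k + 1) (p + 1))⁻¹ ∈ shuffles n (p + 1) q (k + 1) := by
  have hc := simpleRun_apply (n := n) (t := k + 1) (m := p + 1) (by omega) (by omega)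
  set c := simpleRun n (k + 1) (p + 1)
  have hσ : ∀ a, (σ * c⁻¹) (c a) = σ a := fun a => by simp
  obtain ⟨hq, hp⟩ := shuffles_apply_of_ne hn h hk
  refine ⟨fun b hb => ?_, fun b b' hb hbb hb' => ?_, fun b b' hb hbb hb' => ?_⟩
  · obtain ⟨a, rfl⟩ := c.surjective b
    rw [hσ]
    have ha := hc a
    by_cases e : (a : ℕ) = k + (p + 1)
    · rw [if_pos (by omega)] at ha
      obtain rfl : a = ⟨k + (p + 1), hq⟩ := Fin.ext e
      rw [hp]
      exact Fin.ext (by simp only; omega)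
    · rw [if_neg (by omega)] at ha
      rw [h.1 a (by split_ifs at ha <;> omega)]
      exact Fin.ext (by split_ifs at ha <;> omega)
  · obtain ⟨a, rfl⟩ := c.surjective b
    obtain ⟨a', rfl⟩ := c.surjective b'
    rw [hσ, hσ]
    have ha := hc a
    have ha' := hc a'
    rw [Fin.lt_def] at hbb
    exact h.2.1 a a' (by split_ifs at ha ha' <;> omega)
      (by rw [Fin.lt_def]; split_ifs at ha ha' <;> omega) (by split_ifs at ha ha' <;> omega)
  · obtain ⟨a, rfl⟩ := c.surjective b
    obtain ⟨a', rfl⟩ := c.surjective b'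
    rw [hσ, hσ]
    have ha := hc a
    have ha' := hc a'
    rw [Fin.lt_def] at hbb
    exact h.2.2 a a' (by split_ifs at ha ha' <;> omega)
      (by rw [Fin.lt_def]; split_ifs at ha ha' <;> omega) (by split_ifs at ha ha' <;> omega)

theorem bubbleIdx_eq_zero {σ : Perm (Fin n)} {m : ℕ}
    (h : ∀ hm : m < n, ∀ a : Fin n, (a : ℕ) < m → σ a < σ ⟨m, hm⟩) : bubbleIdx σ m = 0 := by
  unfold bubbleIdx
  split_ifs with hm
  · have : (Finset.univ.filter fun a : Fin n => (a : ℕ) < m ∧ σ a < σ ⟨m, hm⟩) =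
        Finset.univ.filter fun a : Fin n => (a : ℕ) < m := by
      ext a
      simp only [Finset.mem_filter, Finset.mem_univ, true_and, and_iff_left_iff_imp]
      exact h hm a
    simp only [this, Fin.card_filter_val_lt]
    rw [if_neg (by omega)]
  · rfl

theorem bubbleIdx_eq_of_apply {σ : Perm (Fin n)} {k m : ℕ} (hm : m < n) (hkm : k < m)
    (h : ∀ a : Fin n, (a : ℕ) < k → σ a = a) (hk : (σ ⟨m, hm⟩ : ℕ) = k) :
    bubbleIdx σ m = k + 1 := by
  have : (Finset.univ.filter fun a : Fin n => (a : ℕ) < m ∧ σ a < σ ⟨m, hm⟩) =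
      Finset.univ.filter fun a : Fin n => (a : ℕ) < k := by
    ext a
    simp only [Finset.mem_filter, Finset.mem_univ, true_and, Fin.lt_def, hk]
    constructor
    · rintro ⟨-, h1⟩
      have h2 := h (σ a) h1
      have := congrArg Fin.val (σ.injective h2)
      omega
    · intro h1
      rw [h a h1]
      omega
  unfold bubbleIdx
  rw [dif_pos hm]
  simp only [this, Fin.card_filter_val_lt]
  rw [min_eq_right (by omega), if_pos (by omega), add_comm]

/-- The bubble index `k + (p + 1)` belongs to the first position of the second part, since positions
are counted from `0`. Its image has rank `k + 1` exactly when it takes the first place of the block.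
For an empty second part at the end of the word, the default `t_n = 0` is what makes this true. -/
theorem bubbleIdx_eq_succ_iff {p q k : ℕ} (hn : k + (p + 1) + q ≤ n) {σ : Perm (Fin n)}
    (h : σ ∈ shuffles n (p + 1) q k) :
    bubbleIdx σ (k + (p + 1)) = k + 1 ↔ σ ⟨k, by omega⟩ ≠ ⟨k, by omega⟩ := by
  constructor
  · intro hb hk
    unfold bubbleIdx at hb
    split_ifs at hb with hm
    · have hcard : (Finset.univ.filter fun a : Fin n => (a : ℕ) < k + 1).card ≤
          (Finset.univ.filter fun a : Fin n =>
            (a : ℕ) < k + (p + 1) ∧ σ a < σ ⟨k + (p + 1), hm⟩).card := by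
        refine Finset.card_le_card fun a => ?_
        simp only [Finset.mem_filter, Finset.mem_univ, true_and]
        intro ha
        refine ⟨by omega, ?_⟩
        have fix : ∀ b : Fin n, (b : ℕ) ≤ k → σ b = b := by
          intro b hb
          rcases Nat.eq_or_lt_of_le hb with e | e
          · rw [show b = ⟨k, by omega⟩ from Fin.ext e]
            exact hk
          · exact h.1 b (by omega)
        rw [fix a (by omega)]
        by_contra hle
        have h1 := σ.injective (fix (σ ⟨k + (p + 1), hm⟩) (by rw [Fin.lt_def] at hle; omega))
        have := congrArg Fin.val h1
        rw [Fin.lt_def] at hle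
        simp only at this
        omega
      rw [Fin.card_filter_val_lt] at hcard
      dsimp only at hb
      split_ifs at hb
      omega
  · intro hk
    obtain ⟨hq, hp⟩ := shuffles_apply_of_ne hn h hk
    exact bubbleIdx_eq_of_apply hq (by omega) (fun a ha => h.1 a (by omega))
      (congrArg Fin.val hp)

theorem bubbleIdx_mul_of_lt {σ c : Perm (Fin n)} {m : ℕ}
    (hc : ∀ a : Fin n, m ≤ (a : ℕ) → c a = a) : bubbleIdx (σ * c) m = bubbleIdx σ m := by
  unfold bubbleIdx
  split_ifs with hm
  · have hlt : ∀ a : Fin n, (c a : ℕ) < m ↔ (a : ℕ) < m := by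
      intro a
      constructor
      · intro h
        by_contra h'
        rw [hc a (by omega)] at h
        exact h' h
      · intro h
        by_contra h'
        have := c.injective (hc (c a) (by omega))
        rw [this] at h'
        exact h' h
    have : (Finset.univ.filter fun a : Fin n => (a : ℕ) < m ∧ σ a < σ ⟨m, hm⟩) =
        (Finset.univ.filter fun a : Fin n =>
          (a : ℕ) < m ∧ (σ * c) a < (σ * c) ⟨m, hm⟩).map c.toEmbedding := by
      ext a
      obtain ⟨a, rfl⟩ := c.surjective a
      simp only [Finset.mem_map_equiv, symm_apply_apply, Finset.mem_filter, Finset.mem_univ,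
        true_and, hlt, Perm.mul_apply, hc ⟨m, hm⟩ le_rfl]
    rw [this, Finset.card_map]
  · rfl

/-- Used to isolate the one factor by which the lifts of a shuffle and of its product with a cycle
differ. -/
theorem prod_reverse_range_map {E : Type*} [Monoid E] (f g : ℕ → E) (N c : ℕ) (hc : c < N)
    (hlt : ∀ m < c, f m = 1) (hg : ∀ m ≤ c, g m = 1) (hgt : ∀ m, c < m → f m = g m) :
    ((List.range N).reverse.map f).prod = ((List.range N).reverse.map g).prod * f c := by
  induction N with
  | zero => omega
  | succ N ih =>
    simp only [List.range_succ, List.reverse_append, List.reverse_singleton, List.singleton_append,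
      List.map_cons, List.prod_cons]
    rcases Nat.lt_or_ge c N with h | h
    · rw [ih h, hgt N h, mul_assoc]
    · obtain rfl : c = N := by omega
      have hone : ∀ u : ℕ → E, (∀ m < c, u m = 1) → ((List.range c).reverse.map u).prod = 1 := by
        intro u hu
        apply List.prod_eq_one
        simp only [List.mem_map, List.mem_reverse, List.mem_range]
        rintro x ⟨m, hm, rfl⟩
        exact hu m hm
      rw [hone f hlt, hone g fun m hm => hg m hm.le, hg c le_rfl]
      simp

variable (K : Type*) [Field K]

theorem liftFactor_of_bubbleIdx_eq_zero {σ : Perm (Fin n)} {m : ℕ} (h : bubbleIdx σ m = 0) :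
    liftFactor K σ m = 1 := by
  simp [liftFactor, h]

theorem lift_one : lift K (1 : Perm (Fin n)) = 1 := by
  apply List.prod_eq_one
  simp only [List.mem_map, List.mem_reverse, List.mem_range]
  rintro x ⟨m, hm, rfl⟩
  exact liftFactor_of_bubbleIdx_eq_zero K (bubbleIdx_eq_zero fun _ a ha => by
    rw [Fin.lt_def]; exact ha)

-- Multiplication by the cycle creates one new bubble component, with `t = k + 1`; the later
-- components are unchanged and the earlier ones are trivial. In its lift the delta removes the
-- merging unless the next index differs from `k + 2`, that is, unless `σ` fixes the second position
-- of the block. In that case the factor merged there comes from the first part, as the recursion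
-- requires.
open Classical in
theorem lift_mul_simpleRun {p q k : ℕ} (hn : k + (p + 1) + (q + 1) ≤ n)
    {σ : Perm (Fin n)} (h : σ ∈ shuffles n (p + 1) q (k + 1)) :
    lift K (σ * simpleRun n (k + 1) (p + 1)) =
      lift K σ * run (sigma K n) (k + 1) (p + 1) +
        (if σ ⟨k + 1, by omega⟩ = ⟨k + 1, by omega⟩ then lift K σ else 0) *
          (merge K n (k + 1) * run (sigma K n) (k + 2) p) := by
  have hc := simpleRun_apply (n := n) (t := k + 1) (m := p + 1) (by omega) (by omega)
  obtain ⟨hmem, hne⟩ := mul_simpleRun_mem_shuffles hn h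
  set c := simpleRun n (k + 1) (p + 1)
  have hfix : ∀ a : Fin n, k + (p + 1) + 1 ≤ (a : ℕ) → c a = a := fun a ha => by
    rw [Fin.ext_iff, hc, if_neg (by omega), if_neg (by omega)]
  have hk := (bubbleIdx_eq_succ_iff (by omega) hmem).2 hne
  have hgt : ∀ m, k + (p + 1) < m → bubbleIdx (σ * c) m = bubbleIdx σ m := fun m hm =>
    bubbleIdx_mul_of_lt fun a ha => hfix a (by omega)
  -- A shuffle is increasing on the first `k + p` positions, so its bubble components there are
  -- trivial.
  have incr : ∀ {τ : Perm (Fin n)} {p q k m : ℕ}, τ ∈ shuffles n p q k → m < k + p →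
      bubbleIdx τ m = 0 := by
    intro τ p q k m hτ hm
    refine bubbleIdx_eq_zero fun hmn a ha => ?_
    have hv : ∀ b : Fin n, (b : ℕ) < k → (τ b : ℕ) = b := fun b hb =>
      congrArg Fin.val (hτ.1 b (Or.inl hb))
    rw [Fin.lt_def]
    rcases Nat.lt_or_ge a k with h1 | h1
    · rw [hv a h1]
      rcases Nat.lt_or_ge m k with h2 | h2
      · rw [hv _ h2]
        exact ha
      · have := shuffles_block hτ ⟨m, hmn⟩ ⟨h2, by simp only; omega⟩
        omega
    · exact hτ.2.1 a ⟨m, hmn⟩ h1 (by rw [Fin.lt_def]; exact ha) hm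
  have hprod : lift K (σ * c) = lift K σ * liftFactor K (σ * c) (k + (p + 1)) := by
    refine prod_reverse_range_map (fun m => liftFactor K (σ * c) (m + 1))
      (fun m => liftFactor K σ (m + 1)) (n - 1) (k + p) (by omega) (fun m hm => ?_)
      (fun m hm => ?_) (fun m hm => ?_)
    · exact liftFactor_of_bubbleIdx_eq_zero K (incr hmem (by omega))
    · exact liftFactor_of_bubbleIdx_eq_zero K (incr h (by omega))
    · simp only [liftFactor, hgt (m + 1) (by omega), hgt (m + 1 + 1) (by omega)]
  have hiff := bubbleIdx_eq_succ_iff (by omega) h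
  have e₀ : bubbleIdx (σ * c) (k + (p + 1) + 1) = bubbleIdx σ (k + 1 + (p + 1)) := by
    rw [hgt _ (Nat.lt_succ_self _), add_right_comm]
  rw [hprod, liftFactor, hk]
  simp only [Nat.add_eq_zero_iff, one_ne_zero, and_false, if_false, Nat.add_sub_cancel,
    sigmaRun_eq_run, merge_succ, show k + (p + 1) - (k + 1) = p by omega]
  have e : k + 1 + 1 = bubbleIdx (σ * c) (k + (p + 1) + 1) ↔
      ¬ σ ⟨k + 1, by omega⟩ = ⟨k + 1, by omega⟩ := by
    rw [eq_comm, e₀]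
    exact hiff
  simp only [e, ite_not, run_succ' _ (k + 1) p]
  split_ifs <;> simp [add_mul, mul_add, mul_assoc]

open Classical in
/-- The shuffles in `𝔖_{p,q}^{↑ k}`. -/
def shuffleFinset (n p q k : ℕ) : Finset (Perm (Fin n)) :=
  Finset.univ.filter (· ∈ shuffles n p q k)

@[simp] theorem mem_shuffleFinset {p q k : ℕ} {σ : Perm (Fin n)} :
    σ ∈ shuffleFinset n p q k ↔ σ ∈ shuffles n p q k := by
  simp [shuffleFinset]

/-- The lifts of the shuffles satisfy the quasi-shuffle recursion. -/
theorem sum_lift_shuffles (k p q : ℕ) : k + p + q ≤ n →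
    ∑ σ ∈ shuffleFinset n p q k, lift K σ =
      qsh (sigma K n) (merge K n) (fun _ => 1) k p q := by
  classical
  have base : ∀ p q k, shuffles n p q k = {1} → ∑ σ ∈ shuffleFinset n p q k, lift K σ = 1 := by
    intro p q k h
    have : shuffleFinset n p q k = {1} := by
      ext σ
      simp [h]
    rw [this, Finset.sum_singleton, lift_one]
  induction k, p, q using qsh_induction with
  | h_left k q =>
    intro _
    rw [base _ _ _ shuffles_zero_left, qsh_zero_left]
  | h_right k p =>
    intro _
    rw [base _ _ _ shuffles_zero_right, qsh_zero_right]
  | h_succ k p q h1 h2 h3 =>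
    intro hn
    have hf : ∀ q k (hn : k + (p + 1) + q ≤ n),
        (shuffleFinset n (p + 1) q k).filter
          (fun σ => σ ⟨k, by omega⟩ = ⟨k, by omega⟩) = shuffleFinset n p q (k + 1) := by
      intro q k hn
      ext σ
      simp only [Finset.mem_filter, mem_shuffleFinset]
      exact (mem_shuffles_succ_iff hn σ).symm
    rw [qsh_succ, ← h1 (by omega), ← h2 (by omega), ← h3 (by omega),
      ← Finset.sum_filter_add_sum_filter_not _
        (fun σ : Perm (Fin n) => σ ⟨k, by omega⟩ = ⟨k, by omega⟩), hf _ _ (by omega), add_assoc]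
    congr 1
    -- The shuffles fixing the first position of the block give the first term of the recursion; the
    -- others, divided by the cycle, give the remaining two through `lift_mul_simpleRun`.
    have hbij : ∑ σ ∈ (shuffleFinset n (p + 1) (q + 1) k).filter
          (fun σ => ¬ σ ⟨k, by omega⟩ = ⟨k, by omega⟩), lift K σ =
        ∑ σ ∈ shuffleFinset n (p + 1) q (k + 1), lift K (σ * simpleRun n (k + 1) (p + 1)) := by
      refine Finset.sum_nbij' (fun σ => σ * (simpleRun n (k + 1) (p + 1))⁻¹)
        (fun σ => σ * simpleRun n (k + 1) (p + 1)) ?_ ?_ ?_ ?_ ?_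
      · intro σ hσ
        simp only [Finset.mem_filter, mem_shuffleFinset] at hσ ⊢
        exact mul_simpleRun_inv_mem_shuffles hn hσ.1 hσ.2
      · intro σ hσ
        simp only [Finset.mem_filter, mem_shuffleFinset] at hσ ⊢
        exact mul_simpleRun_mem_shuffles hn hσ
      · simp
      · simp
      · simp
    rw [hbij, Finset.sum_congr rfl fun σ hσ => lift_mul_simpleRun K hn (mem_shuffleFinset.1 hσ),
      Finset.sum_add_distrib, ← Finset.sum_mul, ← Finset.sum_mul, ← Finset.sum_filter,
      hf _ _ (by omega)]

end Lifting

end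

/-! ### Sums over descent classes as nested quasi-shuffles -/

noncomputable section

namespace Lifting

open Equiv GVB QuasiShuffle

variable {n : ℕ}

theorem shuffles_subset {p q l : ℕ} (hl : l ≤ p) : shuffles n (p - l) q l ⊆ shuffles n p q 0 := by
  rintro σ ⟨h1, h2, h3⟩
  have hv : ∀ b : Fin n, (b : ℕ) < l → (σ b : ℕ) = b := fun b hb =>
    congrArg Fin.val (h1 b (Or.inl hb))
  refine ⟨fun a ha => h1 a (by omega), fun a b _ hab hb => ?_, fun a b ha hab hb =>
    h3 a b (by omega) hab (by omega)⟩
  rcases Nat.lt_or_ge a l with ha | ha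
  · rw [Fin.lt_def] at hab ⊢
    rcases Nat.lt_or_ge b l with hb' | hb'
    · rw [hv a ha, hv b hb']
      exact hab
    · have := block_apply_mem (fun a ha => h1 a ha) b ⟨hb', by omega⟩
      rw [hv a ha]
      omega
  · exact h2 a b ha hab (by omega)

theorem shuffles_subset' {p q l : ℕ} (hl : l ≤ q) : shuffles n p (q - l) 0 ⊆ shuffles n p q 0 := by
  rintro σ ⟨h1, h2, h3⟩
  refine ⟨fun a ha => h1 a (by omega), fun a b h hab hb => h2 a b h hab hb, fun a b ha hab hb => ?_⟩
  rcases Nat.lt_or_ge b (0 + p + (q - l)) with hb' | hb'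
  · exact h3 a b ha hab hb'
  · rw [h1 b (Or.inr hb')]
    rw [Fin.lt_def] at hab ⊢
    rcases Nat.lt_or_ge a (0 + p + (q - l)) with ha' | ha'
    · have := block_apply_mem (fun a ha => h1 a ha) a ⟨Nat.zero_le _, ha'⟩
      omega
    · rw [h1 a (Or.inr ha')]
      exact hab

theorem finRotate_pow_apply (l : ℕ) (hl : l ≤ n) (a : Fin n) :
    ((finRotate n ^ l) a : ℕ) = if (a : ℕ) + l < n then (a : ℕ) + l else (a : ℕ) + l - n := by
  induction l with
  | zero => simp
  | succ l ih =>
    have ih := ih (by omega)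
    obtain ⟨m, rfl⟩ : ∃ m, n = m + 1 := ⟨n - 1, by omega⟩
    rw [pow_succ', Perm.mul_apply]
    by_cases h : (finRotate (m + 1) ^ l) a = Fin.last m
    · have h' := congrArg Fin.val h
      rw [ih] at h'
      simp only [Fin.val_last] at h'
      rw [h, finRotate_last]
      simp only [Fin.val_zero]
      split_ifs at h' ⊢ <;> omega
    · have h' : ((finRotate (m + 1) ^ l) a : ℕ) ≠ m := fun e => h (Fin.ext e)
      rw [coe_finRotate_of_ne_last h, ih]
      rw [ih] at h'
      split_ifs at h' ⊢ <;> omega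

theorem shift_apply (l : ℕ) (σ : Perm (Fin n)) (a : Fin n) :
    shift l σ ((finRotate n ^ l) a) = (finRotate n ^ l) (σ a) := by
  simp [shift]

/-- A shuffle of the first `p + q ≤ n - l` positions lives where rotation by `l` is the
order-preserving map `a ↦ a + l`. -/
theorem shift_mem_shuffles_iff {p q l : ℕ} (hn : l + p + q ≤ n) (σ : Perm (Fin n)) :
    shift l σ ∈ shuffles n p q l ↔ σ ∈ shuffles n p q 0 := by
  have hρ := finRotate_pow_apply (n := n) l (by omega)
  constructor
  · intro h
    have hv : ∀ c : Fin n, ((finRotate n ^ l) (σ c) : ℕ) = shift l σ ((finRotate n ^ l) c) :=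
      fun c => congrArg Fin.val (shift_apply l σ c).symm
    have hb : ∀ c : Fin n, (c : ℕ) < p + q → (σ c : ℕ) < p + q := by
      intro c hc
      have h1 := hρ c
      rw [if_pos (by omega)] at h1
      have h2 := shuffles_block h ((finRotate n ^ l) c) (by omega)
      rw [← hv, hρ] at h2
      split_ifs at h2 <;> omega
    have hlt : ∀ a b : Fin n, (a : ℕ) < p + q → (b : ℕ) < p + q →
        shift l σ ((finRotate n ^ l) a) < shift l σ ((finRotate n ^ l) b) → σ a < σ b := by
      intro a b ha hb' hab
      have h1 := hb a ha
      have h2 := hb b hb'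
      rw [Fin.lt_def, ← hv, ← hv, hρ, hρ, if_pos (by omega), if_pos (by omega)] at hab
      rw [Fin.lt_def]
      omega
    refine ⟨fun c hc => ?_, fun a b _ hab hb' => hlt a b (by omega) (by omega) (h.2.1 _ _ ?_ ?_ ?_),
      fun a b ha hab hb' => hlt a b (by omega) (by omega) (h.2.2 _ _ ?_ ?_ ?_)⟩
    · have h1 := h.1 ((finRotate n ^ l) c) (by rw [hρ]; split_ifs <;> omega)
      rw [shift_apply] at h1
      exact (finRotate n ^ l).injective h1
    all_goals
      have h1 := hρ a
      have h2 := hρ b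
      rw [Fin.lt_def] at hab
      rw [if_pos (by omega)] at h1 h2
      omega
  · intro h
    have hs : ∀ x : Fin n, ∃ c : Fin n, (finRotate n ^ l) c = x := (finRotate n ^ l).surjective
    refine ⟨fun x hx => ?_, fun x y hx hxy hy => ?_, fun x y hx hxy hy => ?_⟩
    · obtain ⟨c, rfl⟩ := hs x
      rw [hρ] at hx
      rw [shift_apply, h.1 c (by split_ifs at hx <;> omega)]
    all_goals
      obtain ⟨a, rfl⟩ := hs x
      obtain ⟨b, rfl⟩ := hs y
      rw [Fin.lt_def] at hxy
      rw [hρ] at hx hxy hy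
      rw [hρ] at hxy
      have ha : (a : ℕ) < p + q := by split_ifs at hx hxy hy <;> omega
      have hb : (b : ℕ) < p + q := by split_ifs at hx hxy hy <;> omega
      have h1 := shuffles_block h a (by omega)
      have h2 := shuffles_block h b (by omega)
      rw [if_pos (by omega)] at hx hxy hy
      rw [if_pos (by omega)] at hxy
      rw [shift_apply, shift_apply, Fin.lt_def, hρ, hρ, if_pos (by omega), if_pos (by omega)]
      have h3 : σ a < σ b := by
        first
        | exact h.2.1 a b (by omega) (by rw [Fin.lt_def]; omega) (by omega)
        | exact h.2.2 a b (by omega) (by rw [Fin.lt_def]; omega) (by omega)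
      rw [Fin.lt_def] at h3
      omega

variable (K : Type*) [Field K]

theorem M_of (p q : ℕ) (σ : Perm (Fin n)) (τ : GVB n) :
    M K p q σ (MonoidAlgebra.of K (GVB n) τ) = M₀ K p q σ τ := by
  simp [M]

theorem M'_of (p q k : ℕ) (σ : Perm (Fin n)) (τ : GVB n) :
    M' K p q k σ (MonoidAlgebra.of K (GVB n) τ) = M₀' K p q k σ τ := by
  simp [M']

theorem linearMap_eq_gradedMul {T : MonoidAlgebra K (GVB n) →ₗ[K] MonoidAlgebra K (GVB n)}
    {f : ℕ → MonoidAlgebra K (GVB n)} (h : ∀ τ, T (MonoidAlgebra.of K (GVB n) τ) =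
      f (virtualLength τ) * MonoidAlgebra.of K (GVB n) τ) : T = gradedMul f := by
  refine LinearMap.ext fun x => ?_
  induction x using MonoidAlgebra.induction_on with
  | of τ => rw [h, gradedMul_of]
  | add x y hx hy => simp only [map_add, hx, hy]
  | smul c x hx => simp only [map_smul, hx]

/-- Summed over all shuffles, the operator depends on `τ` only through its virtual length. The
shuffles contributing for a given `l` are exactly those of the block behind the first `l` positions.
-/
theorem sum_M (p q : ℕ) : ∑ σ ∈ shuffleFinset n p q 0, M K p q σ =
    gradedMul fun l => if l < p then ∑ σ ∈ shuffleFinset n (p - l) q l, lift K σ else 0 := by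
  classical
  refine linearMap_eq_gradedMul K fun τ => ?_
  simp only [LinearMap.sum_apply, M_of, M₀, Q]
  by_cases h : virtualLength τ < p
  · simp only [h, true_and, if_true, Finset.sum_mul]
    rw [← Finset.sum_filter]
    refine Finset.sum_congr ?_ fun σ hσ => ?_
    · ext σ
      simp only [Finset.mem_filter, mem_shuffleFinset]
      exact ⟨fun h => h.2, fun h' => ⟨shuffles_subset h.le h', h'⟩⟩
    · rw [if_pos (mem_shuffleFinset.1 hσ)]
  · simp [h]

/-- After reindexing by `shift l`, the shuffles again act behind the first `l` positions, but here
the second part of the block has become shorter by `l`, not the first. -/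
theorem sum_M' {p q : ℕ} (hn : p + q = n) : ∑ σ ∈ shuffleFinset n p q 0, M' K p q 0 σ =
    gradedMul fun l => if l < q then ∑ σ ∈ shuffleFinset n p (q - l) l, lift K σ else 0 := by
  classical
  refine linearMap_eq_gradedMul K fun τ => ?_
  simp only [LinearMap.sum_apply, M'_of, M₀', Q, zero_add]
  by_cases h : virtualLength τ < q
  · simp only [h, true_and, if_true, Finset.sum_mul]
    rw [← Finset.sum_filter]
    set l := virtualLength τ
    have hsh : ∀ σ : Perm (Fin n), shift l ((finRotate n ^ l)⁻¹ * σ * finRotate n ^ l) = σ := by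
      intro σ
      simp [shift, mul_assoc]
    refine Finset.sum_nbij' (shift l) (fun σ => (finRotate n ^ l)⁻¹ * σ * finRotate n ^ l)
      ?_ ?_ ?_ ?_ ?_
    · intro σ hσ
      simp only [Finset.mem_filter, mem_shuffleFinset] at hσ ⊢
      exact (shift_mem_shuffles_iff (by omega) σ).2 hσ.2
    · intro σ hσ
      simp only [Finset.mem_filter, mem_shuffleFinset] at hσ ⊢
      have : (finRotate n ^ l)⁻¹ * σ * finRotate n ^ l ∈ shuffles n p (q - l) 0 := by
        rw [← shift_mem_shuffles_iff (l := l) (by omega), hsh]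
        exact hσ
      exact ⟨shuffles_subset' h.le this, this⟩
    · intro σ _
      simp [shift, mul_assoc]
    · intro σ _
      exact hsh σ
    · intro σ hσ
      simp only [Finset.mem_filter, mem_shuffleFinset] at hσ
      rw [if_pos ((shift_mem_shuffles_iff (by omega) σ).2 hσ.2)]
  · simp [h]

theorem M_apply_one {p q : ℕ} (hp : 0 < p) {σ : Perm (Fin n)} (hσ : σ ∈ shuffles n p q 0) :
    M K p q σ 1 = lift K σ := by
  rw [← map_one (MonoidAlgebra.of K (GVB n)), M_of, M₀, map_one]
  simp [hp, hσ, Q]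

theorem M'_apply_one {p q k : ℕ} (hq : 0 < q) {σ : Perm (Fin n)} (hσ : σ ∈ shuffles n p q k) :
    M' K p q k σ 1 = lift K σ := by
  rw [← map_one (MonoidAlgebra.of K (GVB n)), M'_of, M₀', map_one]
  simp [hq, hσ, Q, shift]

/-- Uniqueness of the block decomposition makes the pair chosen in `split` the expected one, so that
`split` inverts multiplication. -/
theorem mul_mem_desLE {i j : ℕ} (hij : i < j) (hj : j < n) {l r : Perm (Fin n)}
    (hl : l ∈ shuffles n j (n - j) 0) (hr : r ∈ shuffles n i (j - i) 0) :
    l * r ∈ desLE n {i, j} ∧ split i j (l * r) = (l, r) := by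
  have hu : ∀ p : Perm (Fin n) × Perm (Fin n), p.1 ∈ shuffles n j (n - j) 0 ∧
      p.2 ∈ shuffles n i (j - i) 0 ∧ p.1 * p.2 = l * r → p = (l, r) := by
    rintro p ⟨h1, h2, h3⟩
    exact (existsUnique_block_decomp (l * r) 0 j).unique
      ⟨fun a b ha hab hb => h1.2.1 a b ha hab (by omega), fun a ha => h2.1 a (by omega), h3⟩
      ⟨fun a b ha hab hb => hl.2.1 a b ha hab (by omega), fun a ha => hr.1 a (by omega), rfl⟩
  have hex : ∃ p : Perm (Fin n) × Perm (Fin n), p.1 ∈ shuffles n j (n - j) 0 ∧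
      p.2 ∈ shuffles n i (j - i) 0 ∧ p.1 * p.2 = l * r := ⟨(l, r), hl, hr, rfl⟩
  refine ⟨(mem_desLE_iff_existsUnique hij hj _).2 ⟨(l, r), ⟨hl, hr, rfl⟩, fun p hp => hu p hp⟩, ?_⟩
  rw [split, dif_pos hex]
  exact hu _ hex.choose_spec

theorem mul_mem_desLE' {i j : ℕ} (hij : i < j) (hj : j < n) {l r : Perm (Fin n)}
    (hl : l ∈ shuffles n i (n - i) 0) (hr : r ∈ shuffles n (j - i) (n - j) i) :
    l * r ∈ desLE n {i, j} ∧ split' i j (l * r) = (l, r) := by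
  have hu : ∀ p : Perm (Fin n) × Perm (Fin n), p.1 ∈ shuffles n i (n - i) 0 ∧
      p.2 ∈ shuffles n (j - i) (n - j) i ∧ p.1 * p.2 = l * r → p = (l, r) := by
    rintro p ⟨h1, h2, h3⟩
    exact (existsUnique_block_decomp (l * r) i n).unique
      ⟨fun a b ha hab hb => h1.2.2 a b (by omega) hab (by omega), fun a ha => h2.1 a (by omega), h3⟩
      ⟨fun a b ha hab hb => hl.2.2 a b (by omega) hab (by omega), fun a ha => hr.1 a (by omega),
        rfl⟩
  have hex : ∃ p : Perm (Fin n) × Perm (Fin n), p.1 ∈ shuffles n i (n - i) 0 ∧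
      p.2 ∈ shuffles n (j - i) (n - j) i ∧ p.1 * p.2 = l * r := ⟨(l, r), hl, hr, rfl⟩
  refine ⟨(mem_desLE_iff_existsUnique' hij hj _).2 ⟨(l, r), ⟨hl, hr, rfl⟩, fun p hp => hu p hp⟩, ?_⟩
  rw [split', dif_pos hex]
  exact hu _ hex.choose_spec

theorem sum_desLE {E : Type*} [AddCommMonoid E] {i j : ℕ} (hij : i < j) (hj : j < n)
    (F : Perm (Fin n) × Perm (Fin n) → E) :
    ∑ σ ∈ desLE n {i, j}, F (split i j σ) =
      ∑ l ∈ shuffleFinset n j (n - j) 0, ∑ r ∈ shuffleFinset n i (j - i) 0, F (l, r) := by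
  rw [← Finset.sum_product']
  have hsp : ∀ σ ∈ desLE n {i, j}, (split i j σ).1 ∈ shuffles n j (n - j) 0 ∧
      (split i j σ).2 ∈ shuffles n i (j - i) 0 ∧ (split i j σ).1 * (split i j σ).2 = σ := by
    intro σ hσ
    obtain ⟨p, ⟨h1, h2, rfl⟩, -⟩ := (mem_desLE_iff_existsUnique hij hj σ).1 hσ
    rw [(mul_mem_desLE hij hj h1 h2).2]
    exact ⟨h1, h2, rfl⟩
  refine Finset.sum_nbij' (split i j) (fun p => p.1 * p.2) (fun σ hσ => ?_) (fun p hp => ?_)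
    (fun σ hσ => (hsp σ hσ).2.2) (fun p hp => ?_) fun σ _ => rfl
  · simp only [Finset.mem_product, mem_shuffleFinset]
    exact ⟨(hsp σ hσ).1, (hsp σ hσ).2.1⟩
  · simp only [Finset.mem_product, mem_shuffleFinset] at hp
    exact (mul_mem_desLE hij hj hp.1 hp.2).1
  · simp only [Finset.mem_product, mem_shuffleFinset] at hp
    exact (mul_mem_desLE hij hj hp.1 hp.2).2

theorem sum_desLE' {E : Type*} [AddCommMonoid E] {i j : ℕ} (hij : i < j) (hj : j < n)
    (F : Perm (Fin n) × Perm (Fin n) → E) :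
    ∑ σ ∈ desLE n {i, j}, F (split' i j σ) =
      ∑ l ∈ shuffleFinset n i (n - i) 0, ∑ r ∈ shuffleFinset n (j - i) (n - j) i, F (l, r) := by
  rw [← Finset.sum_product']
  have hsp : ∀ σ ∈ desLE n {i, j}, (split' i j σ).1 ∈ shuffles n i (n - i) 0 ∧
      (split' i j σ).2 ∈ shuffles n (j - i) (n - j) i ∧
        (split' i j σ).1 * (split' i j σ).2 = σ := by
    intro σ hσ
    obtain ⟨p, ⟨h1, h2, rfl⟩, -⟩ := (mem_desLE_iff_existsUnique' hij hj σ).1 hσ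
    rw [(mul_mem_desLE' hij hj h1 h2).2]
    exact ⟨h1, h2, rfl⟩
  refine Finset.sum_nbij' (split' i j) (fun p => p.1 * p.2) (fun σ hσ => ?_) (fun p hp => ?_)
    (fun σ hσ => (hsp σ hσ).2.2) (fun p hp => ?_) fun σ _ => rfl
  · simp only [Finset.mem_product, mem_shuffleFinset]
    exact ⟨(hsp σ hσ).1, (hsp σ hσ).2.1⟩
  · simp only [Finset.mem_product, mem_shuffleFinset] at hp
    exact (mul_mem_desLE' hij hj hp.1 hp.2).1
  · simp only [Finset.mem_product, mem_shuffleFinset] at hp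
    exact (mul_mem_desLE' hij hj hp.1 hp.2).2

/-- The sum of the lifts `Q_{≤ {i,j}}` is the quasi-shuffle product of three blocks, bracketed to
the left. -/
theorem sum_QLE {i j : ℕ} (hi : 1 ≤ i) (hij : i < j) (hj : j < n) :
    ∑ σ ∈ desLE n {i, j}, QLE K i j σ = qsh (sigma K n) (merge K n)
      (fun l => qsh (sigma K n) (merge K n) (fun _ => 1) l (j - l) (n - j)) 0 i (j - i) := by
  have h1 : ∀ f : ℕ → MonoidAlgebra K (GVB n), gradedMul f
      (∑ r ∈ shuffleFinset n i (j - i) 0, lift K r) = qsh (sigma K n) (merge K n) f 0 i (j - i) :=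
    fun f => by rw [sum_lift_shuffles K _ _ _ (by omega), ← qsh_eq_gradedMul _ _ _ _ (by omega)]
  have h2 : ∑ σ ∈ desLE n {i, j}, QLE K i j σ =
      (∑ l ∈ shuffleFinset n j (n - j) 0, M K j (n - j) l)
        (∑ r ∈ shuffleFinset n i (j - i) 0, lift K r) := by
    simp only [QLE]
    rw [sum_desLE hij hj fun p => M K j (n - j) p.1 (M K i (j - i) p.2 1), LinearMap.sum_apply]
    refine Finset.sum_congr rfl fun l _ => ?_
    rw [map_sum]
    refine Finset.sum_congr rfl fun r hr => ?_
    simp only [M_apply_one K (p := i) (by omega) (mem_shuffleFinset.1 hr)]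
  rw [h2, sum_M, h1]
  refine qsh_congr _ _ _ _ _ fun l hp hq => ?_
  -- At most `i < j` mergings can have occurred, so the case in which `M` vanishes never arises.
  rw [if_pos (by omega), sum_lift_shuffles K _ _ _ (by omega)]

/-- The sum of the lifts `Q'_{≤ {i,j}}` is the quasi-shuffle product of three blocks, bracketed to
the right. -/
theorem sum_QLE' {i j : ℕ} (hij : i < j) (hj : j < n) :
    ∑ σ ∈ desLE n {i, j}, QLE' K i j σ = qsh (sigma K n) (merge K n)
      (fun l => qsh (sigma K n) (merge K n) (fun _ => 1) l i (n - i - l)) i (j - i) (n - j) := by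
  have h1 : ∀ f : ℕ → MonoidAlgebra K (GVB n), gradedMul f
      (∑ r ∈ shuffleFinset n (j - i) (n - j) i, lift K r) =
        qsh (sigma K n) (merge K n) f i (j - i) (n - j) :=
    fun f => by rw [sum_lift_shuffles K _ _ _ (by omega), ← qsh_eq_gradedMul _ _ _ _ (by omega)]
  have h2 : ∑ σ ∈ desLE n {i, j}, QLE' K i j σ =
      (∑ l ∈ shuffleFinset n i (n - i) 0, M' K i (n - i) 0 l)
        (∑ r ∈ shuffleFinset n (j - i) (n - j) i, lift K r) := by
    simp only [QLE']
    rw [sum_desLE' hij hj fun p => M' K i (n - i) 0 p.1 (M' K (j - i) (n - j) i p.2 1),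
      LinearMap.sum_apply]
    refine Finset.sum_congr rfl fun l _ => ?_
    rw [map_sum]
    refine Finset.sum_congr rfl fun r hr => ?_
    simp only [M'_apply_one K (q := n - j) (by omega) (mem_shuffleFinset.1 hr)]
  rw [h2, sum_M' K (p := i) (q := n - i) (by omega), h1]
  refine qsh_congr _ _ _ _ _ fun l hp hq => ?_
  rw [if_pos (by omega), sum_lift_shuffles K _ _ _ (by omega)]

/-- Algebra maps commute with `qsh`, so `MergeRel.qsh_assoc` applies to the images of the two nested
quasi-shuffles. -/
theorem rep_sum_QLE {V : Type*} [AddCommGroup V] [Module K V] (A : UnitalBraidedAlgebra K V)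
    {i j : ℕ} (hi : 1 ≤ i) (hij : i < j) (hj : j < n) :
    A.rep n (∑ σ ∈ desLE n {i, j}, QLE K i j σ) =
      A.rep n (∑ σ ∈ desLE n {i, j}, QLE' K i j σ) := by
  rw [sum_QLE K hi hij hj, sum_QLE' K hij hj, ← AlgHom.coe_toRingHom, map_qsh, map_qsh]
  simp only [map_qsh, map_one, AlgHom.coe_toRingHom]
  have := (A.mergeRel_rep (n := n)).qsh_assoc n 0 i (j - i) (n - j) (by omega) (by omega)
  simpa only [zero_add, show i + (j - i) = j by omega, show j - i + (n - j) = n - i by omega]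
    using this

end Lifting

end

/-! ### A representation by letters in which left-over factors are not units -/

noncomputable section

namespace GVB

open TensorSlots UnitalBraidedAlgebra QuasiShuffle

variable {K : Type*} [Field K] {V : Type*} [AddCommGroup V] [Module K V]

/-- The representation of `K[GVB_n^+]` on `V^{⊗ n}` in which `σ_a` and `ξ_a` act through operators
`f` and `g` on `V ⊗ V`. -/
def pairRep (n : ℕ) (f g : Module.End K (V ⊗[K] V))
    (hf : on12 f * on23 f * on12 f = on23 f * on12 f * on23 f)
    (hg : on12 g * on23 g * on12 g = on23 g * on12 g * on23 g)
    (hgf : on12 g * on23 f * on12 f = on23 f * on12 f * on23 g)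
    (hfg : on12 f * on23 f * on12 g = on23 g * on12 f * on23 f) :
    MonoidAlgebra K (GVB n) →ₐ[K] Module.End K (⨂[K]^n V) :=
  MonoidAlgebra.lift K _ _ <| PresentedMonoid.lift
    (fun x : Gen n => match x with
      | .sigma i => adjacentOp f i
      | .xi i => adjacentOp g i) (by
    intro a b h
    cases h with
    | comm_ss i j h => simpa using adjacentOp_comm _ _ i j h
    | comm_sx i j h => simpa using adjacentOp_comm _ _ i j h
    | comm_xx i j h => simpa using adjacentOp_comm _ _ i j h
    | braid_sss i j h => simpa using adjacentOp_word i j h _ _ _ _ _ _ hf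
    | braid_xxx i j h => simpa using adjacentOp_word i j h _ _ _ _ _ _ hg
    | braid_xss i j h => simpa using adjacentOp_word i j h _ _ _ _ _ _ hgf
    | braid_ssx i j h => simpa using (adjacentOp_word i j h _ _ _ _ _ _ hfg).symm)

section pairRep

variable (n : ℕ) (f g : Module.End K (V ⊗[K] V))
    (hf : on12 f * on23 f * on12 f = on23 f * on12 f * on23 f)
    (hg : on12 g * on23 g * on12 g = on23 g * on12 g * on23 g)
    (hgf : on12 g * on23 f * on12 f = on23 f * on12 f * on23 g)
    (hfg : on12 f * on23 f * on12 g = on23 g * on12 f * on23 f)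

theorem pairRep_sigma (a : ℕ) : pairRep n f g hf hg hgf hfg (sigma K n a) = nthOp n f a := by
  unfold sigma nthOp
  split_ifs with h
  · simp [pairRep]
  · simp

theorem pairRep_merge (a : ℕ) : pairRep n f g hf hg hgf hfg (merge K n (a + 1)) =
    run (nthOp n f) 1 a * nthOp n g (a + 1) := by
  rw [merge_succ, map_mul, ← AlgHom.coe_toRingHom, map_run]
  simp only [AlgHom.coe_toRingHom, pairRep_sigma]
  congr 1
  unfold xi nthOp
  split_ifs with h
  · simp [pairRep]
  · simp

end pairRep

/-- Letters of a representation separating the two bracketings of a quasi-shuffle product. -/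
inductive Letter
  | o
  | q
  | u
  | w

namespace Letter

/-- The exchange of letters, where defined. -/
def exchange : Letter → Letter → Option (Letter × Letter)
  | o, o => some (o, o)
  | o, q => some (q, o)
  | u, q => some (q, u)
  | _, _ => none

/-- The merging of letters, where defined. -/
def fuse : Letter → Letter → Option (Letter × Letter)
  | u, u => some (o, u)
  | u, w => some (q, w)
  | _, _ => none

/-- A partial map of pairs of letters, applied to the first two of three letters. -/
def fst₂ (F : Letter → Letter → Option (Letter × Letter)) (t : Letter × Letter × Letter) :
    Option (Letter × Letter × Letter) :=
  (F t.1 t.2.1).map fun p => (p.1, p.2, t.2.2)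

/-- A partial map of pairs of letters, applied to the last two of three letters. -/
def snd₂ (F : Letter → Letter → Option (Letter × Letter)) (t : Letter × Letter × Letter) :
    Option (Letter × Letter × Letter) :=
  (F t.2.1 t.2.2).map fun p => (t.1, p)

variable (K) in
/-- The basis vector of a letter. -/
def vec (a : Letter) : Letter →₀ K := Finsupp.single a 1

variable (K) in
/-- The tensor of a pair of letters, zero if undefined. -/
def vec₂ (t : Option (Letter × Letter)) : (Letter →₀ K) ⊗[K] (Letter →₀ K) :=
  t.elim 0 fun p => vec K p.1 ⊗ₜ vec K p.2

variable (K) in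
/-- The tensor of three letters, zero if undefined. -/
def vec₃ (t : Option (Letter × Letter × Letter)) :
    (Letter →₀ K) ⊗[K] ((Letter →₀ K) ⊗[K] (Letter →₀ K)) :=
  t.elim 0 fun p => vec K p.1 ⊗ₜ (vec K p.2.1 ⊗ₜ vec K p.2.2)

variable (K) in
/-- The operator on `V ⊗ V` given by a partial map of pairs of basis vectors. -/
def pairOp (F : Letter → Letter → Option (Letter × Letter)) :
    Module.End K ((Letter →₀ K) ⊗[K] (Letter →₀ K)) :=
  TensorProduct.lift <| Finsupp.lift _ K _ fun a => Finsupp.lift _ K _ fun b => vec₂ K (F a b)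

theorem pairOp_vec (F : Letter → Letter → Option (Letter × Letter)) (a b : Letter) :
    pairOp K F (vec K a ⊗ₜ vec K b) = vec₂ K (F a b) := by
  simp [pairOp, vec]

theorem on12_pairOp (F : Letter → Letter → Option (Letter × Letter))
    (t : Option (Letter × Letter × Letter)) :
    on12 (pairOp K F) (vec₃ K t) = vec₃ K (t.bind (fst₂ F)) := by
  rcases t with _ | ⟨a, b, c⟩
  · simp [vec₃]
  · have : on12 (pairOp K F) (vec₃ K (some (a, b, c))) =
        TensorProduct.assoc K _ _ _ (vec₂ K (F a b) ⊗ₜ vec K c) := by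
      simp [on12, vec₃, pairOp_vec]
    rw [this]
    rcases h : F a b with _ | ⟨x, y⟩ <;> simp [vec₂, vec₃, fst₂, h]

theorem on23_pairOp (F : Letter → Letter → Option (Letter × Letter))
    (t : Option (Letter × Letter × Letter)) :
    on23 (pairOp K F) (vec₃ K t) = vec₃ K (t.bind (snd₂ F)) := by
  rcases t with _ | ⟨a, b, c⟩
  · simp [vec₃]
  · have : on23 (pairOp K F) (vec₃ K (some (a, b, c))) = vec K a ⊗ₜ vec₂ K (F b c) := by
      simp [on23, vec₃, pairOp_vec]
    rw [this]
    rcases h : F b c with _ | ⟨x, y⟩ <;> simp [vec₂, vec₃, snd₂, h]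

theorem ext_letters {f g : Module.End K ((Letter →₀ K) ⊗[K] ((Letter →₀ K) ⊗[K] (Letter →₀ K)))}
    (h : ∀ t, f (vec₃ K (some t)) = g (vec₃ K (some t))) : f = g := by
  ext a b : 5
  apply LinearMap.ext_ring
  apply Finsupp.lhom_ext'
  intro c
  apply LinearMap.ext_ring
  simpa [vec₃, vec] using h (a, b, c)

/-- These operators map basis words to basis words or to zero, so the defining relations reduce to
comparing partial maps on the finitely many triples of letters. -/
theorem word_eq {F₁ F₂ F₃ G₁ G₂ G₃ : Letter → Letter → Option (Letter × Letter)}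
    (h : ∀ a b c, ((fst₂ F₃ (a, b, c)).bind (snd₂ F₂)).bind (fst₂ F₁) =
      ((snd₂ G₃ (a, b, c)).bind (fst₂ G₂)).bind (snd₂ G₁)) :
    on12 (pairOp K F₁) * on23 (pairOp K F₂) * on12 (pairOp K F₃) =
      on23 (pairOp K G₁) * on12 (pairOp K G₂) * on23 (pairOp K G₃) := by
  refine ext_letters fun ⟨a, b, c⟩ => ?_
  simp only [Module.End.mul_apply, on12_pairOp, on23_pairOp, Option.bind_some, h]

variable (K) in
/-- The representation of `K[GVB_n^+]` by exchanging and merging of letters. -/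
def letterRep (n : ℕ) : MonoidAlgebra K (GVB n) →ₐ[K] Module.End K (⨂[K]^n (Letter →₀ K)) :=
  pairRep n (pairOp K exchange) (pairOp K fuse)
    (word_eq fun a b c => by cases a <;> cases b <;> cases c <;> rfl)
    (word_eq fun a b c => by cases a <;> cases b <;> cases c <;> rfl)
    (word_eq fun a b c => by cases a <;> cases b <;> cases c <;> rfl)
    (word_eq fun a b c => by cases a <;> cases b <;> cases c <;> rfl)

variable (K) in
/-- The pure tensor of a word. -/
def word (n : ℕ) (x : ℕ → Letter) : ⨂[K]^n (Letter →₀ K) := pureTensor K n fun c => vec K (x c)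

variable (K) in
/-- The sum of the coefficients with respect to the basis of words. -/
def coeffSum (n : ℕ) : (⨂[K]^n (Letter →₀ K)) →ₗ[K] K := PiTensorProduct.lift
  ((MultilinearMap.mkPiAlgebra K (Fin n) K).compLinearMap fun _ =>
    Finsupp.lift K K Letter fun _ => 1)

/-- A functional with value `1` on every word detects a single surviving word over any field,
without comparing words with each other. -/
theorem coeffSum_word (n : ℕ) (x : ℕ → Letter) : coeffSum K n (word K n x) = 1 := by
  simp [coeffSum, word, pureTensor, vec]

variable {n : ℕ}

theorem letterRep_sigma_eq_zero {a : ℕ} (ha : a + 1 < n) {x : ℕ → Letter}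
    (h : exchange (x a) (x (a + 1)) = none) :
    letterRep K n (sigma K n (a + 1)) (word K n x) = 0 := by
  rw [letterRep, pairRep_sigma]
  exact nthOp_pureTensor_eq_zero _ ha (by rw [pairOp_vec, h]; rfl)

theorem letterRep_merge {a : ℕ} (ha : a + 1 < n) {x : ℕ → Letter} {e y : Letter}
    (h : fuse (x a) (x (a + 1)) = some (e, y)) (hx : ∀ c < a, exchange (x c) e = some (e, x c)) :
    letterRep K n (merge K n (a + 1)) (word K n x) =
      word K n fun c => if c = 0 then e else if c ≤ a then x (c - 1)
        else if c = a + 1 then y else x c := by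
  rw [letterRep, pairRep_merge, word, run_nthOp_mul_nthOp_pureTensor _ _ a ha (vec K e) (vec K y)]
  · refine pureTensor_congr fun c _ => ?_
    simp only [apply_ite (vec K)]
  · rw [pairOp_vec, h]; rfl
  · intro c hc
    rw [pairOp_vec, hx c hc]; rfl

theorem letterRep_merge_eq_zero_of_blocked {a : ℕ} (ha : a + 2 < n) {x : ℕ → Letter} {e y : Letter}
    (h : fuse (x (a + 1)) (x (a + 2)) = some (e, y))
    (hx : ∀ c, 1 ≤ c → c < a + 1 → exchange (x c) e = some (e, x c))
    (h₀ : exchange (x 0) e = none) :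
    letterRep K n (merge K n (a + 2)) (word K n x) = 0 := by
  rw [letterRep, pairRep_merge, word,
    run_nthOp_mul_nthOp_pureTensor_eq_zero _ _ a ha (vec K e) (vec K y)]
  · rw [pairOp_vec, h]; rfl
  · intro c hc hc'
    rw [pairOp_vec, hx c hc hc']; rfl
  · rw [pairOp_vec, h₀]; rfl

end Letter

end GVB

/-! ### The two sums differ in the monoid algebra -/

namespace Lifting

open GVB QuasiShuffle Letter

variable (K : Type*) [Field K] {n : ℕ}

/-- On the word chosen below the four-term formulas `qsh_qsh_smul_left` and `qsh_qsh_smul_right`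
apply. They share three terms; the double merging is a word in one bracketing and zero in the other.
-/
theorem sum_QLE_ne_sum_QLE' {i j : ℕ} (hi : 1 ≤ i) (hij : i < j) (hj : j < n) :
    ∑ σ ∈ desLE n {i, j}, QLE K i j σ ≠ ∑ σ ∈ desLE n {i, j}, QLE' K i j σ := by
  rw [sum_QLE K hi hij hj, sum_QLE' K hij hj]
  obtain ⟨i, rfl⟩ : ∃ c, i = c + 1 := ⟨i - 1, by omega⟩
  obtain ⟨d, rfl⟩ : ∃ d, j = i + d + 2 := ⟨j - (i + 2), by omega⟩
  obtain ⟨r, rfl⟩ : ∃ r, n = i + d + r + 3 := ⟨n - (i + d + 3), by omega⟩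
  rw [show i + d + 2 - (i + 1) = d + 1 by omega,
    show i + d + r + 3 - (i + d + 2) = r + 1 by omega,
    show i + d + r + 3 - (i + 1) = d + r + 2 by omega]
  obtain ⟨n, hn⟩ : ∃ n, n = i + d + r + 3 := ⟨_, rfl⟩
  rw [← hn]
  -- With `i` lowered by one, the three blocks read `o ⋯ o u`, `u ⋯ u` and `w ⋯ w`. At both
  -- boundaries, `u u` and `u w`, exchange is undefined and merging is defined. The letters `o` let
  -- the left-over `o` of the left boundary reach the front.
  let x : ℕ → Letter := fun c => if c < i then o else if c ≤ i + d + 1 then u else w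
  let v := word K n x
  let s := fun a => letterRep K n (sigma K n a)
  let X := fun a => letterRep K n (merge K n a)
  have hx : ∀ c, x c = if c < i then o else if c ≤ i + d + 1 then u else w := fun c => rfl
  have s_i : s (i + 1) v = 0 := letterRep_sigma_eq_zero (by omega) (by
    simp only [hx]; split_ifs <;> first | rfl | omega)
  have s_j : s (i + d + 2) v = 0 := letterRep_sigma_eq_zero (by omega) (by
    simp only [hx]; split_ifs <;> first | rfl | omega)
  let y : ℕ → Letter := fun c => if c ≤ i then o else if c ≤ i + d + 1 then u else w
  have X_i : X (i + 1) v = word K n y := by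
    refine (letterRep_merge (e := o) (y := u) (by omega) ?_ ?_).trans
      (congrArg (word K n) (funext fun c => ?_))
    · simp only [hx]; split_ifs <;> first | rfl | omega
    · intro c hc
      simp only [hx]; split_ifs; rfl
    · simp only [hx, y]; split_ifs <;> first | rfl | omega
  have s_j_X_i : s (i + d + 2) (X (i + 1) v) = 0 := by
    rw [X_i]
    exact letterRep_sigma_eq_zero (by omega) (by
      simp only [y]; split_ifs <;> first | rfl | omega)
  have X_j_X_i : coeffSum K n (X (i + d + 2) (X (i + 1) v)) = 1 := by
    rw [X_i]
    refine (congrArg _ (letterRep_merge (e := q) (y := w) (by omega) ?_ ?_)).trans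
      (coeffSum_word _ _)
    · simp only [y]; split_ifs <;> first | rfl | omega
    · intro c hc
      simp only [y]; split_ifs <;> first | rfl | omega
  let z : ℕ → Letter := fun c => if c = 0 then q else if c ≤ i then o
    else if c ≤ i + d + 1 then u else w
  have X_j : X (i + d + 2) v = word K n z := by
    refine (letterRep_merge (e := q) (y := w) (by omega) ?_ ?_).trans
      (congrArg (word K n) (funext fun c => ?_))
    · simp only [hx]; split_ifs <;> first | rfl | omega
    · intro c hc
      simp only [hx]; split_ifs <;> first | rfl | omega
    · simp only [hx, z]; split_ifs <;> first | rfl | omega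
  have s_i_X_j : s (i + 2) (X (i + d + 2) v) = 0 := by
    rw [X_j]
    exact letterRep_sigma_eq_zero (by omega) (by
      simp only [z]; split_ifs <;> first | rfl | contradiction | omega)
  have X_i_X_j : X (i + 2) (X (i + d + 2) v) = 0 := by
    rw [X_j]
    -- If the middle block has a single letter, its merging with `w` has used it, and the second
    -- merging is of `u` and `w`, leaving `q`; otherwise it is of `u` and `u`, leaving `o`. In both
    -- cases the `q` already in front blocks the left-over.
    rcases Nat.eq_zero_or_pos d with rfl | hd
    · refine letterRep_merge_eq_zero_of_blocked (e := q) (y := w) (by omega) ?_ ?_ rfl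
      · simp only [z]; split_ifs <;> first | rfl | contradiction | omega
      · intro c hc hc'
        simp only [z]; split_ifs <;> first | rfl | contradiction | omega
    · refine letterRep_merge_eq_zero_of_blocked (e := o) (y := u) (by omega) ?_ ?_ rfl
      · simp only [z]; split_ifs <;> first | rfl | contradiction | omega
      · intro c hc hc'
        simp only [z]; split_ifs <;> first | rfl | contradiction | omega
  intro heq
  have hL := qsh_qsh_smul_left (s := s) (X := X) i d r v s_i s_j s_j_X_i
  have hR := qsh_qsh_smul_right (s := s) (X := X) i d r v s_i s_j s_i_X_j
  have heq' := congrArg (fun x => (letterRep K n).toRingHom x v) heq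
  simp only [map_qsh, map_one] at heq'
  have e : v + X (i + d + 2) v + (X (i + 1) v + X (i + d + 2) (X (i + 1) v)) =
      v + X (i + 1) v + (X (i + d + 2) v + X (i + 2) (X (i + d + 2) v)) :=
    hL.symm.trans (heq'.trans hR)
  rw [X_i_X_j, add_zero] at e
  have e' := congrArg (coeffSum K n) e
  simp only [map_add, X_j_X_i] at e'
  refine one_ne_zero (α := K) ?_
  linear_combination e'

end Lifting

end

theorem corollary3p6 (K : Type*) [Field K] (n i j : ℕ) (hi : 1 ≤ i) (hij : i < j) (hj : j < n) :
    (∀ (V : Type*) [AddCommGroup V] [Module K V] (A : UnitalBraidedAlgebra K V),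
      A.rep n (∑ σ ∈ Lifting.desLE n {i, j}, Lifting.QLE K i j σ) =
        A.rep n (∑ σ ∈ Lifting.desLE n {i, j}, Lifting.QLE' K i j σ)) ∧
    (∑ σ ∈ Lifting.desLE n {i, j}, Lifting.QLE K i j σ) ≠
      ∑ σ ∈ Lifting.desLE n {i, j}, Lifting.QLE' K i j σ :=
  ⟨fun _ _ _ A => Lifting.rep_sum_QLE K A hi hij hj, Lifting.sum_QLE_ne_sum_QLE' K hi hij hj⟩
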